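/- Let $X_1,\dots,X_d\in\mathbb Z^n$ and $\lambda_1,\dots,\lambda_d\in\mathbb R$ be such that $$\Delta=\bigcap_{j=1}^d\{\mu\in(\mathbb R^n)^*\mid\langle\mu,X_j\rangle\ge\lambda_j\}$$ is a smooth pointed polyhedron with normal vectors $X_j$: $\Delta$ is $n$-dimensional, has a vertex, has exactly $d$ facets, the $j$-th one being $\Delta\cap\{\langle\mu,X_j\rangle=\lambda_j\}$, exactly $n$ facets meet at each vertex, and the corresponding $n$ vectors $X_j$ form a basis of $\mathbb Z^n$. *Toric quasifolds.* More generally let $V$ be a finite-dimensional real vector space and $Q\subset V$ a quasilattice (the $\mathbb Z$-span of a finite set of real spanning vectors). A (symplectic) quasifold is a space covered by open subsets homeomorphic to quotients $\tilde U/\Gamma$, where $\tilde U$ is a (symplectic) manifold and $\Gamma$ is a countable group of (symplectic) diffeomorphisms whose set of free points is connected and dense, with changes of charts that lift to (symplectic) diffeomorphisms of the universal coverings. Given a full-dimensional simple pointed polyhedron $\Delta\subset V^*$ with normal vectors $X_1,\dots,X_d\in Q$ and constants $\lambda_j$ as above, let $\pi:\mathbb R^d\to V$, $e_j\mapsto X_j$,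 let $N=\exp(\pi^{-1}(Q))\subset T^d=\mathbb R^d/\mathbb Z^d$, let $J(z)=\sum_j(|z_j|^2+\lambda_j)e_j^*$ on $\mathbb C^d$, and let $\Psi$ be $J$ followed by restriction to $\ker\pi$. The symplectic toric quasifold corresponding to $(\Delta,\{X_j\},Q)$ is $\Psi^{-1}(0)/N$, of dimension $2\dim V$, with its charts at the vertices of $\Delta$: at a vertex lying on the facets $j\in I$, the chart sends $(z_j)_{j\in I}$ to the class of the point of $\Psi^{-1}(0)$ having these coordinates and positive remaining coordinates; its symplectic form in each chart is the standard one. The quasitorus $V/Q\simeq T^d/N$ acts on it with moment mapping $\Phi([z])=(\pi^*)^{-1}(J(z))$. *The statement.* Let $M$ be the symplectic toric manifold corresponding to $(\Delta,\{X_j\},\mathbb Z^n)$, with moment mapping $\Phi:M\to(\mathbb R^n)^*$ for the action of $T^n=\mathbb R^n/\mathbb Z^n$. Let $K$ be any connected Lie subgroup of $T^n$, not necessarily closed; that is, $K=\mathfrak k/(\mathfrak k\cap\mathbb Z^n)$ for a vector subspace $\mathfrak k\subset\mathbb R^n$, of dimension $k$. Let $j:\mathfrak k\to\mathbb R^n$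 be the inclusion, $p:\mathbb R^n\to\mathbb R^n/\mathfrak k$ the projection, and $\Phi_{\mathfrak k}=j^*\circ\Phi$ the moment mapping of the induced action of $K$. Assume that $\Phi_{\mathfrak k}^{-1}(0)$ is non-empty and that $K$ acts on it with $0$-dimensional isotropy groups. Put $$\Delta_{\mathfrak k}=\{\nu\in(\mathbb R^n/\mathfrak k)^*\mid\langle\nu,p(X_j)\rangle\ge\lambda_j,\ j=1,\dots,d\}\;\cong\;\Delta\cap\ker j^*,$$ and number the $X_j$ so that $j=1,\dots,d_{\mathfrak k}$ are the indices for which $\Delta_{\mathfrak k}\cap\{\langle\nu,p(X_j)\rangle=\lambda_j\}$ is a facet of $\Delta_{\mathfrak k}$. Then: 1. $\Delta_{\mathfrak k}$ is a full-dimensional simple pointed polyhedron in $(\mathbb R^n/\mathfrak k)^*$, it is the intersection of its first $d_{\mathfrak k}$ half-spaces, $p(X_1),\dots,p(X_{d_{\mathfrak k}})$ are normal vectors for its $d_{\mathfrak k}$ different facets, and $p(\mathbb Z^n)$ is a quasilattice that contains them; so the symplectic toric quasifold $X_{\mathfrak k}$ corresponding to $(\Delta_{\mathfrak k},\{p(X_1),\dots,p(X_{d_{\mathfrak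 k}})\},p(\mathbb Z^n))$ is defined, and it is a symplectic quasifold. 2. The orbit space $M_{\mathfrak k}=\Phi_{\mathfrak k}^{-1}(0)/K$ is a symplectic quasifold of dimension $2(n-k)$. Its symplectic form $\omega_{\mathfrak k}$ is the reduced one: the projection $\rho:\Phi_{\mathfrak k}^{-1}(0)\to M_{\mathfrak k}$ is smooth and $\rho^*\omega_{\mathfrak k}=\iota^*\omega$, where $\omega$ is the symplectic form of $M$ and $\iota:\Phi_{\mathfrak k}^{-1}(0)\to M$ is the inclusion. 3. The action of $T^n$ induces a smooth action of the quasitorus $T^n/K$ on $M_{\mathfrak k}$ by symplectomorphisms. 4. There is a symplectomorphism $M_{\mathfrak k}\to X_{\mathfrak k}$ that is equivariant with respect to the canonical isomorphism $T^n/K\cong(\mathbb R^n/\mathfrak k)/p(\mathbb Z^n)$. -/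

import Mathlib

open scoped ContDiff Topology

noncomputable section

set_option linter.unusedSectionVars false

/-! ### Symplectic quasifolds -/

/-- Data of a symplectic quasifold chart on `M`: a domain `dom` in the real vector space `E`, a group
`grp` of transformations of `dom`, a map `dom → M` (to induce a homeomorphism of `dom / grp` with an
open subset of `M`), and a 2-form on `dom` (only its values on `dom` matter). -/
structure QChart (E : Type*) [NormedAddCommGroup E] [NormedSpace ℝ E] (M : Type*) where
  dom : Set E
  grp : Subgroup (Equiv.Perm dom)
  map : dom → M
  form : E → E [⋀^Fin 2]→L[ℝ] ℝ

/-- Pull-back of a 2-form by a map, at a point. -/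
def pullbackForm {E F : Type*} [NormedAddCommGroup E] [NormedSpace ℝ E]
    [NormedAddCommGroup F] [NormedSpace ℝ F] (h : E → F) (σ : F → F [⋀^Fin 2]→L[ℝ] ℝ) (x : E) :
    E [⋀^Fin 2]→L[ℝ] ℝ :=
  (σ (h x)).compContinuousLinearMap (fderiv ℝ h x)

namespace QChart

variable {E E' : Type*} [NormedAddCommGroup E] [NormedSpace ℝ E]
  [NormedAddCommGroup E'] [NormedSpace ℝ E'] {M M' : Type*}

/-- `x` lies in the domain of the chart and represents the point `m`. -/
def Rep (a : QChart E M) (x : E) (m : M) : Prop := ∃ h : x ∈ a.dom, a.map ⟨x, h⟩ = m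

/-- The points of the domain with trivial isotropy in the chart group. -/
def freeSet (a : QChart E M) : Set E :=
  {x | ∃ h : x ∈ a.dom, ∀ γ ∈ a.grp, γ ⟨x, h⟩ = ⟨x, h⟩ → γ = 1}

/-- The points in the domain of `a` whose image in `M` lies also in the image of `b`. -/
def overlap (a : QChart E M) (b : QChart E' M) : Set E :=
  {x | ∃ m y, a.Rep x m ∧ b.Rep y m}

/-- Transport of a chart along a map `M → M'`. -/
def push (g : M → M') (a : QChart E M) : QChart E M' where
  dom := a.dom
  grp := a.grp
  map := g ∘ a.map
  form := a.form

/-- The chart is a quasifold chart with a symplectic form: the domain is open; a countable group acts on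
it smoothly, the set of free points being connected and dense; the map induces a homeomorphism from the
orbit space onto an open subset of `M`; the form is smooth, closed, nondegenerate and invariant. -/
structure IsSymplectic [TopologicalSpace M] (a : QChart E M) : Prop where
  isOpen_dom : IsOpen a.dom
  countable_grp : Countable a.grp
  smooth_grp : ∀ γ ∈ a.grp, ∃ h : E → E, ContDiffOn ℝ ∞ h a.dom ∧ (∀ x : a.dom, h x = γ x) ∧
    ∀ x ∈ a.dom, pullbackForm h a.form x = a.form x
  connected_free : IsConnected a.freeSet
  dense_free : a.dom ⊆ closure a.freeSet
  continuous_map : Continuous a.map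
  isOpenMap_map : IsOpenMap a.map
  map_eq_iff : ∀ x y : a.dom, a.map x = a.map y ↔ ∃ γ ∈ a.grp, γ x = y
  smooth_form : ContDiffOn ℝ ∞ a.form a.dom
  closed_form : ∀ x ∈ a.dom, extDeriv a.form x = 0
  nondegenerate_form : ∀ x ∈ a.dom, ∀ u : E, (∀ v : E, a.form x ![u, v] = 0) → u = 0

/-- Compatibility of two charts: if their images meet, the overlaps are submodels (their sets of free
points are connected) and the change of charts is a symplectic diffeomorphism of models, that is, it lifts
to a symplectic diffeomorphism of coverings. The lift is given as a connected space `W` covering both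
overlaps; passing to the universal covering of `W` one gets the diffeomorphism between the universal
coverings of the two overlaps. -/
def Compatible (a : QChart E M) (b : QChart E' M) : Prop :=
  (a.overlap b).Nonempty →
    IsConnected (a.freeSet ∩ a.overlap b) ∧ IsConnected (b.freeSet ∩ b.overlap a) ∧
    ∃ (W : Type) (_ : TopologicalSpace W) (α : W → a.overlap b) (β : W → b.overlap a),
      ConnectedSpace W ∧ IsCoveringMap α ∧ Function.Surjective α ∧
      IsCoveringMap β ∧ Function.Surjective β ∧
      (∀ w, ∃ m, a.Rep (α w) m ∧ b.Rep (β w) m) ∧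
      ∀ w, ∃ (h : E → E') (h' : E' → E),
        ContDiffAt ℝ ∞ h (α w) ∧ ContDiffAt ℝ ∞ h' (β w) ∧
        (∀ᶠ w' in 𝓝 w, h (α w') = β w' ∧ h' (β w') = α w') ∧
        ∀ᶠ x in 𝓝 (α w : E), pullbackForm h b.form x = a.form x

end QChart

section Quasifold

variable {E E' : Type*} [NormedAddCommGroup E] [NormedSpace ℝ E]
  [NormedAddCommGroup E'] [NormedSpace ℝ E'] {M M' : Type*}

/-- The charts in `𝒜` form an atlas that makes `M` a symplectic quasifold, of dimension `dim E`.
(An atlas, not necessarily maximal.) -/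
structure IsSymplecticQuasifold [TopologicalSpace M] (𝒜 : Set (QChart E M)) : Prop where
  chart : ∀ a ∈ 𝒜, a.IsSymplectic
  cover : ∀ m : M, ∃ a ∈ 𝒜, ∃ x, a.Rep x m
  compatible : ∀ a ∈ 𝒜, ∀ b ∈ 𝒜, a.Compatible b

/-- `g` is a symplectomorphism of symplectic quasifolds: a homeomorphism that carries the charts of the
first to charts compatible with those of the second. -/
structure IsSymplectomorphism [TopologicalSpace M] [TopologicalSpace M']
    (𝒜 : Set (QChart E M)) (ℬ : Set (QChart E' M')) (g : M → M') : Prop where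
  homeo : IsHomeomorph g
  compatible : ∀ a ∈ 𝒜, ∀ b ∈ ℬ, (a.push g).Compatible b

/-- A map `act : V → M → M` (an action of `V`, or of a quotient of `V` by a subgroup) is smooth: in charts
it lifts locally, through any pair of corresponding points, to smooth maps. -/
def IsSmoothAction {V : Type*} [NormedAddCommGroup V] [NormedSpace ℝ V]
    (𝒜 : Set (QChart E M)) (act : V → M → M) : Prop :=
  ∀ a ∈ 𝒜, ∀ b ∈ 𝒜, ∀ (v : V) (x y : E) (m : M), a.Rep x m → b.Rep y (act v m) →
    ∃ h : V × E → E, ContDiffAt ℝ ∞ h (v, x) ∧ h (v, x) = y ∧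
      ∀ᶠ p in 𝓝 (v, x), ∃ m', a.Rep p.2 m' ∧ b.Rep (h p) (act p.1 m')

/-- Let `Z ⊆ M` and `ρ : Z → R`. The structures `ℬ` on `M` and `𝒜` on `R` satisfy `ρ^*ω_R = ι^*ω_M`, with
`ρ` smooth and `ι : Z → M` the inclusion: every smooth map `f` into (a chart of) `M` that takes values in `Z`
is sent by `ρ` to a smooth map `f'` into `R`, and `f'^*ω_R = f^*ω_M`. -/
def IsReducedStructure {Z : Set M} {R : Type*} (ℬ : Set (QChart E M)) (ρ : Z → R)
    (𝒜 : Set (QChart E' R)) : Prop :=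
  ∀ b ∈ ℬ, ∀ a ∈ 𝒜, ∀ (p : ℕ) (f : EuclideanSpace ℝ (Fin p) → E) (u₀ : EuclideanSpace ℝ (Fin p))
    (x : E'), ContDiffAt ℝ ∞ f u₀ → (∀ᶠ u in 𝓝 u₀, ∃ z : Z, b.Rep (f u) z) →
    (∃ z : Z, b.Rep (f u₀) z ∧ a.Rep x (ρ z)) →
    ∃ f' : EuclideanSpace ℝ (Fin p) → E', ContDiffAt ℝ ∞ f' u₀ ∧ f' u₀ = x ∧
      ∀ᶠ u in 𝓝 u₀, (∃ z : Z, b.Rep (f u) z ∧ a.Rep (f' u) (ρ z)) ∧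
        pullbackForm f' a.form u = pullbackForm f b.form u

end Quasifold

/-- The standard symplectic form `(1 / 2πi) ∑ dz_j ∧ dz̄_j` on `ℂ^m`. It is normalized so that `∑ |z_j|² e_j^*`
(plus a constant) is the moment mapping for the action `exp(Y) z = (e^{2πi Y_j} z_j)_j`. -/
def stdForm (m : ℕ) : (Fin m → ℂ) [⋀^Fin 2]→L[ℝ] ℝ where
  toFun v := (1 / Real.pi) * ∑ j, ((v 0 j).im * (v 1 j).re - (v 0 j).re * (v 1 j).im)
  map_update_add' v i x y := by
    rw [← mul_add, ← Finset.sum_add_distrib]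
    congr 1
    refine Finset.sum_congr rfl fun j _ => ?_
    fin_cases i <;> simp <;> ring
  map_update_smul' v i c x := by
    rw [smul_eq_mul, mul_left_comm, Finset.mul_sum (a := c)]
    congr 1
    refine Finset.sum_congr rfl fun j _ => ?_
    fin_cases i <;> simp <;> ring
  map_eq_zero_of_eq' v i j h hij := by
    have h01 : v 0 = v 1 := by
      fin_cases i <;> fin_cases j <;> simp_all
    simp only [h01]
    simp [mul_comm]
  cont := by fun_prop

/-! ### The generalized Delzant construction -/

/-- A triple `(Δ, {X_j}, Q)`, where `Δ = {μ ∈ V^* | ⟨μ, X_j⟩ ≥ λ_j}` and `Q` is an additive subgroup of `V`. -/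
structure ToricData (ι V : Type*) [AddCommGroup V] [Module ℝ V] where
  X : ι → V
  lam : ι → ℝ
  Q : AddSubgroup V

/-- `Q` is a quasilattice: the `ℤ`-span of a finite set of real spanning vectors. -/
def IsQuasilattice {V : Type*} [AddCommGroup V] [Module ℝ V] (Q : AddSubgroup V) : Prop :=
  ∃ S : Finset V, Q = AddSubgroup.closure (S : Set V) ∧ Submodule.span ℝ (S : Set V) = ⊤

/-- `F` (a face of the polyhedron `P`) has codimension one in `P`. -/
def IsFacet {W : Type*} [AddCommGroup W] [Module ℝ W] (P F : Set W) : Prop :=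
  F.Nonempty ∧ Module.finrank ℝ (vectorSpan ℝ F) + 1 = Module.finrank ℝ (vectorSpan ℝ P)

namespace ToricData

section Polyhedron

variable {ι V : Type*} [AddCommGroup V] [Module ℝ V] (D : ToricData ι V)

def polyhedron : Set (Module.Dual ℝ V) := {μ | ∀ j, D.lam j ≤ μ (D.X j)}

def face (j : ι) : Set (Module.Dual ℝ V) := {μ ∈ D.polyhedron | μ (D.X j) = D.lam j}

def vertices : Set (Module.Dual ℝ V) := D.polyhedron.extremePoints ℝ

/-- The facets containing `μ`. -/
def active (μ : Module.Dual ℝ V) : Set ι := {j | μ (D.X j) = D.lam j}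

/-- `Δ` is a full-dimensional simple pointed polyhedron, the `X_j` are normal vectors for its (pairwise
different) facets, `Q` is a quasilattice and the `X_j` lie in `Q`. -/
structure IsAdmissible : Prop where
  quasilattice : IsQuasilattice D.Q
  mem_Q : ∀ j, D.X j ∈ D.Q
  nonempty : D.polyhedron.Nonempty
  full : vectorSpan ℝ D.polyhedron = ⊤
  facet : ∀ j, IsFacet D.polyhedron (D.face j)
  face_injective : Function.Injective D.face
  pointed : D.vertices.Nonempty
  simple : ∀ ν ∈ D.vertices, (D.active ν).ncard = Module.finrank ℝ V

end Polyhedron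

/-- The exponential `ℝ^d → T^d`, `Y ↦ (e^{2πi Y_j})_j`, as a subgroup of the maps acting on `ℂ^d`. -/
def expT {ι : Type*} (Y : ι → ℝ) : ι → Circle := fun j => Circle.exp (2 * Real.pi * Y j)

theorem expT_add {ι : Type*} (Y Z : ι → ℝ) : expT (Y + Z) = expT Y * expT Z := by
  funext j; simp [expT, mul_add, Circle.exp_add]

theorem norm_torus_smul {ι : Type*} (t : ι → Circle) (z : ι → ℂ) (j : ι) :
    ‖(t • z) j‖ = ‖z j‖ := by
  change ‖(t j : ℂ) * z j‖ = ‖z j‖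
  rw [norm_mul, Circle.norm_coe, one_mul]

section Construction

variable {ι V : Type*} [Fintype ι] [AddCommGroup V] [Module ℝ V] (D : ToricData ι V)

/-- The linear mapping `π : ℝ^d → V`, `e_j ↦ X_j`. -/
def proj : (ι → ℝ) →ₗ[ℝ] V := Fintype.linearCombination ℝ D.X

/-- The group `N = exp {Y ∈ ℝ^d | π(Y) ∈ Q}`, the kernel of `T^d → V / Q`. -/
def N : Subgroup (ι → Circle) where
  carrier := {t | ∃ Y : ι → ℝ, D.proj Y ∈ D.Q ∧ t = expT Y}
  mul_mem' := by
    rintro _ _ ⟨Y, hY, rfl⟩ ⟨Z, hZ, rfl⟩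
    exact ⟨Y + Z, by rw [map_add]; exact D.Q.add_mem hY hZ, (expT_add Y Z).symm⟩
  one_mem' := ⟨0, by simp, by funext j; simp [expT]⟩
  inv_mem' := by
    rintro _ ⟨Y, hY, rfl⟩
    exact ⟨-Y, by rw [map_neg]; exact D.Q.neg_mem hY, by funext j; simp [expT, Circle.exp_neg]⟩

/-- The level set `Ψ⁻¹(0)`, where `Ψ` is the restriction to `Lie(N) = ker π` of
`J(z) = ∑ (|z_j|² + λ_j) e_j^*`. -/
def levelSet : Set (ι → ℂ) :=
  {z | ∀ Y : ι → ℝ, D.proj Y = 0 → ∑ j, (‖z j‖ ^ 2 + D.lam j) * Y j = 0}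

theorem smul_mem_levelSet (t : ι → Circle) {z : ι → ℂ} (hz : z ∈ D.levelSet) :
    t • z ∈ D.levelSet := by
  intro Y hY
  have h := hz Y hY
  simpa only [norm_torus_smul] using h

/-- The action of the torus `T^d` on `Ψ⁻¹(0)`. -/
def torusAct (t : ι → Circle) (z : D.levelSet) : D.levelSet :=
  ⟨t • z.1, D.smul_mem_levelSet t z.2⟩

/-- The relation of lying in the same `N`-orbit. -/
def orbitSetoid : Setoid D.levelSet where
  r z w := ∃ t ∈ D.N, D.torusAct t z = w
  iseqv :=
    { refl := fun z => ⟨1, D.N.one_mem, Subtype.ext (one_smul _ _)⟩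
      symm := by
        rintro z _ ⟨t, ht, rfl⟩
        exact ⟨t⁻¹, D.N.inv_mem ht, Subtype.ext (inv_smul_smul t z.1)⟩
      trans := by
        rintro z _ _ ⟨t, ht, rfl⟩ ⟨s, hs, rfl⟩
        exact ⟨s * t, D.N.mul_mem hs ht, Subtype.ext (mul_smul s t z.1)⟩ }

/-- The space `Ψ⁻¹(0) / N`. -/
def Space : Type _ := Quotient D.orbitSetoid

instance : TopologicalSpace D.Space :=
  inferInstanceAs (TopologicalSpace (Quotient D.orbitSetoid))

/-- The class `[z]` in `Ψ⁻¹(0) / N`. -/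
def cls (z : D.levelSet) : D.Space := Quotient.mk D.orbitSetoid z

theorem cls_eq_iff {z w : D.levelSet} : D.cls z = D.cls w ↔ ∃ t ∈ D.N, D.torusAct t z = w :=
  Quotient.eq (r := D.orbitSetoid)

theorem exists_moment (z : D.levelSet) :
    ∃ μ : Module.Dual ℝ V, ∀ j, μ (D.X j) = ‖z.1 j‖ ^ 2 + D.lam j := by
  classical
  let J : Module.Dual ℝ (ι → ℝ) := Fintype.linearCombination ℝ fun j => ‖z.1 j‖ ^ 2 + D.lam j
  have hJ : J ∈ (LinearMap.ker D.proj).dualAnnihilator := by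
    rw [Submodule.mem_dualAnnihilator]
    intro Y hY
    have h := z.2 Y (LinearMap.mem_ker.1 hY)
    simpa [J, Fintype.linearCombination_apply, mul_comm] using h
  rw [← LinearMap.range_dualMap_eq_dualAnnihilator_ker] at hJ
  obtain ⟨μ, hμ⟩ := hJ
  refine ⟨μ, fun j => ?_⟩
  have h := LinearMap.congr_fun hμ (Pi.single j 1)
  simpa [J, proj] using h

/-- The moment mapping `Φ([z]) = (π^*)⁻¹(J(z))`: the functional with `⟨Φ([z]), X_j⟩ = |z_j|² + λ_j`. -/
def moment (x : D.Space) : Module.Dual ℝ V :=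
  Classical.epsilon fun μ => ∀ z, D.cls z = x → ∀ j, μ (D.X j) = ‖z.1 j‖ ^ 2 + D.lam j

theorem moment_cls (z : D.levelSet) (j : ι) :
    D.moment (D.cls z) (D.X j) = ‖z.1 j‖ ^ 2 + D.lam j := by
  have hex : ∃ μ : Module.Dual ℝ V, ∀ w, D.cls w = D.cls z →
      ∀ j, μ (D.X j) = ‖w.1 j‖ ^ 2 + D.lam j := by
    obtain ⟨μ, hμ⟩ := D.exists_moment z
    refine ⟨μ, fun w hw j => ?_⟩
    obtain ⟨t, -, rfl⟩ := D.cls_eq_iff.1 hw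
    rw [hμ]
    simp only [torusAct, norm_torus_smul]
  exact Classical.epsilon_spec hex z rfl j

/-- The action of `T^d` induced on `Ψ⁻¹(0) / N`. -/
def torusActSpace (t : ι → Circle) : D.Space → D.Space :=
  Quotient.map (D.torusAct t) (by
    rintro z _ ⟨s, hs, rfl⟩
    exact ⟨s, hs, Subtype.ext (smul_comm s t z.1)⟩)

theorem torusActSpace_cls (t : ι → Circle) (z : D.levelSet) :
    D.torusActSpace t (D.cls z) = D.cls (D.torusAct t z) := rfl

theorem torusActSpace_comm (s t : ι → Circle) (x : D.Space) :
    D.torusActSpace s (D.torusActSpace t x) = D.torusActSpace t (D.torusActSpace s x) := by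
  induction x using Quotient.inductionOn with
  | h z => exact congrArg D.cls (Subtype.ext (smul_comm s t z.1))

/-- The action of the quasitorus `V / Q ≃ T^d / N`: the class of `π(Y)` acts as `exp(Y)`
(see `act_cls`; `π` is onto, the polyhedron being pointed). -/
def act (q : V ⧸ D.Q) : D.Space → D.Space :=
  D.torusActSpace (expT (Function.invFun
    (fun Y : ι → ℝ => (QuotientAddGroup.mk (D.proj Y) : V ⧸ D.Q)) q))

theorem act_cls (Y : ι → ℝ) (z : D.levelSet) :
    D.act (QuotientAddGroup.mk (D.proj Y)) (D.cls z) = D.cls (D.torusAct (expT Y) z) := by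
  set f : (ι → ℝ) → V ⧸ D.Q := fun Y => QuotientAddGroup.mk (D.proj Y) with hf
  have h : f (Function.invFun f (f Y)) = f Y := Function.invFun_eq ⟨Y, rfl⟩
  set Y' := Function.invFun f (f Y) with hY'
  have hQ : D.proj (Y - Y') ∈ D.Q := by
    have := QuotientAddGroup.eq.1 h
    rwa [neg_add_eq_sub, ← map_sub] at this
  change D.cls (D.torusAct (expT Y') z) = _
  refine D.cls_eq_iff.2 ⟨expT (Y - Y'), ⟨_, hQ, rfl⟩, Subtype.ext ?_⟩
  change expT (Y - Y') • expT Y' • z.1 = expT Y • z.1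
  rw [← mul_smul, ← expT_add, sub_add_cancel]

theorem act_comm (p q : V ⧸ D.Q) (x : D.Space) : D.act p (D.act q x) = D.act q (D.act p x) :=
  D.torusActSpace_comm _ _ x

theorem moment_act (q : V ⧸ D.Q) (x : D.Space) : D.moment (D.act q x) = D.moment x := by
  have key : ∀ (t : ι → Circle) (w : D.Space), (fun μ : Module.Dual ℝ V =>
      ∀ z, D.cls z = D.torusActSpace t w → ∀ j, μ (D.X j) = ‖z.1 j‖ ^ 2 + D.lam j) =
      fun μ => ∀ z, D.cls z = w → ∀ j, μ (D.X j) = ‖z.1 j‖ ^ 2 + D.lam j := by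
    intro t w
    funext μ
    refine propext ⟨fun h z hz j => ?_, fun h z hz j => ?_⟩
    · rw [h (D.torusAct t z) (by rw [← hz]; rfl) j]
      simp only [torusAct, norm_torus_smul]
    · have h1 : D.cls (D.torusAct t⁻¹ z) = w := by
        rw [← D.torusActSpace_cls, hz]
        induction w using Quotient.inductionOn with
        | h w => exact congrArg D.cls (Subtype.ext (inv_smul_smul t w.1))
      have h2 := h _ h1 j
      simpa only [torusAct, norm_torus_smul] using h2
  unfold moment
  exact congrArg Classical.epsilon (key _ x)

/-- A vertex `ν` of `Δ` with an ordering `X_{e 1}, …, X_{e m}` of the normal vectors of the facets that meet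
at `ν`; they form a basis of `V`. -/
structure VertexFrame (m : ℕ) where
  ν : Module.Dual ℝ V
  isVertex : ν ∈ D.vertices
  e : Fin m ↪ ι
  range_e : Set.range e = D.active ν
  basis : Module.Basis (Fin m) ℝ V
  basis_eq : ∀ h, basis h = D.X (e h)

namespace VertexFrame

variable {D} {m : ℕ} (F : D.VertexFrame m)

/-- `∑_h a_{jh} (|z_h|² + λ_h) - λ_j`, where `X_j = ∑_h a_{jh} X_h`. -/
def height (z : Fin m → ℂ) (j : ι) : ℝ :=
  ∑ h, F.basis.repr (D.X j) h * (‖z h‖ ^ 2 + D.lam (F.e h)) - D.lam j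

/-- The open set `Ũ_ν ⊆ ℂ^m`. -/
def dom : Set (Fin m → ℂ) := {z | ∀ j, j ∉ Set.range F.e → 0 < F.height z j}

/-- The point of `ℂ^d` with coordinates `z_h` at the facets through `ν`, and
`w_j = √(∑_h a_{jh} (|z_h|² + λ_h) - λ_j)` at the others. -/
def lift (z : Fin m → ℂ) : ι → ℂ :=
  Function.extend F.e z fun j => ((Real.sqrt (F.height z j) : ℝ) : ℂ)

theorem norm_lift {z : Fin m → ℂ} (hz : z ∈ F.dom) (j : ι) :
    ‖F.lift z j‖ ^ 2 + D.lam j =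
      ∑ h, F.basis.repr (D.X j) h * (‖z h‖ ^ 2 + D.lam (F.e h)) := by
  by_cases hj : ∃ i, F.e i = j
  · obtain ⟨i, rfl⟩ := hj
    rw [lift, F.e.injective.extend_apply, ← F.basis_eq]
    simp [Finsupp.single_apply, ite_mul]
  · have h0 := hz j (fun h => hj h)
    rw [lift, Function.extend_apply' _ _ _ hj, Complex.norm_real, Real.norm_eq_abs,
      sq_abs, Real.sq_sqrt h0.le, height]
    ring

theorem lift_mem {z : Fin m → ℂ} (hz : z ∈ F.dom) : F.lift z ∈ D.levelSet := by
  intro Y hY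
  have h0 : ∀ h, ∑ j, F.basis.repr (D.X j) h * Y j = 0 := by
    intro h
    have := congrArg (fun v => F.basis.repr v h) hY
    simpa [proj, Fintype.linearCombination_apply, Finsupp.finsetSum_apply, mul_comm] using this
  calc ∑ j, (‖F.lift z j‖ ^ 2 + D.lam j) * Y j
      = ∑ j, ∑ h, (‖z h‖ ^ 2 + D.lam (F.e h)) * (F.basis.repr (D.X j) h * Y j) := by
        refine Finset.sum_congr rfl fun j _ => ?_
        rw [F.norm_lift hz, Finset.sum_mul]
        exact Finset.sum_congr rfl fun h _ => by ring
    _ = 0 := by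
        rw [Finset.sum_comm]
        simp only [← Finset.mul_sum, h0, mul_zero, Finset.sum_const_zero]

/-- The group `Γ_ν = N ∩ {t | t_j = 1 for the facets j not containing ν}`, acting on `Ũ_ν`. -/
def grp : Subgroup (Equiv.Perm F.dom) where
  carrier := {σ | ∃ t ∈ D.N, (∀ j, j ∉ Set.range F.e → t j = 1) ∧
    ∀ z h, (σ z).1 h = t (F.e h) • z.1 h}
  mul_mem' := by
    rintro σ τ ⟨t, ht, ht', hσ⟩ ⟨s, hs, hs', hτ⟩
    refine ⟨t * s, D.N.mul_mem ht hs, fun j hj => by simp [ht' j hj, hs' j hj], fun z h => ?_⟩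
    rw [Equiv.Perm.mul_apply, hσ, hτ, Pi.mul_apply, mul_smul]
  one_mem' := ⟨1, D.N.one_mem, by simp, by simp⟩
  inv_mem' := by
    rintro σ ⟨t, ht, ht', hσ⟩
    refine ⟨t⁻¹, D.N.inv_mem ht, fun j hj => by simp [ht' j hj], fun z h => ?_⟩
    have := hσ (σ⁻¹ z) h
    rw [show σ (σ⁻¹ z) = z from σ.apply_symm_apply z] at this
    rw [this, Pi.inv_apply, inv_smul_smul]

/-- The symplectic quasifold chart `(U_ν, ρ_ν, Ũ_ν / Γ_ν)`, `ρ_ν([z]) = [z : w]`. -/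
def chart : QChart (Fin m → ℂ) D.Space where
  dom := F.dom
  grp := F.grp
  map z := D.cls ⟨F.lift z.1, F.lift_mem z.2⟩
  form _ := stdForm m

end VertexFrame

/-- The atlas of the symplectic toric quasifold (of dimension `2m`, `m = dim V`) corresponding to
`(Δ, {X_j}, Q)`, indexed by the vertices of `Δ` and the orderings of the facets through them. -/
def atlas (m : ℕ) : Set (QChart (Fin m → ℂ) D.Space) := Set.range fun F : D.VertexFrame m => F.chart

end Construction

/-! ### Symplectic reduction -/

section Reduction

variable {ι V : Type*} [Fintype ι] [AddCommGroup V] [Module ℝ V] (D : ToricData ι V)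
  (𝔨 : Submodule ℝ V)

/-- The subgroup `K = 𝔨 / (𝔨 ∩ Q)` of `V / Q`, that is, the image of `𝔨`. -/
def subgroupK : AddSubgroup (V ⧸ D.Q) := 𝔨.toAddSubgroup.map (QuotientAddGroup.mk' D.Q)

/-- The moment mapping `Φ_𝔨 = j^* ∘ Φ` of the action of `K`, with `j : 𝔨 → V` the inclusion. -/
def momentK (x : D.Space) : Module.Dual ℝ 𝔨 := 𝔨.subtype.dualMap (D.moment x)

/-- The level set `Φ_𝔨⁻¹(0)`. -/
def zeroLevel : Set D.Space := {x | D.momentK 𝔨 x = 0}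

/-- The isotropy groups of `K` on `Φ_𝔨⁻¹(0)` are 0-dimensional: their Lie algebras
`{Y ∈ 𝔨 | exp(tY) x = x for all t}` vanish. -/
def ZeroDimIsotropy : Prop :=
  ∀ x ∈ D.zeroLevel 𝔨, ∀ Y ∈ 𝔨,
    (∀ t : ℝ, D.act (QuotientAddGroup.mk (t • Y)) x = x) → Y = 0

/-- The action of `V / Q` on `Φ_𝔨⁻¹(0)`. -/
def actZero (q : V ⧸ D.Q) (x : D.zeroLevel 𝔨) : D.zeroLevel 𝔨 :=
  ⟨D.act q x.1, by
    have h := x.2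
    simp only [zeroLevel, momentK, Set.mem_ofPred_eq, moment_act] at h ⊢
    exact h⟩

/-- The reduced space `Φ_𝔨⁻¹(0) / K`. -/
def Reduced : Type _ :=
  Quot fun x y : D.zeroLevel 𝔨 => ∃ κ ∈ D.subgroupK 𝔨, D.actZero 𝔨 κ x = y

instance : TopologicalSpace (D.Reduced 𝔨) :=
  inferInstanceAs (TopologicalSpace (Quot _))

/-- The projection `ρ : Φ_𝔨⁻¹(0) → Φ_𝔨⁻¹(0) / K`. -/
def toReduced (x : D.zeroLevel 𝔨) : D.Reduced 𝔨 := Quot.mk _ x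

/-- The map of `Φ_𝔨⁻¹(0) / K` induced by an element of `V / Q`. -/
def reducedAct (q : V ⧸ D.Q) : D.Reduced 𝔨 → D.Reduced 𝔨 :=
  Quot.map (D.actZero 𝔨 q) (by
    rintro x _ ⟨κ, hκ, rfl⟩
    exact ⟨κ, hκ, Subtype.ext (D.act_comm κ q x.1)⟩)

/-- The polyhedron `Δ_𝔨 = {ν ∈ (V / 𝔨)^* | ⟨ν, p(X_j)⟩ ≥ λ_j for all j}` (that is, `Δ ∩ ker j^*`), presented
by all the half-spaces, with `p : V → V / 𝔨` the projection, and `p(Q)`. -/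
def slice : ToricData ι (V ⧸ 𝔨) where
  X j := 𝔨.mkQ (D.X j)
  lam := D.lam
  Q := D.Q.map 𝔨.mkQ.toAddMonoidHom

open Classical in
/-- The indices of the half-spaces that cut out facets of `Δ_𝔨`. -/
def sliceFacets : Finset ι :=
  Finset.univ.filter fun j => IsFacet (D.slice 𝔨).polyhedron ((D.slice 𝔨).face j)

/-- The triple `(Δ_𝔨, {p(X_j)}, p(Q))`, where `j` runs through the facets of `Δ_𝔨`. -/
def reducedData : ToricData {j // j ∈ D.sliceFacets 𝔨} (V ⧸ 𝔨) where
  X j := (D.slice 𝔨).X j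
  lam j := (D.slice 𝔨).lam j
  Q := (D.slice 𝔨).Q

/-- The canonical homomorphism `(V / Q) / K → (V / 𝔨) / p(Q)`, `[[v]] ↦ [p(v)]`. -/
def residualHom : (V ⧸ D.Q) ⧸ D.subgroupK 𝔨 →+ (V ⧸ 𝔨) ⧸ (D.reducedData 𝔨).Q :=
  QuotientAddGroup.lift (D.subgroupK 𝔨)
    (QuotientAddGroup.lift D.Q
      ((QuotientAddGroup.mk' (D.reducedData 𝔨).Q).comp 𝔨.mkQ.toAddMonoidHom)
      (fun q hq => (QuotientAddGroup.eq_zero_iff _).2 ⟨q, hq, rfl⟩))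
    (by
      rintro _ ⟨Y, hY, rfl⟩
      have : 𝔨.mkQ Y = 0 := (Submodule.Quotient.mk_eq_zero 𝔨).2 hY
      change (QuotientAddGroup.mk (𝔨.mkQ Y) : (V ⧸ 𝔨) ⧸ (D.reducedData 𝔨).Q) = 0
      rw [this]; rfl)

theorem residualHom_bijective : Function.Bijective (D.residualHom 𝔨) := by
  constructor
  · rw [injective_iff_map_eq_zero]
    intro a
    induction a using QuotientAddGroup.induction_on with
    | H b =>
      induction b using QuotientAddGroup.induction_on with
      | H v =>
        intro h
        change (QuotientAddGroup.mk (𝔨.mkQ v) : (V ⧸ 𝔨) ⧸ (D.reducedData 𝔨).Q) = 0 at h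
        obtain ⟨q, hq, hqv⟩ := (QuotientAddGroup.eq_zero_iff _).1 h
        have hk : v - q ∈ 𝔨 := by
          rw [← Submodule.Quotient.mk_eq_zero, Submodule.Quotient.mk_sub, sub_eq_zero]
          exact hqv.symm
        refine (QuotientAddGroup.eq_zero_iff _).2 ⟨v - q, hk, ?_⟩
        have h0 : (QuotientAddGroup.mk q : V ⧸ D.Q) = 0 := (QuotientAddGroup.eq_zero_iff _).2 hq
        change (QuotientAddGroup.mk (v - q) : V ⧸ D.Q) = _
        rw [QuotientAddGroup.mk_sub, h0, sub_zero]
  · intro a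
    induction a using QuotientAddGroup.induction_on with
    | H b =>
      obtain ⟨v, rfl⟩ := 𝔨.mkQ_surjective b
      exact ⟨QuotientAddGroup.mk (QuotientAddGroup.mk v), rfl⟩

end Reduction

end ToricData

/-- The lattice `ℤⁿ` in `ℝⁿ`. -/
def intLattice (n : ℕ) : AddSubgroup (Fin n → ℝ) :=
  AddMonoidHom.range ((Int.castAddHom ℝ).compLeft (Fin n))

/-- The triple `(Δ, {X_1, …, X_d}, ℤⁿ)`. -/
def latticeData {n d : ℕ} (X : Fin d → Fin n → ℝ) (lam : Fin d → ℝ) : ToricData (Fin d) (Fin n → ℝ) where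
  X := X
  lam := lam
  Q := intLattice n

/-- `Δ = {μ | ⟨μ, X_j⟩ ≥ λ_j}` is a smooth pointed polyhedron in `(ℝⁿ)^*`: it is full-dimensional, simple and
pointed, the `X_j` are normal vectors for its facets, and for each vertex the normal vectors of the facets
through it form a basis of `ℤⁿ`. -/
structure IsSmoothPolyhedron {n d : ℕ} (X : Fin d → Fin n → ℝ) (lam : Fin d → ℝ) : Prop where
  admissible : (latticeData X lam).IsAdmissible
  linearIndependent : ∀ ν ∈ (latticeData X lam).vertices,
    LinearIndependent ℤ fun j : (latticeData X lam).active ν => X j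
  span : ∀ ν ∈ (latticeData X lam).vertices,
    AddSubgroup.closure (X '' (latticeData X lam).active ν) = intLattice n

end

/-!
Let `D` be a triple `(Δ, {X_j}, Q)` and `𝔨` a subspace of `V`. The proof separates the combinatorics of
the slice `Δ_𝔨 = Δ ∩ ker j^*` from the local geometry of the quotients `Ψ⁻¹(0) / N`.

*Combinatorics.* Call a presentation of a polyhedron regular if the normal vectors that are active at a point of
it are linearly independent (`ToricData.IsRegular`). Admissible triples are regular. At a point of the zero level
over `μ ∈ Δ` the isotropy algebra of `V` is the span of the active normal vectors, so 0-dimensional isotropy of `K`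
says exactly that `𝔨` meets these spans trivially, that is, that the slice is regular again
(`IsRegular.slice`). In a regular presentation every half-space whose face is nonempty cuts out a facet, different
ones cut out different facets, and those with empty face are redundant; so the facets of the slice give an
admissible triple with the same polyhedron (`IsRegular.isAdmissible_restrict`).

*Toric quasifolds.* The space of a regular triple is a symplectic quasifold with the vertex charts
(`VertexFrame.isSymplectic_chart`, `IsRegular.isSymplecticQuasifold`). The reason is that two points of a chart
at a vertex represent the same class exactly if `exp(Y)` carries one lift to the other for some `Y` with
`π(Y) ∈ Q`, and that a point of the level set near the image of the chart is moved into the slice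
of the chart (the points with positive coordinates at the facets away from the vertex) by `exp(δ)`, with
`δ ∈ ker π` depending smoothly on the point (`VertexFrame.exists_local_lift`).
Along such a motion the form does not change: the difference is `∑ d|ζ_j|² ∧ dδ_j`, and it vanishes because
`∑ |ζ_j|² Y_j` is constant on the level set for each `Y ∈ ker π`. A change of charts, followed by an element of
the quasitorus, lifts to the space of pairs `(z, Y)` such that `exp(Y)` moves the lift of `z` into the slice of the
other chart (`VertexFrame.transitionSet`); this is a covering of both overlaps, with countable discrete groups of
deck translations in `Y` (`VertexFrame.compatible_act`).

*Reduction.* A point `z` of the level set of `D` represents a point of `Φ_𝔨⁻¹(0)` exactly if it lies in the level set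
of the slice, and two such points are in the same orbit of `N` and `K` exactly if they are in the same orbit
of the group of the slice (`sliceHomeo`). On the level set of the slice the coordinates of redundant half-spaces do not
vanish, so they can be made positive, and the rest is the level set of the reduced triple
(`IsSufficient.homeo`). This gives an equivariant homeomorphism from the toric quasifold of the reduced polyhedron
to the reduced space (`reducedHomeo`); the atlas is transported along it, so that it becomes a symplectomorphism,
and what remains to be seen is that the transported form is the reduced one (`isReducedStructure`), which is again the
local straightening by `exp(ker π)`.
-/

noncomputable section

set_option linter.unusedSectionVars false

/-! ### Polyhedra whose active normal vectors are linearly independent -/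

namespace ToricData

section Regular

variable {ι V : Type*} [AddCommGroup V] [Module ℝ V] (D : ToricData ι V)

/-- The part of admissibility that the charts need: the half-spaces may be redundant, but the normal
vectors of the ones that are tight at any given point of the polyhedron are linearly independent. -/
structure IsRegular : Prop where
  countable : (D.Q : Set V).Countable
  mem_Q : ∀ j, D.X j ∈ D.Q
  span : Submodule.span ℝ (Set.range D.X) = ⊤
  linearIndependent : ∀ μ ∈ D.polyhedron, LinearIndependent ℝ fun j : D.active μ => D.X j

variable {D}

theorem eventually_lt_of_not_active [Finite ι] {μ : Module.Dual ℝ V} (hμ : μ ∈ D.polyhedron)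
    (ξ : Module.Dual ℝ V) :
    ∀ᶠ t : ℝ in 𝓝 0, ∀ j, j ∉ D.active μ → D.lam j < (μ + t • ξ) (D.X j) := by
  rw [Filter.eventually_all]
  intro j
  by_cases hj : j ∈ D.active μ
  · exact Filter.Eventually.of_forall fun t h => absurd hj h
  · have h1 : D.lam j < μ (D.X j) := lt_of_le_of_ne (hμ j) fun h => hj h.symm
    have h2 : Filter.Tendsto (fun t : ℝ => (μ + t • ξ) (D.X j)) (𝓝 0) (𝓝 (μ (D.X j))) := by
      have : Continuous fun t : ℝ => μ (D.X j) + t * ξ (D.X j) := by fun_prop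
      simpa using this.tendsto 0
    exact (h2.eventually (lt_mem_nhds h1)).mono fun t h _ => h

theorem eventually_mem_polyhedron [Finite ι] {μ : Module.Dual ℝ V} (hμ : μ ∈ D.polyhedron)
    {ξ : Module.Dual ℝ V} (hξ : ∀ j ∈ D.active μ, ξ (D.X j) = 0) :
    ∀ᶠ t : ℝ in 𝓝 0, μ + t • ξ ∈ D.polyhedron := by
  filter_upwards [eventually_lt_of_not_active hμ ξ] with t ht j
  by_cases hj : j ∈ D.active μ
  · have : μ (D.X j) = D.lam j := hj
    simp [hξ j hj, this]
  · exact (ht j hj).le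

theorem exists_dual_ne_zero {s : Set V} (hs : Submodule.span ℝ s ≠ ⊤) :
    ∃ ξ : Module.Dual ℝ V, ξ ≠ 0 ∧ ∀ v ∈ s, ξ v = 0 := by
  obtain ⟨ξ, h0, h⟩ := Submodule.exists_le_ker_of_lt_top _ (lt_top_iff_ne_top.2 hs)
  exact ⟨ξ, h0, fun v hv => h (Submodule.subset_span hv)⟩

theorem span_active_of_mem_vertices [Finite ι] {ν : Module.Dual ℝ V} (hν : ν ∈ D.vertices) :
    Submodule.span ℝ (D.X '' D.active ν) = ⊤ := by
  by_contra h
  obtain ⟨ξ, h0, hξ⟩ := exists_dual_ne_zero h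
  have hξ' : ∀ j ∈ D.active ν, ξ (D.X j) = 0 := fun j hj => hξ _ ⟨j, hj, rfl⟩
  have h1 := eventually_mem_polyhedron hν.1 hξ'
  have h2 : ∀ᶠ t : ℝ in 𝓝 0, ν + t • (-ξ) ∈ D.polyhedron :=
    eventually_mem_polyhedron hν.1 fun j hj => by simp [hξ' j hj]
  obtain ⟨t, ⟨ht1, ht2⟩, ht⟩ := ((h1.and h2).filter_mono nhdsWithin_le_nhds |>.and
    (self_mem_nhdsWithin : ∀ᶠ t : ℝ in 𝓝[>] 0, t ∈ Set.Ioi 0)).exists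
  have hseg : ν ∈ openSegment ℝ (ν + t • ξ) (ν + t • (-ξ)) :=
    ⟨1 / 2, 1 / 2, by norm_num, by norm_num, by norm_num, by module⟩
  have := hν.2 ht1 ht2 hseg
  rw [add_eq_left, smul_eq_zero] at this
  exact this.elim (ne_of_gt ht) h0

theorem mem_vertices_of_span_active {ν : Module.Dual ℝ V} (hν : ν ∈ D.polyhedron)
    (hs : Submodule.span ℝ (D.X '' D.active ν) = ⊤) : ν ∈ D.vertices := by
  refine ⟨hν, fun x hx y hy hseg => ?_⟩
  obtain ⟨a, b, ha, hb, hab, rfl⟩ := hseg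
  refine LinearMap.ext_on hs ?_
  rintro _ ⟨j, hj, rfl⟩
  have hj' : a * x (D.X j) + b * y (D.X j) = D.lam j := hj
  have h1 := hx j
  have h2 := hy j
  change x (D.X j) = a * x (D.X j) + b * y (D.X j)
  rw [hj']
  have : a * (x (D.X j) - D.lam j) + b * (y (D.X j) - D.lam j) = 0 := by
    have : (a + b) * D.lam j = D.lam j := by rw [hab, one_mul]
    linarith
  have h3 : 0 ≤ b * (y (D.X j) - D.lam j) := mul_nonneg hb.le (sub_nonneg.2 h2)
  have h4 : 0 ≤ a * (x (D.X j) - D.lam j) := mul_nonneg ha.le (sub_nonneg.2 h1)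
  have h5 : a * (x (D.X j) - D.lam j) = 0 := by linarith
  rcases mul_eq_zero.1 h5 with h | h
  · exact absurd h ha.ne'
  · linarith

/-- Moving in a direction along which all tight constraints stay tight, until another one becomes tight. -/
theorem exists_active_ssubset [Finite ι] (hspan : Submodule.span ℝ (Set.range D.X) = ⊤)
    {μ : Module.Dual ℝ V} (hμ : μ ∈ D.polyhedron)
    (hs : Submodule.span ℝ (D.X '' D.active μ) ≠ ⊤) :
    ∃ μ' ∈ D.polyhedron, D.active μ ⊂ D.active μ' := by
  obtain ⟨ξ', h0, hξ'⟩ := exists_dual_ne_zero hs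
  obtain ⟨ξ, i, hi, hξ⟩ : ∃ (ξ : Module.Dual ℝ V) (i : ι), ξ (D.X i) < 0 ∧
      ∀ j ∈ D.active μ, ξ (D.X j) = 0 := by
    have : ∃ i, ξ' (D.X i) ≠ 0 := by
      by_contra! h
      exact h0 (LinearMap.ext_on hspan (by rintro _ ⟨j, rfl⟩; simpa using h j))
    obtain ⟨i, hi⟩ := this
    rcases lt_or_gt_of_ne hi with h | h
    · exact ⟨ξ', i, h, fun j hj => hξ' _ ⟨j, hj, rfl⟩⟩
    · exact ⟨-ξ', i, by simpa using h, fun j hj => by simp [hξ' _ ⟨j, hj, rfl⟩]⟩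
  -- the first time at which a constraint that decreases along `ξ` becomes tight
  let S : Set ι := {j | ξ (D.X j) < 0}
  let T : ι → ℝ := fun j => (μ (D.X j) - D.lam j) / (-ξ (D.X j))
  obtain ⟨j, hj, hmin⟩ := Set.exists_min_image S T (Set.toFinite S) ⟨i, hi⟩
  have hT : 0 ≤ T j := div_nonneg (sub_nonneg.2 (hμ j)) (neg_nonneg.2 (le_of_lt hj))
  have hjneg : ξ (D.X j) < 0 := hj
  refine ⟨μ + T j • ξ, fun l => ?_, ?_⟩
  · change D.lam l ≤ μ (D.X l) + T j * ξ (D.X l)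
    by_cases hl : ξ (D.X l) < 0
    · have := hmin l hl
      rw [le_div_iff₀ (neg_pos.2 hl)] at this
      linarith
    · have := mul_nonneg hT (not_lt.1 hl)
      have := hμ l
      linarith
  · refine (Set.ssubset_iff_of_subset fun l hl => ?_).2 ⟨j, ?_, fun h => ?_⟩
    · change μ (D.X l) + T j * ξ (D.X l) = D.lam l
      rw [hξ l hl, mul_zero, add_zero]
      exact hl
    · change μ (D.X j) + T j * ξ (D.X j) = D.lam j
      have : T j * ξ (D.X j) = -(μ (D.X j) - D.lam j) := by
        simp only [T]
        field_simp [hjneg.ne]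
      linarith
    · exact hjneg.ne (hξ j h)

/-- Every face contains a vertex: among the points with more and more tight constraints, one with a maximal
set of them is a vertex. -/
theorem exists_vertex_active_subset [Finite ι] (hspan : Submodule.span ℝ (Set.range D.X) = ⊤)
    {μ : Module.Dual ℝ V} (hμ : μ ∈ D.polyhedron) :
    ∃ ν ∈ D.vertices, D.active μ ⊆ D.active ν := by
  let 𝒮 : Set (Set ι) := {A | ∃ ν ∈ D.polyhedron, D.active ν = A ∧ D.active μ ⊆ A}
  obtain ⟨A, hA⟩ := (Set.toFinite 𝒮).exists_maximal ⟨_, μ, hμ, rfl, subset_rfl⟩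
  obtain ⟨ν, hν, rfl, hsub⟩ := hA.prop
  refine ⟨ν, mem_vertices_of_span_active hν ?_, hsub⟩
  by_contra h
  obtain ⟨ν', hν', hlt⟩ := exists_active_ssubset hspan hν h
  exact hlt.2 (hA.le_of_ge ⟨ν', hν', rfl, hsub.trans hlt.1⟩ hlt.1)

theorem linearIndependent_mono_active {μ ν : Module.Dual ℝ V} (h : D.active μ ⊆ D.active ν)
    (hν : LinearIndependent ℝ fun j : D.active ν => D.X j) :
    LinearIndependent ℝ fun j : D.active μ => D.X j :=
  hν.comp (Set.inclusion h) (Set.inclusion_injective h)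

theorem IsAdmissible.isRegular [Finite ι] [FiniteDimensional ℝ V] (h : D.IsAdmissible) :
    D.IsRegular := by
  have hspan : Submodule.span ℝ (Set.range D.X) = ⊤ := by
    obtain ⟨ν, hν⟩ := h.pointed
    exact top_le_iff.1 ((span_active_of_mem_vertices hν).symm.le.trans
      (Submodule.span_mono (Set.image_subset_range _ _)))
  refine ⟨?_, h.mem_Q, hspan, fun μ hμ => ?_⟩
  · obtain ⟨S, hS, -⟩ := h.quasilattice
    rw [hS]
    have h1 : (AddSubgroup.closure (S : Set V) : Set V) =
        Set.range (Fintype.linearCombination ℤ ((↑) : S → V)) := by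
      rw [← LinearMap.coe_range, Fintype.range_linearCombination, Subtype.range_coe,
        ← Submodule.span_int_eq_addSubgroupClosure]
      rfl
    rw [h1]
    exact Set.countable_range _
  · obtain ⟨ν, hν, hsub⟩ := exists_vertex_active_subset hspan hμ
    refine linearIndependent_mono_active hsub ?_
    have : Fintype (D.active ν) := Fintype.ofFinite _
    refine linearIndependent_of_top_le_span_of_card_eq_finrank ?_ ?_
    · rw [← span_active_of_mem_vertices hν, Set.image_eq_range]
    · rw [← h.simple ν hν, Set.ncard_eq_toFinset_card', Set.toFinset_card]

/-- A functional takes prescribed values on linearly independent vectors. -/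
theorem exists_dual_apply_eq [Finite ι] {A : Set ι}
    (hA : LinearIndependent ℝ fun j : A => D.X j) (c : ι → ℝ) :
    ∃ ξ : Module.Dual ℝ V, ∀ j ∈ A, ξ (D.X j) = c j := by
  have := Fintype.ofFinite A
  obtain ⟨g, hg⟩ := LinearMap.exists_leftInverse_of_injective
    (Finsupp.linearCombination ℝ fun j : A => D.X j) (by rwa [LinearMap.ker_eq_bot])
  refine ⟨(Finsupp.linearCombination ℝ fun j : A => c j) ∘ₗ g, fun j hj => ?_⟩
  have := LinearMap.congr_fun hg (Finsupp.single ⟨j, hj⟩ 1)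
  simp only [LinearMap.coe_comp, Function.comp_apply, Finsupp.linearCombination_single, one_smul,
    LinearMap.id_apply] at this
  simp [this]

/-- Constraints that are tight at a point can be relaxed independently of each other. -/
theorem exists_active_eq [Finite ι] {μ : Module.Dual ℝ V} (hμ : μ ∈ D.polyhedron)
    (hli : LinearIndependent ℝ fun j : D.active μ => D.X j) {A : Set ι} (hA : A ⊆ D.active μ) :
    ∃ μ' ∈ D.polyhedron, D.active μ' = A := by
  classical
  obtain ⟨ξ, hξ⟩ := exists_dual_apply_eq hli fun j => if j ∈ A then 0 else 1
  obtain ⟨t, h, ht⟩ := ((eventually_lt_of_not_active hμ ξ).filter_mono nhdsWithin_le_nhds |>.and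
    (self_mem_nhdsWithin : ∀ᶠ t : ℝ in 𝓝[>] 0, t ∈ Set.Ioi 0)).exists
  have h1 : ∀ j ∈ A, (μ + t • ξ) (D.X j) = D.lam j := fun j hj => by
    have : μ (D.X j) = D.lam j := hA hj
    simp [hξ j (hA hj), hj, this]
  have h2 : ∀ j ∉ A, D.lam j < (μ + t • ξ) (D.X j) := fun j hj => by
    by_cases hj' : j ∈ D.active μ
    · have h3 : μ (D.X j) = D.lam j := hj'
      have h4 : 0 < t := ht
      simp [hξ j hj', hj, h3, h4]
    · exact h j hj'
  refine ⟨μ + t • ξ, fun j => ?_, Set.ext fun j => ⟨fun hj => ?_, h1 j⟩⟩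
  · by_cases hj : j ∈ A
    · exact (h1 j hj).ge
    · exact (h2 j hj).le
  · by_contra hj'
    exact (h2 j hj').ne hj.symm

theorem dual_mem_vectorSpan {μ : Module.Dual ℝ V} {P : Set (Module.Dual ℝ V)}
    (hμP : μ ∈ P) (ξ : Module.Dual ℝ V) (h : ∀ᶠ t : ℝ in 𝓝 0, μ + t • ξ ∈ P) :
    ξ ∈ vectorSpan ℝ P := by
  obtain ⟨t, ht, ht0⟩ := (h.filter_mono nhdsWithin_le_nhds |>.and
    (self_mem_nhdsWithin : ∀ᶠ t : ℝ in 𝓝[>] 0, t ∈ Set.Ioi 0)).exists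
  have h1 : t • ξ ∈ vectorSpan ℝ P := by
    have := vsub_mem_vectorSpan ℝ ht hμP
    simpa using this
  exact ((vectorSpan ℝ P).smul_mem_iff (ne_of_gt ht0)).1 h1

theorem IsRegular.vectorSpan_polyhedron [Finite ι] (h : D.IsRegular) (hne : D.polyhedron.Nonempty) :
    vectorSpan ℝ D.polyhedron = ⊤ := by
  obtain ⟨μ, hμ⟩ := hne
  obtain ⟨μ', hμ', h'⟩ := exists_active_eq hμ (h.linearIndependent μ hμ) (Set.empty_subset _)
  exact eq_top_iff.2 fun ξ _ => dual_mem_vectorSpan hμ' ξ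
    (eventually_mem_polyhedron hμ' (by simp [h']))

/-- In a regular polyhedron every nonempty face `Δ ∩ {⟨μ, X_j⟩ = λ_j}` is a facet. -/
theorem IsRegular.isFacet [Finite ι] [FiniteDimensional ℝ V] (h : D.IsRegular) {j : ι}
    (hj : (D.face j).Nonempty) : IsFacet D.polyhedron (D.face j) := by
  refine ⟨hj, ?_⟩
  obtain ⟨μ, hμ, hμj⟩ := hj
  rw [h.vectorSpan_polyhedron ⟨μ, hμ⟩, finrank_top, Subspace.dual_finrank_eq]
  obtain ⟨μ', hμ', h'⟩ := exists_active_eq hμ (h.linearIndependent μ hμ)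
    (Set.singleton_subset_iff.2 (show j ∈ D.active μ from hμj))
  have hμ'j : μ' (D.X j) = D.lam j := (h' ▸ Set.mem_singleton j : j ∈ D.active μ')
  have h0 : D.X j ≠ 0 :=
    (h.linearIndependent μ hμ).ne_zero (⟨j, hμj⟩ : D.active μ)
  have hspan : vectorSpan ℝ (D.face j) = (Submodule.span ℝ {D.X j}).dualAnnihilator := by
    refine le_antisymm (Submodule.span_le.2 ?_) fun ξ hξ => ?_
    · rintro _ ⟨x, hx, y, hy, rfl⟩
      rw [SetLike.mem_coe, Submodule.mem_dualAnnihilator]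
      intro w hw
      obtain ⟨c, rfl⟩ := Submodule.mem_span_singleton.1 hw
      have h1 : x (D.X j) = D.lam j := hx.2
      have h2 : y (D.X j) = D.lam j := hy.2
      simp [h1, h2]
    · have hξ0 : ξ (D.X j) = 0 :=
        (Submodule.mem_dualAnnihilator ξ).1 hξ _ (Submodule.mem_span_singleton_self _)
      refine dual_mem_vectorSpan (show μ' ∈ D.face j from ⟨hμ', hμ'j⟩) ξ ?_
      refine (eventually_mem_polyhedron hμ' (ξ := ξ) (by simp [h', hξ0])).mono fun t ht => ?_
      exact ⟨ht, by simp [hμ'j, hξ0]⟩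
  rw [hspan]
  have h1 := Subspace.finrank_add_finrank_dualAnnihilator_eq (Submodule.span ℝ {D.X j})
  rw [finrank_span_singleton h0] at h1
  omega

theorem IsRegular.active_vertex_ncard [Finite ι] (h : D.IsRegular) {ν : Module.Dual ℝ V}
    (hν : ν ∈ D.vertices) : (D.active ν).ncard = Module.finrank ℝ V := by
  have : Fintype (D.active ν) := Fintype.ofFinite _
  let b := Module.Basis.mk (h.linearIndependent ν hν.1)
    (by rw [← span_active_of_mem_vertices hν, Set.image_eq_range])
  rw [Module.finrank_eq_card_basis b, Set.ncard_eq_toFinset_card', Set.toFinset_card]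

/-! ### Discarding redundant half-spaces -/

/-- The data that keep only the half-spaces with index in `S`. -/
def restrict (T : ToricData ι V) (S : Finset ι) : ToricData {j // j ∈ S} V where
  X j := T.X j
  lam j := T.lam j
  Q := T.Q

/-- Half-spaces whose boundary hyperplane misses the polyhedron are redundant: walking from a point of the
polyhedron towards a point outside, the first constraint to become tight is one that is about to be
violated. -/
theorem polyhedron_restrict [Finite ι] {T : ToricData ι V} {S : Finset ι}
    (hne : T.polyhedron.Nonempty) (hS : ∀ j, (T.face j).Nonempty → j ∈ S) :
    (T.restrict S).polyhedron = T.polyhedron := by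
  refine Set.Subset.antisymm (fun ν' hν' => ?_) fun ν hν j => hν j
  by_contra hout
  obtain ⟨ν, hν⟩ := hne
  let B : Set ι := {j | ν' (T.X j) < T.lam j}
  have hB : B.Nonempty := by
    by_contra h
    rw [Set.not_nonempty_iff_eq_empty] at h
    exact hout fun j => not_lt.1 fun hj => (h ▸ (show j ∈ B from hj) : j ∈ (∅ : Set ι))
  let τ : ι → ℝ := fun j => (ν (T.X j) - T.lam j) / (ν (T.X j) - ν' (T.X j))
  obtain ⟨j, hj, hmin⟩ := Set.exists_min_image B τ (Set.toFinite B) hB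
  have hpos : ∀ l ∈ B, 0 < ν (T.X l) - ν' (T.X l) := fun l hl => by
    have h1 : ν' (T.X l) < T.lam l := hl
    have := hν l
    linarith
  have hτ0 : 0 ≤ τ j := div_nonneg (sub_nonneg.2 (hν j)) (hpos j hj).le
  have hτ1 : τ j ≤ 1 := by
    rw [div_le_one (hpos j hj)]
    have h1 : ν' (T.X j) < T.lam j := hj
    linarith
  have hjS : j ∈ S := by
    refine hS j ⟨ν + τ j • (ν' - ν), fun l => ?_, ?_⟩
    · change T.lam l ≤ ν (T.X l) + τ j * (ν' (T.X l) - ν (T.X l))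
      by_cases hl : l ∈ B
      · have := hmin l hl
        rw [le_div_iff₀ (hpos l hl)] at this
        linarith
      · have h1 : T.lam l ≤ ν' (T.X l) := not_lt.1 hl
        have h2 := hν l
        nlinarith
    · change ν (T.X j) + τ j * (ν' (T.X j) - ν (T.X j)) = T.lam j
      have : τ j * (ν (T.X j) - ν' (T.X j)) = ν (T.X j) - T.lam j :=
        div_mul_cancel₀ _ (hpos j hj).ne'
      linarith
  have h1 : ν' (T.X j) < T.lam j := hj
  exact absurd (hν' ⟨j, hjS⟩) (not_le.2 h1)

theorem face_restrict {T : ToricData ι V} {S : Finset ι}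
    (hP : (T.restrict S).polyhedron = T.polyhedron) (j : {j // j ∈ S}) :
    (T.restrict S).face j = T.face j := by
  unfold face
  rw [hP]; rfl

/-- The facets of a regular presentation form an admissible triple. Different facets are distinguished by
points at which a single constraint is tight. -/
theorem IsRegular.isAdmissible_restrict [Finite ι] [FiniteDimensional ℝ V] {T : ToricData ι V}
    (h : T.IsRegular) (hQ : IsQuasilattice T.Q) (hne : T.polyhedron.Nonempty) {S : Finset ι}
    (hS : ∀ j, j ∈ S ↔ (T.face j).Nonempty) : (T.restrict S).IsAdmissible := by
  have hP : (T.restrict S).polyhedron = T.polyhedron :=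
    polyhedron_restrict hne fun j => (hS j).2
  have hV : (T.restrict S).vertices = T.vertices := by unfold vertices; rw [hP]
  refine ⟨hQ, fun j => h.mem_Q j, hP ▸ hne, hP ▸ h.vectorSpan_polyhedron hne, fun j => ?_,
    fun i j hij => ?_, ?_, fun ν hν => ?_⟩
  · rw [face_restrict hP, hP]
    exact h.isFacet ((hS j).1 j.2)
  · rw [face_restrict hP, face_restrict hP] at hij
    obtain ⟨μ, hμ, hμi⟩ := (hS i).1 i.2
    obtain ⟨μ', hμ', h'⟩ := exists_active_eq hμ (h.linearIndependent μ hμ)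
      (Set.singleton_subset_iff.2 (show i.1 ∈ T.active μ from hμi))
    have h1 : μ' ∈ T.face i := ⟨hμ', (h' ▸ Set.mem_singleton i.1 : i.1 ∈ T.active μ')⟩
    rw [hij] at h1
    have h2 : j.1 ∈ T.active μ' := h1.2
    rw [h'] at h2
    exact Subtype.ext (Set.mem_singleton_iff.1 h2).symm
  · obtain ⟨μ, hμ⟩ := hne
    obtain ⟨ν, hν, -⟩ := exists_vertex_active_subset h.span hμ
    exact ⟨ν, hV ▸ hν⟩
  · rw [hV] at hν
    rw [← h.active_vertex_ncard hν]
    have : T.active ν = Subtype.val '' (T.restrict S).active ν := by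
      ext j
      refine ⟨fun hj => ⟨⟨j, (hS j).2 ⟨ν, hν.1, hj⟩⟩, hj, rfl⟩, ?_⟩
      rintro ⟨i, hi, rfl⟩
      exact hi
    rw [this, Set.ncard_image_of_injective _ Subtype.val_injective]

end Regular

section Frames

variable {ι V : Type*} [Fintype ι] [AddCommGroup V] [Module ℝ V] {D : ToricData ι V}

/-- Every point of the polyhedron lies over the chart of some vertex: all constraints that are tight at the
point are tight at the vertex. -/
theorem IsRegular.exists_frame (h : D.IsRegular) [FiniteDimensional ℝ V] {m : ℕ}
    (hm : m = Module.finrank ℝ V) {μ : Module.Dual ℝ V} (hμ : μ ∈ D.polyhedron) :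
    ∃ F : D.VertexFrame m, D.active μ ⊆ Set.range F.e := by
  obtain ⟨ν, hν, hsub⟩ := exists_vertex_active_subset h.span hμ
  have hfin : Fintype (D.active ν) := Fintype.ofFinite _
  let b := Module.Basis.mk (h.linearIndependent ν hν.1)
    (by rw [← span_active_of_mem_vertices hν, Set.image_eq_range])
  have hcard : Fintype.card (D.active ν) = m := by
    rw [hm, Module.finrank_eq_card_basis b]
  let φ : D.active ν ≃ Fin m := Fintype.equivFinOfCardEq hcard
  have hr : Set.range (φ.symm.toEmbedding.trans (Function.Embedding.subtype _) : Fin m ↪ ι)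
      = D.active ν := by
    ext j
    constructor
    · rintro ⟨i, rfl⟩
      exact (φ.symm i).2
    · intro hj
      exact ⟨φ ⟨j, hj⟩, by simp⟩
  exact ⟨⟨ν, hν, φ.symm.toEmbedding.trans (Function.Embedding.subtype _), hr, b.reindex φ,
    fun i => by simp [b]⟩, hr ▸ hsub⟩

end Frames

/-! ### Straightening phases by the torus -/

theorem expT_smul_apply {ι : Type*} (Y : ι → ℝ) (z : ι → ℂ) (j : ι) :
    (expT Y • z) j = Complex.exp ((2 * Real.pi * Y j : ℝ) * Complex.I) * z j := rfl

theorem expT_zero {ι : Type*} : expT (0 : ι → ℝ) = 1 := by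
  funext j; simp [expT]

theorem expT_neg {ι : Type*} (Y : ι → ℝ) : expT (-Y) = (expT Y)⁻¹ := by
  funext j; simp [expT, Circle.exp_neg]

theorem expT_smul_expT_smul {ι : Type*} (Y Z : ι → ℝ) (z : ι → ℂ) :
    expT Y • expT Z • z = expT (Y + Z) • z := by
  rw [expT_add, mul_smul]

theorem expT_apply_eq_one_iff {ι : Type*} {Y : ι → ℝ} {j : ι} :
    expT Y j = 1 ↔ ∃ k : ℤ, Y j = k := by
  rw [expT, Circle.exp_eq_one]
  refine exists_congr fun k => ?_
  rw [mul_comm (k : ℝ)]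
  exact mul_right_inj' (by positivity)

theorem continuous_expT_smul {ι : Type*} :
    Continuous fun p : (ι → ℝ) × (ι → ℂ) => expT p.1 • p.2 :=
  continuous_pi fun j => by
    simp only [expT_smul_apply]
    fun_prop

theorem continuousAt_expT_smul {ι X : Type*} [TopologicalSpace X] {Y : X → ι → ℝ} {z : X → ι → ℂ}
    {x : X} (hY : ContinuousAt Y x) (hz : ContinuousAt z x) :
    ContinuousAt (fun x => expT (Y x) • z x) x :=
  continuous_expT_smul.continuousAt.comp (f := fun x => (Y x, z x)) (hY.prodMk hz)

theorem contDiffAt_expT_smul {ι E : Type*} [Fintype ι] [NormedAddCommGroup E] [NormedSpace ℝ E]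
    {Y : E → ι → ℝ} {z : E → ι → ℂ} {u : E} (hY : ContDiffAt ℝ ∞ Y u) (hz : ContDiffAt ℝ ∞ z u) :
    ContDiffAt ℝ ∞ (fun u => expT (Y u) • z u) u := by
  rw [contDiffAt_pi]
  intro j
  simp only [expT_smul_apply]
  refine ContDiffAt.mul (ContDiffAt.cexp (ContDiffAt.mul ?_ contDiffAt_const)) (contDiffAt_pi.1 hz j)
  exact Complex.ofRealCLM.contDiff.contDiffAt.comp u (contDiffAt_const.mul (contDiffAt_pi.1 hY j))

/-- If two rotations of a nonzero complex number agree, and the angles differ by less than a full turn,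
then the angles agree. -/
theorem eq_of_expT_smul_eq {ι : Type*} {Y Z : ι → ℝ} {z : ι → ℂ} {j : ι} (hz : z j ≠ 0)
    (h : (expT Y • z) j = (expT Z • z) j) (hlt : |Y j - Z j| < 1) : Y j = Z j := by
  have h1 : expT (Y - Z) j = 1 := by
    have h2 : expT Y j = expT Z j := by
      have h3 : (expT Y j : ℂ) * z j = (expT Z j : ℂ) * z j := h
      exact Circle.ext (mul_right_cancel₀ hz h3)
    rw [sub_eq_add_neg, expT_add, expT_neg, Pi.mul_apply, Pi.inv_apply, h2, mul_inv_cancel]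
  obtain ⟨k, hk⟩ := expT_apply_eq_one_iff.1 h1
  rw [Pi.sub_apply] at hk
  rw [hk, ← Int.cast_abs, ← Int.cast_one, Int.cast_lt, Int.abs_lt_one_iff] at hlt
  rw [hlt, Int.cast_zero, sub_eq_zero] at hk
  exact hk

/-- The angles (in turns) by which the coordinates of `ζ` have to be rotated to acquire the phases of the
coordinates of `ζ₀`. The angle is 0 where `ζ` or `ζ₀` vanishes
(`log 0 = 0`), which makes the map smooth at `ζ₀` without conditions. -/
def phaseDiff {ι : Type*} (ζ₀ ζ : ι → ℂ) : ι → ℝ :=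
  fun j => -(Complex.log (ζ j / ζ₀ j)).im / (2 * Real.pi)

theorem phaseDiff_self {ι : Type*} (ζ₀ : ι → ℂ) : phaseDiff ζ₀ ζ₀ = 0 := by
  funext j
  by_cases h : ζ₀ j = 0 <;> simp [phaseDiff, h]

theorem contDiffAt_phaseDiff {ι : Type*} [Fintype ι] (ζ₀ : ι → ℂ) :
    ContDiffAt ℝ ∞ (phaseDiff ζ₀) ζ₀ := by
  rw [contDiffAt_pi]
  intro j
  by_cases h : ζ₀ j = 0
  · simp only [phaseDiff, h, div_zero, Complex.log_zero]
    exact contDiffAt_const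
  · have h1 : ContDiffAt ℝ ∞ (fun ζ : ι → ℂ => ζ j / ζ₀ j) ζ₀ :=
      (contDiff_apply ℝ ℂ j).contDiffAt.div_const _
    have h2 : ContDiffAt ℝ ∞ Complex.log (ζ₀ j / ζ₀ j) :=
      (Complex.contDiffAt_log (by simp [div_self h])).restrict_scalars ℝ
    have h3 : ContDiffAt ℝ ∞ (fun ζ : ι → ℂ => Complex.log (ζ j / ζ₀ j)) ζ₀ :=
      ContDiffAt.comp (g := Complex.log) ζ₀ h2 h1
    have h4 := (Complex.imCLM.contDiff (n := ∞)).contDiffAt.comp ζ₀ h3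
    exact h4.neg.div_const _

theorem expT_phaseDiff_smul {ι : Type*} {ζ₀ ζ : ι → ℂ} {j : ι} (h : ζ j ≠ 0) (h₀ : ζ₀ j ≠ 0) :
    (expT (phaseDiff ζ₀ ζ) • ζ) j = (‖ζ j‖ / ‖ζ₀ j‖ : ℝ) * ζ₀ j := by
  have hw : ζ j / ζ₀ j ≠ 0 := div_ne_zero h h₀
  have h1 : Complex.exp ((2 * Real.pi * phaseDiff ζ₀ ζ j : ℝ) * Complex.I) * (ζ j / ζ₀ j) =
      (‖ζ j / ζ₀ j‖ : ℂ) := by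
    have h2 : 2 * Real.pi * phaseDiff ζ₀ ζ j = -Complex.arg (ζ j / ζ₀ j) := by
      rw [phaseDiff, Complex.log_im]
      field_simp
    have h3 := Complex.norm_mul_exp_arg_mul_I (ζ j / ζ₀ j)
    rw [h2]
    calc _ = Complex.exp ((-Complex.arg (ζ j / ζ₀ j) : ℝ) * Complex.I) *
          (‖ζ j / ζ₀ j‖ * Complex.exp (Complex.arg (ζ j / ζ₀ j) * Complex.I)) := by rw [h3]
      _ = _ := by
        rw [mul_left_comm, ← Complex.exp_add]
        simp
  rw [expT_smul_apply]
  calc _ = Complex.exp ((2 * Real.pi * phaseDiff ζ₀ ζ j : ℝ) * Complex.I) * (ζ j / ζ₀ j) * ζ₀ j := by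
        field_simp
    _ = _ := by rw [h1, norm_div]

/-! ### The standard 2-form and the torus action -/

/-- The standard form on `ℂ^ι` evaluated on two tangent vectors. -/
def coordForm {ι : Type*} [Fintype ι] (a b : ι → ℂ) : ℝ :=
  (1 / Real.pi) * ∑ j, ((a j).im * (b j).re - (a j).re * (b j).im)

theorem pullbackForm_stdForm {E : Type*} [NormedAddCommGroup E] [NormedSpace ℝ E] {m : ℕ}
    (f : E → Fin m → ℂ) (x : E) (v : Fin 2 → E) :
    pullbackForm f (fun _ => stdForm m) x v = coordForm (fderiv ℝ f x (v 0)) (fderiv ℝ f x (v 1)) :=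
  rfl

theorem coordForm_torus_smul {ι : Type*} [Fintype ι] (t : ι → Circle) (a b : ι → ℂ) :
    coordForm (t • a) (t • b) = coordForm a b := by
  unfold coordForm
  congr 1
  refine Finset.sum_congr rfl fun j _ => ?_
  change ((t j : ℂ) * a j).im * ((t j : ℂ) * b j).re - ((t j : ℂ) * a j).re * ((t j : ℂ) * b j).im = _
  have h : (t j : ℂ).re * (t j : ℂ).re + (t j : ℂ).im * (t j : ℂ).im = 1 := by
    rw [← Complex.normSq_apply, Circle.normSq_coe]
  simp only [Complex.mul_re, Complex.mul_im]
  linear_combination ((a j).im * (b j).re - (a j).re * (b j).im) * h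

section Forms

variable {ι V : Type*} [Fintype ι] [AddCommGroup V] [Module ℝ V] {D : ToricData ι V}
  {E : Type*} [NormedAddCommGroup E] [NormedSpace ℝ E]

/-- The infinitesimal form of the moment condition `Ψ = 0`. -/
theorem sum_fderiv_eq_zero {ζ : E → ι → ℂ} {u : E} (hζ : DifferentiableAt ℝ ζ u)
    (hmem : ∀ᶠ u' in 𝓝 u, ζ u' ∈ D.levelSet) {Y : ι → ℝ} (hY : D.proj Y = 0) (a : E) :
    ∑ j, ((ζ u j).re * (fderiv ℝ ζ u a j).re + (ζ u j).im * (fderiv ℝ ζ u a j).im) * Y j = 0 := by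
  have hc : ∀ j, HasFDerivAt (fun u => ζ u j)
      ((ContinuousLinearMap.proj (R := ℝ) (φ := fun _ : ι => ℂ) j).comp (fderiv ℝ ζ u)) u := fun j =>
    (ContinuousLinearMap.proj (R := ℝ) (φ := fun _ : ι => ℂ) j).hasFDerivAt.comp u hζ.hasFDerivAt
  have hre := fun j => Complex.reCLM.hasFDerivAt.comp u (hc j)
  have him := fun j => Complex.imCLM.hasFDerivAt.comp u (hc j)
  have hsum := HasFDerivAt.fun_sum (u := Finset.univ) fun j _ =>
    ((((hre j).mul (hre j)).add ((him j).mul (him j))).add_const (D.lam j)).mul_const (Y j)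
  have h0 : (fun u' => ∑ j, ((((Complex.reCLM ∘ fun u => ζ u j) * (Complex.reCLM ∘ fun u => ζ u j) +
      (Complex.imCLM ∘ fun u => ζ u j) * (Complex.imCLM ∘ fun u => ζ u j)) u' + D.lam j) * Y j)) =ᶠ[𝓝 u]
      fun _ => 0 := by
    filter_upwards [hmem] with u' hu'
    rw [← hu' Y hY]
    refine Finset.sum_congr rfl fun j _ => ?_
    rw [Complex.sq_norm, Complex.normSq_apply]
    rfl
  have h1 := (hsum.congr_of_eventuallyEq h0.symm).unique (hasFDerivAt_const (0 : ℝ) u)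
  have h2 := congrArg (fun L : E →L[ℝ] ℝ => L a) h1
  simp at h2
  have h3 : 2 * ∑ j, ((ζ u j).re * (fderiv ℝ ζ u a j).re + (ζ u j).im * (fderiv ℝ ζ u a j).im) * Y j = 0 := by
    rw [← h2, Finset.mul_sum]
    refine Finset.sum_congr rfl fun j _ => ?_
    ring
  linarith

/-- On the level set `Ψ⁻¹(0)` the form is basic for the group `exp(ker π)`: it does not change when a map is
rotated by a variable element of this group, because the differential of `|ζ_j|²` annihilates `ker π`. -/
theorem coordForm_fderiv_expT_smul {ζ : E → ι → ℂ} {δ : E → ι → ℝ} {u : E}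
    (hζ : DifferentiableAt ℝ ζ u) (hδ : DifferentiableAt ℝ δ u)
    (hmem : ∀ᶠ u' in 𝓝 u, ζ u' ∈ D.levelSet) {v : V} (hker : ∀ᶠ u' in 𝓝 u, D.proj (δ u') = v)
    (a b : E) :
    coordForm (fderiv ℝ (fun u => expT (δ u) • ζ u) u a) (fderiv ℝ (fun u => expT (δ u) • ζ u) u b) =
      coordForm (fderiv ℝ ζ u a) (fderiv ℝ ζ u b) := by
  have hc : ∀ j, HasFDerivAt (fun u => ζ u j)
      ((ContinuousLinearMap.proj (R := ℝ) (φ := fun _ : ι => ℂ) j).comp (fderiv ℝ ζ u)) u := fun j =>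
    (ContinuousLinearMap.proj (R := ℝ) (φ := fun _ : ι => ℂ) j).hasFDerivAt.comp u hζ.hasFDerivAt
  have hd : ∀ j, HasFDerivAt (fun u => δ u j)
      ((ContinuousLinearMap.proj (R := ℝ) (φ := fun _ : ι => ℝ) j).comp (fderiv ℝ δ u)) u := fun j =>
    (ContinuousLinearMap.proj (R := ℝ) (φ := fun _ : ι => ℝ) j).hasFDerivAt.comp u hδ.hasFDerivAt
  have hprod := fun j => ((((Complex.ofRealCLM.hasFDerivAt.comp u ((hd j).const_mul (2 * Real.pi))).mul_const
    Complex.I).cexp).mul (hc j))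
  have hF : HasFDerivAt (fun u => expT (δ u) • ζ u) _ u := hasFDerivAt_pi.2 hprod
  have hval : ∀ c, fderiv ℝ (fun u => expT (δ u) • ζ u) u c = expT (δ u) •
      fun j => fderiv ℝ ζ u c j + ((2 * Real.pi * fderiv ℝ δ u c j : ℝ) : ℂ) * Complex.I * ζ u j := by
    intro c
    rw [hF.fderiv]
    funext j
    rw [expT_smul_apply]
    simp
    ring
  have hker' : ∀ c, D.proj (fderiv ℝ δ u c) = 0 := by
    intro c
    -- a functional that is constant along `δ` has vanishing derivative
    by_contra hne
    obtain ⟨φ, hφ⟩ : ∃ φ : Module.Dual ℝ V, φ (D.proj (fderiv ℝ δ u c)) ≠ 0 := by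
      by_contra! h
      exact hne ((Module.forall_dual_apply_eq_zero_iff ℝ _).1 h)
    let L : (ι → ℝ) →L[ℝ] ℝ := LinearMap.toContinuousLinearMap (φ ∘ₗ D.proj)
    have h1 : HasFDerivAt (L ∘ δ) (L.comp (fderiv ℝ δ u)) u := L.hasFDerivAt.comp u hδ.hasFDerivAt
    have h2 : (L ∘ δ) =ᶠ[𝓝 u] fun _ => φ v := hker.mono fun u' hu' => by
      change φ (D.proj (δ u')) = φ v
      rw [hu']
    have h3 := (h1.congr_of_eventuallyEq h2.symm).unique (hasFDerivAt_const (φ v) u)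
    exact hφ (congrArg (fun L : E →L[ℝ] ℝ => L c) h3)
  rw [hval, hval, coordForm_torus_smul]
  have ha := sum_fderiv_eq_zero hζ hmem (hker' b) a
  have hb := sum_fderiv_eq_zero hζ hmem (hker' a) b
  unfold coordForm
  congr 1
  have key : ∑ j, (((fderiv ℝ ζ u a j).im * (fderiv ℝ ζ u b j).re -
        (fderiv ℝ ζ u a j).re * (fderiv ℝ ζ u b j).im) + 2 * Real.pi *
      (((ζ u j).re * (fderiv ℝ ζ u b j).re + (ζ u j).im * (fderiv ℝ ζ u b j).im) * fderiv ℝ δ u a j) -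
      2 * Real.pi *
      (((ζ u j).re * (fderiv ℝ ζ u a j).re + (ζ u j).im * (fderiv ℝ ζ u a j).im) * fderiv ℝ δ u b j)) =
      ∑ j, ((fderiv ℝ ζ u a j).im * (fderiv ℝ ζ u b j).re -
        (fderiv ℝ ζ u a j).re * (fderiv ℝ ζ u b j).im) := by
    rw [Finset.sum_sub_distrib, Finset.sum_add_distrib, ← Finset.mul_sum, ← Finset.mul_sum, ha, hb]
    ring
  rw [← key]
  refine Finset.sum_congr rfl fun j _ => ?_
  simp only [Complex.add_re, Complex.add_im, Complex.mul_re, Complex.mul_im, Complex.ofReal_re,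
    Complex.ofReal_im, Complex.I_re, Complex.I_im]
  ring

end Forms

/-! ### Sections of the projection and local lifts into the vertex charts -/

section Lift

variable {ι V : Type*} [Fintype ι] [AddCommGroup V] [Module ℝ V] (D : ToricData ι V)

/-- `R` is a linear section of `π : ℝ^d → V` with values in the coordinate subspace `ℝ^S`. -/
structure IsSection (S : Set ι) (R : V →ₗ[ℝ] (ι → ℝ)) : Prop where
  proj_apply : ∀ v, D.proj (R v) = v
  apply_eq_zero : ∀ v, ∀ j ∉ S, R v j = 0

theorem proj_apply (Y : ι → ℝ) : D.proj Y = ∑ j, Y j • D.X j := rfl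

theorem proj_single [DecidableEq ι] (j : ι) : D.proj (Pi.single j 1) = D.X j := by
  simp [proj]

theorem exists_isSection {S : Set ι} (hS : Submodule.span ℝ (D.X '' S) = ⊤) :
    ∃ R, D.IsSection S R := by
  classical
  let P : (ι → ℝ) →ₗ[ℝ] (ι → ℝ) :=
    LinearMap.pi fun j => if j ∈ S then LinearMap.proj j else 0
  have hP : ∀ Y j, P Y j = if j ∈ S then Y j else 0 := fun Y j => by
    simp only [P, LinearMap.pi_apply]
    split_ifs <;> rfl
  have hsurj : LinearMap.range (D.proj ∘ₗ P) = ⊤ := by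
    rw [← top_le_iff, ← hS, Submodule.span_le]
    rintro _ ⟨j, hj, rfl⟩
    refine ⟨Pi.single j 1, ?_⟩
    have : P (Pi.single j 1) = Pi.single j 1 := by
      funext i
      rw [hP]
      by_cases hi : i = j
      · subst hi; simp [hj]
      · simp [hi]
    rw [LinearMap.comp_apply, this, proj_single]
  obtain ⟨g, hg⟩ := LinearMap.exists_rightInverse_of_surjective _ hsurj
  refine ⟨P ∘ₗ g, fun v => LinearMap.congr_fun hg v, fun v j hj => ?_⟩
  rw [LinearMap.comp_apply, hP, if_neg hj]

variable {D}

/-- The correction of an angle vector, within the coordinates in `S`, to one in `ker π`. -/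
def toKer (D : ToricData ι V) (R : V →ₗ[ℝ] (ι → ℝ)) : (ι → ℝ) →L[ℝ] (ι → ℝ) :=
  LinearMap.toContinuousLinearMap (LinearMap.id - R ∘ₗ D.proj)

theorem toKer_apply (R : V →ₗ[ℝ] (ι → ℝ)) (Y : ι → ℝ) : D.toKer R Y = Y - R (D.proj Y) := rfl

theorem IsSection.proj_toKer {S : Set ι} {R : V →ₗ[ℝ] (ι → ℝ)} (hR : D.IsSection S R) (Y : ι → ℝ) :
    D.proj (D.toKer R Y) = 0 := by
  rw [toKer_apply, map_sub, hR.proj_apply, sub_self]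

theorem IsSection.toKer_apply_of_notMem {S : Set ι} {R : V →ₗ[ℝ] (ι → ℝ)} (hR : D.IsSection S R)
    (Y : ι → ℝ) {j : ι} (hj : j ∉ S) : D.toKer R Y j = Y j := by
  rw [toKer_apply, Pi.sub_apply, hR.apply_eq_zero _ j hj, sub_zero]

/-- Rotating `ζ` by this element of `exp(ker π)` gives its coordinates outside `S` the phases of `ζ₀`. -/
def straighten (D : ToricData ι V) (R : V →ₗ[ℝ] (ι → ℝ)) (ζ₀ ζ : ι → ℂ) : ι → ℝ :=
  D.toKer R (phaseDiff ζ₀ ζ)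

theorem straighten_self (R : V →ₗ[ℝ] (ι → ℝ)) (ζ₀ : ι → ℂ) : D.straighten R ζ₀ ζ₀ = 0 := by
  rw [straighten, phaseDiff_self, map_zero]

theorem contDiffAt_straighten (R : V →ₗ[ℝ] (ι → ℝ)) (ζ₀ : ι → ℂ) :
    ContDiffAt ℝ ∞ (D.straighten R ζ₀) ζ₀ :=
  (D.toKer R).contDiff.contDiffAt.comp ζ₀ (contDiffAt_phaseDiff ζ₀)

theorem IsSection.expT_straighten_smul {S : Set ι} {R : V →ₗ[ℝ] (ι → ℝ)} (hR : D.IsSection S R)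
    {Y : ι → ℝ} {ζ₀ ζ : ι → ℂ} {j : ι} (hj : j ∉ S) (h : ζ j ≠ 0) (h₀ : ζ₀ j ≠ 0)
    (hY : (expT Y • ζ₀) j = ‖ζ₀ j‖) :
    (expT (Y + D.straighten R ζ₀ ζ) • ζ) j = ‖ζ j‖ := by
  have h1 : expT (D.straighten R ζ₀ ζ) j = expT (phaseDiff ζ₀ ζ) j := by
    rw [expT, expT, straighten, hR.toKer_apply_of_notMem _ hj]
  have h2 : (expT Y j : ℂ) * ζ₀ j = ‖ζ₀ j‖ := hY
  have h3 : (expT (phaseDiff ζ₀ ζ) j : ℂ) * ζ j = (‖ζ j‖ / ‖ζ₀ j‖ : ℝ) * ζ₀ j :=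
    expT_phaseDiff_smul h h₀
  change (expT (Y + D.straighten R ζ₀ ζ) j : ℂ) * ζ j = _
  rw [expT_add, Pi.mul_apply, h1, Circle.coe_mul, mul_assoc, h3, mul_left_comm, h2,
    ← Complex.ofReal_mul, div_mul_cancel₀ _ (norm_ne_zero_iff.2 h₀)]

/-- Near `ζ₀`, the coordinates outside `S` are made positive by rotations in a smooth family of elements of
`exp(ker π)`, once this is so for `ζ₀`. -/
theorem IsSection.exists_local_straightening {S : Set ι} {R : V →ₗ[ℝ] (ι → ℝ)} (hR : D.IsSection S R)
    {ζ₀ : ι → ℂ} (h₀ : ∀ j ∉ S, ζ₀ j ≠ 0) {Y : ι → ℝ} (hY : ∀ j ∉ S, (expT Y • ζ₀) j = ‖ζ₀ j‖) :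
    ∃ δ : (ι → ℂ) → ι → ℝ, ContDiffAt ℝ ∞ δ ζ₀ ∧ δ ζ₀ = 0 ∧ (∀ ζ, D.proj (δ ζ) = 0) ∧
      ∀ᶠ ζ in 𝓝 ζ₀, ∀ j ∉ S, ζ j ≠ 0 ∧ (expT (Y + δ ζ) • ζ) j = ‖ζ j‖ := by
  refine ⟨D.straighten R ζ₀, contDiffAt_straighten R ζ₀, straighten_self R ζ₀,
    fun ζ => hR.proj_toKer _, ?_⟩
  rw [Filter.eventually_all]
  intro j
  by_cases hj : j ∈ S
  · exact Filter.Eventually.of_forall fun ζ h => absurd hj h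
  · have hcont : ContinuousAt (fun ζ : ι → ℂ => ζ j) ζ₀ := (continuous_apply j).continuousAt
    exact (hcont.eventually_ne (h₀ j hj)).mono fun ζ hζ _ =>
      ⟨hζ, hR.expT_straighten_smul hj hζ (h₀ j hj) (hY j hj)⟩

namespace VertexFrame

variable {m : ℕ} (F : D.VertexFrame m)

theorem span_range : Submodule.span ℝ (D.X '' Set.range F.e) = ⊤ := by
  rw [← Set.range_comp, ← F.basis.span_eq]
  congr 1
  exact congrArg Set.range (funext fun h => (F.basis_eq h).symm)

theorem exists_isSection : ∃ R, D.IsSection (Set.range F.e) R := D.exists_isSection F.span_range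

theorem lift_apply (z : Fin m → ℂ) (h : Fin m) : F.lift z (F.e h) = z h :=
  F.e.injective.extend_apply _ _ _

theorem lift_of_notMem (z : Fin m → ℂ) {j : ι} (hj : j ∉ Set.range F.e) :
    F.lift z j = (Real.sqrt (F.height z j) : ℝ) :=
  Function.extend_apply' _ _ _ fun h => hj h

theorem lift_eq_norm {z : Fin m → ℂ} {j : ι} (hj : j ∉ Set.range F.e) :
    F.lift z j = ‖F.lift z j‖ := by
  rw [F.lift_of_notMem z hj, Complex.norm_real, Real.norm_of_nonneg (Real.sqrt_nonneg _)]

theorem lift_ne_zero {z : Fin m → ℂ} (hz : z ∈ F.dom) {j : ι} (hj : j ∉ Set.range F.e) :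
    F.lift z j ≠ 0 := by
  rw [F.lift_of_notMem z hj, Ne, Complex.ofReal_eq_zero]
  exact (Real.sqrt_pos.2 (hz j hj)).ne'

theorem height_comp {η : ι → ℂ} (hη : η ∈ D.levelSet) (j : ι) :
    F.height (η ∘ F.e) j = ‖η j‖ ^ 2 := by
  obtain ⟨μ, hμ⟩ := D.exists_moment ⟨η, hη⟩
  have h1 : μ (D.X j) = ∑ h, F.basis.repr (D.X j) h * (‖η (F.e h)‖ ^ 2 + D.lam (F.e h)) := by
    conv_lhs => rw [← F.basis.sum_repr (D.X j), map_sum]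
    refine Finset.sum_congr rfl fun h _ => ?_
    rw [map_smul, F.basis_eq, hμ, smul_eq_mul]
  rw [height, Finset.sum_congr rfl fun h _ => by rw [Function.comp_apply], ← h1, hμ]
  ring

theorem comp_mem_dom {η : ι → ℂ} (hη : η ∈ D.levelSet) (h0 : ∀ j, j ∉ Set.range F.e → η j ≠ 0) :
    η ∘ F.e ∈ F.dom := fun j hj => by
  rw [F.height_comp hη]
  have := norm_pos_iff.2 (h0 j hj)
  positivity

/-- A point of the level set whose coordinates at the facets away from the vertex are nonnegative reals is
determined by its other coordinates. -/
theorem lift_comp {η : ι → ℂ} (hη : η ∈ D.levelSet)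
    (hpos : ∀ j, j ∉ Set.range F.e → η j = ‖η j‖) : F.lift (η ∘ F.e) = η := by
  funext j
  by_cases hj : j ∈ Set.range F.e
  · obtain ⟨h, rfl⟩ := hj
    exact F.lift_apply _ h
  · rw [F.lift_of_notMem _ hj, F.height_comp hη, Real.sqrt_sq (norm_nonneg _), ← hpos j hj]

theorem continuous_height (j : ι) : Continuous fun z => F.height z j := by
  unfold height
  fun_prop

theorem continuous_lift : Continuous F.lift := by
  refine continuous_pi fun j => ?_
  by_cases hj : j ∈ Set.range F.e
  · obtain ⟨h, rfl⟩ := hj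
    simp only [lift_apply]
    fun_prop
  · simp only [F.lift_of_notMem _ hj]
    exact Complex.continuous_ofReal.comp (Real.continuous_sqrt.comp (F.continuous_height j))

theorem isOpen_dom : IsOpen F.dom := by
  have : F.dom = ⋂ j : ι, {z | j ∉ Set.range F.e → 0 < F.height z j} := by
    ext z; simp [dom]
  rw [this]
  refine isOpen_iInter_of_finite fun j => ?_
  by_cases hj : j ∈ Set.range F.e
  · simp only [hj, not_true_eq_false, false_imp_iff]
    exact isOpen_univ
  · simp only [hj, not_false_eq_true, true_imp_iff]
    exact isOpen_lt continuous_const (F.continuous_height j)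

theorem contDiffAt_lift {z : Fin m → ℂ} (hz : z ∈ F.dom) : ContDiffAt ℝ ∞ F.lift z := by
  rw [contDiffAt_pi]
  intro j
  by_cases hj : j ∈ Set.range F.e
  · obtain ⟨h, rfl⟩ := hj
    simp only [lift_apply]
    exact (contDiff_apply ℝ ℂ h).contDiffAt
  · simp only [F.lift_of_notMem _ hj]
    have h1 : ContDiffAt ℝ ∞ (fun z => F.height z j) z := by
      unfold height
      refine ContDiffAt.sub (ContDiffAt.sum fun h _ => ?_) contDiffAt_const
      refine contDiffAt_const.mul (ContDiffAt.add ?_ contDiffAt_const)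
      exact (contDiff_norm_sq ℝ).contDiffAt.comp z (contDiff_apply ℝ ℂ h).contDiffAt
    exact Complex.ofRealCLM.contDiff.contDiffAt.comp z (h1.sqrt (hz j hj).ne')

variable {E : Type*} [NormedAddCommGroup E] [NormedSpace ℝ E]

/-- The coordinates of `lift` away from the vertex are real and do not contribute to the form. -/
theorem coordForm_fderiv_lift {f : E → Fin m → ℂ} {u : E} (hf : DifferentiableAt ℝ f u)
    (hdom : f u ∈ F.dom) (a b : E) :
    coordForm (fderiv ℝ (fun u => F.lift (f u)) u a) (fderiv ℝ (fun u => F.lift (f u)) u b) =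
      coordForm (fderiv ℝ f u a) (fderiv ℝ f u b) := by
  have hL : DifferentiableAt ℝ (fun u => F.lift (f u)) u :=
    ((F.contDiffAt_lift hdom).differentiableAt (by simp)).comp u hf
  have hc : ∀ j, HasFDerivAt (fun u => F.lift (f u) j) ((ContinuousLinearMap.proj (R := ℝ)
      (φ := fun _ : ι => ℂ) j).comp (fderiv ℝ (fun u => F.lift (f u)) u)) u := fun j =>
    (ContinuousLinearMap.proj (R := ℝ) (φ := fun _ : ι => ℂ) j).hasFDerivAt.comp u hL.hasFDerivAt
  have h1 : ∀ h c, fderiv ℝ (fun u => F.lift (f u)) u c (F.e h) = fderiv ℝ f u c h := by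
    intro h c
    have h2 := hc (F.e h)
    simp only [lift_apply] at h2
    have h3 : HasFDerivAt (fun u => f u h) ((ContinuousLinearMap.proj (R := ℝ)
      (φ := fun _ : Fin m => ℂ) h).comp (fderiv ℝ f u)) u :=
      (ContinuousLinearMap.proj (R := ℝ) (φ := fun _ : Fin m => ℂ) h).hasFDerivAt.comp u hf.hasFDerivAt
    exact congrArg (fun L : E →L[ℝ] ℂ => L c) (h2.unique h3)
  have h2 : ∀ j ∉ Set.range F.e, ∀ c, (fderiv ℝ (fun u => F.lift (f u)) u c j).im = 0 := by
    intro j hj c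
    have h3 := Complex.imCLM.hasFDerivAt.comp u (hc j)
    have h4 : (Complex.imCLM ∘ fun u => F.lift (f u) j) = fun _ => 0 := by
      funext u
      simp [F.lift_of_notMem _ hj]
    rw [h4] at h3
    exact congrArg (fun L : E →L[ℝ] ℝ => L c) (h3.unique (hasFDerivAt_const (0 : ℝ) u))
  unfold coordForm
  congr 1
  refine (Fintype.sum_of_injective F.e F.e.injective _ _ (fun j hj => ?_) fun h => ?_).symm
  · rw [h2 j hj, h2 j hj, zero_mul, mul_zero, sub_zero]
  · rw [h1, h1]

theorem _root_.ContDiffAt.eventually_differentiableAt {E G : Type*} [NormedAddCommGroup E]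
    [NormedSpace ℝ E] [NormedAddCommGroup G] [NormedSpace ℝ G] {f : E → G} {u : E}
    (h : ContDiffAt ℝ ∞ f u) : ∀ᶠ u' in 𝓝 u, DifferentiableAt ℝ f u' :=
  ((h.of_le (m := 1) (by simp)).eventually (by simp)).mono fun _ h => h.differentiableAt (by simp)

/-- Near a point of the level set that an element of the torus carries into the slice of a vertex chart, a
rotation by an element of the torus that depends smoothly on the point moves the level set into the slice. -/
theorem exists_local_section {ζ₀ : ι → ℂ} {x : Fin m → ℂ} (hx : x ∈ F.dom) {Y₀ : ι → ℝ}
    (hY : expT Y₀ • ζ₀ = F.lift x) :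
    ∃ (Z : (ι → ℂ) → Fin m → ℂ) (δ : (ι → ℂ) → ι → ℝ), ContDiffAt ℝ ∞ Z ζ₀ ∧ Z ζ₀ = x ∧
      ContDiffAt ℝ ∞ δ ζ₀ ∧ δ ζ₀ = 0 ∧ (∀ ζ, D.proj (δ ζ) = 0) ∧ ∀ᶠ ζ in 𝓝 ζ₀, ζ ∈ D.levelSet →
        Z ζ ∈ F.dom ∧ F.lift (Z ζ) = expT (Y₀ + δ ζ) • ζ := by
  obtain ⟨R, hR⟩ := F.exists_isSection
  have hnorm : ∀ j, ‖ζ₀ j‖ = ‖F.lift x j‖ := fun j => by rw [← hY, norm_torus_smul]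
  have h0 : ∀ j, j ∉ Set.range F.e → ζ₀ j ≠ 0 := fun j hj => by
    rw [← norm_ne_zero_iff, hnorm, norm_ne_zero_iff]
    exact F.lift_ne_zero hx hj
  obtain ⟨δ, hδ, hδ0, hker, hstr⟩ := hR.exists_local_straightening h0 (Y := Y₀) fun j hj => by
    rw [hY, hnorm]
    exact F.lift_eq_norm hj
  have hη : ContDiffAt ℝ ∞ (fun ζ => expT (Y₀ + δ ζ) • ζ) ζ₀ :=
    contDiffAt_expT_smul (contDiffAt_const.add hδ) contDiffAt_id
  refine ⟨fun ζ => (expT (Y₀ + δ ζ) • ζ) ∘ F.e, δ, contDiffAt_pi.2 fun h => contDiffAt_pi.1 hη (F.e h),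
    ?_, hδ, hδ0, hker, ?_⟩
  · simp only [hδ0, add_zero, hY]
    exact funext fun h => F.lift_apply x h
  · filter_upwards [hstr] with ζ hs hζ
    have h1 : expT (Y₀ + δ ζ) • ζ ∈ D.levelSet := D.smul_mem_levelSet _ hζ
    refine ⟨F.comp_mem_dom h1 fun j hj => ?_, F.lift_comp h1 fun j hj => ?_⟩
    · rw [← norm_ne_zero_iff, norm_torus_smul, norm_ne_zero_iff]
      exact (hs j hj).1
    · rw [norm_torus_smul]
      exact (hs j hj).2

/-- A smooth family of points of the level set lifts locally, through a prescribed point, to a smooth family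
of points of a vertex chart; the lift has the same pull-back of the symplectic form. -/
theorem exists_local_lift {ζ : E → ι → ℂ} {u₀ : E} (hζ : ContDiffAt ℝ ∞ ζ u₀)
    (hmem : ∀ᶠ u in 𝓝 u₀, ζ u ∈ D.levelSet) {x : Fin m → ℂ} (hx : x ∈ F.dom) {Y₀ : ι → ℝ}
    (hY : expT Y₀ • ζ u₀ = F.lift x) :
    ∃ (f : E → Fin m → ℂ) (δ : E → ι → ℝ), ContDiffAt ℝ ∞ f u₀ ∧ f u₀ = x ∧
      ContDiffAt ℝ ∞ δ u₀ ∧ δ u₀ = 0 ∧ ∀ᶠ u in 𝓝 u₀, f u ∈ F.dom ∧ D.proj (δ u) = 0 ∧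
        F.lift (f u) = expT (Y₀ + δ u) • ζ u ∧ ∀ a b : E,
          coordForm (fderiv ℝ f u a) (fderiv ℝ f u b) = coordForm (fderiv ℝ ζ u a) (fderiv ℝ ζ u b) := by
  obtain ⟨Z, δ, hZ, hZ0, hδ, hδ0, hker, hgood⟩ := F.exists_local_section hx hY
  have hf : ContDiffAt ℝ ∞ (Z ∘ ζ) u₀ := hZ.comp u₀ hζ
  have hδ' : ContDiffAt ℝ ∞ (δ ∘ ζ) u₀ := hδ.comp u₀ hζ
  refine ⟨Z ∘ ζ, δ ∘ ζ, hf, hZ0, hδ', hδ0, ?_⟩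
  have hgood' := (hζ.continuousAt.eventually hgood).and hmem
  filter_upwards [hgood'.eventually_nhds, hmem.eventually_nhds, hζ.eventually_differentiableAt,
    hδ'.eventually_differentiableAt, hf.eventually_differentiableAt] with u h1 h2 h3 h4 h5
  obtain ⟨h6, h7⟩ := h1.self_of_nhds
  refine ⟨(h6 h7).1, hker _, (h6 h7).2, fun a b => ?_⟩
  rw [← F.coordForm_fderiv_lift h5 (h6 h7).1]
  have h8 : (fun u => F.lift ((Z ∘ ζ) u)) =ᶠ[𝓝 u] fun u => expT (Y₀ + (δ ∘ ζ) u) • ζ u :=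
    h1.mono fun u hu => (hu.1 hu.2).2
  rw [h8.fderiv_eq]
  refine coordForm_fderiv_expT_smul h3 (h4.const_add Y₀) h2 (v := D.proj Y₀) ?_ a b
  exact Filter.Eventually.of_forall fun u => by
    rw [map_add, Function.comp_apply, hker, add_zero]

end VertexFrame

end Lift

/-! ### The vertex charts -/

/-- Sets of points of `ℂ^m` that are given by a convex condition on the squared moduli of the coordinates
are connected: they are images of convex sets under polar coordinates. -/
theorem isConnected_setOf_norm_sq {m : ℕ} {C : Set (Fin m → ℝ)} (hC : Convex ℝ C) (hne : C.Nonempty)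
    (h0 : ∀ c ∈ C, ∀ h, 0 ≤ c h) : IsConnected {z : Fin m → ℂ | (fun h => ‖z h‖ ^ 2) ∈ C} := by
  have hcont : Continuous fun p : (Fin m → ℝ) × (Fin m → ℝ) =>
      expT p.2 • fun h => ((Real.sqrt (p.1 h) : ℝ) : ℂ) :=
    continuous_expT_smul.comp (continuous_snd.prodMk (continuous_pi fun h =>
      Complex.continuous_ofReal.comp (Real.continuous_sqrt.comp (by fun_prop))))
  have himage : {z : Fin m → ℂ | (fun h => ‖z h‖ ^ 2) ∈ C} =
      (fun p : (Fin m → ℝ) × (Fin m → ℝ) => expT p.2 • fun h => ((Real.sqrt (p.1 h) : ℝ) : ℂ)) ''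
        (C ×ˢ Set.univ) := by
    ext z
    constructor
    · intro hz
      refine ⟨(fun h => ‖z h‖ ^ 2, fun h => Complex.arg (z h) / (2 * Real.pi)), ⟨hz, trivial⟩, ?_⟩
      funext h
      refine (expT_smul_apply _ _ _).trans ?_
      have : 2 * Real.pi * (Complex.arg (z h) / (2 * Real.pi)) = Complex.arg (z h) := by
        field_simp
      simp only [this, Real.sqrt_sq (norm_nonneg _)]
      rw [mul_comm, Complex.norm_mul_exp_arg_mul_I]
    · rintro ⟨⟨c, φ⟩, ⟨hc, -⟩, rfl⟩
      have : (fun h => ‖(expT φ • fun h => ((Real.sqrt (c h) : ℝ) : ℂ)) h‖ ^ 2) = c := by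
        funext h
        rw [norm_torus_smul, Complex.norm_real, Real.norm_of_nonneg (Real.sqrt_nonneg _),
          Real.sq_sqrt (h0 c hc h)]
      rw [Set.mem_ofPred_eq, this]
      exact hc
  rw [himage]
  exact ((hC.prod convex_univ).isConnected (hne.prod Set.univ_nonempty)).image _ hcont.continuousOn

theorem dense_forall_ne_zero (m : ℕ) : Dense {z : Fin m → ℂ | ∀ h, z h ≠ 0} := by
  have : {z : Fin m → ℂ | ∀ h, z h ≠ 0} = Set.univ.pi fun _ => ({0}ᶜ : Set ℂ) := by
    ext z; simp
  rw [this]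
  exact dense_pi _ fun h _ => dense_compl_singleton 0

theorem stdForm_nondegenerate {m : ℕ} (u : Fin m → ℂ)
    (h : ∀ v : Fin m → ℂ, stdForm m ![u, v] = 0) : u = 0 := by
  have h1 : ∀ v : Fin m → ℂ, ∑ j, ((u j).im * (v j).re - (u j).re * (v j).im) = 0 := fun v => by
    have h2 : (1 / Real.pi) * ∑ j, ((u j).im * (v j).re - (u j).re * (v j).im) = 0 := h v
    exact (mul_eq_zero.1 h2).resolve_left (by positivity)
  funext j
  have h2 := h1 (Pi.single j 1)
  have h3 := h1 (Pi.single j Complex.I)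
  rw [Finset.sum_eq_single j (fun i _ hi => by simp [hi]) (by simp)] at h2 h3
  simp at h2 h3
  exact Complex.ext h3 h2

section Charts

variable {ι V : Type*} [Fintype ι] [AddCommGroup V] [Module ℝ V] {D : ToricData ι V}

theorem cls_eq_cls_iff {z w : D.levelSet} :
    D.cls z = D.cls w ↔ ∃ Y : ι → ℝ, D.proj Y ∈ D.Q ∧ expT Y • z.1 = w.1 := by
  rw [D.cls_eq_iff]
  constructor
  · rintro ⟨_, ⟨Y, hY, rfl⟩, rfl⟩
    exact ⟨Y, hY, rfl⟩
  · rintro ⟨Y, hY, h⟩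
    exact ⟨expT Y, ⟨Y, hY, rfl⟩, Subtype.ext h⟩

theorem proj_mem_of_expT_eq_one (hX : ∀ j, D.X j ∈ D.Q) {Y : ι → ℝ} (hY : expT Y = 1) :
    D.proj Y ∈ D.Q := by
  rw [proj_apply]
  refine sum_mem fun j _ => ?_
  obtain ⟨k, hk⟩ := expT_apply_eq_one_iff.1 (congrFun hY j)
  rw [hk, Int.cast_smul_eq_zsmul]
  exact zsmul_mem (hX j) k

/-- Integral coordinates of a representative of an element of `N` can be dropped, since the `X_j` lie in
`Q`. -/
theorem exists_supported (hX : ∀ j, D.X j ∈ D.Q) {S : Set ι} {Y : ι → ℝ} (hY : D.proj Y ∈ D.Q)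
    (hS : ∀ j ∉ S, expT Y j = 1) :
    ∃ Y' : ι → ℝ, (∀ j ∉ S, Y' j = 0) ∧ D.proj Y' ∈ D.Q ∧ expT Y' = expT Y := by
  classical
  have h1 : expT (Y - S.indicator Y) = 1 := by
    funext j
    by_cases hj : j ∈ S
    · simp [expT, hj]
    · have : (Y - S.indicator Y) j = Y j := by simp [hj]
      rw [expT, this]
      exact hS j hj
  refine ⟨S.indicator Y, fun j hj => by simp [hj], ?_, ?_⟩
  · have := D.Q.sub_mem hY (proj_mem_of_expT_eq_one hX h1)
    rwa [← map_sub, sub_sub_cancel] at this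
  · conv_rhs => rw [← sub_add_cancel Y (S.indicator Y), expT_add, h1, one_mul]

theorem continuous_torusAct (t : ι → Circle) : Continuous (D.torusAct t) :=
  Continuous.subtype_mk (continuous_pi fun j => by
    exact continuous_const.mul ((continuous_apply j).comp continuous_subtype_val)) _

theorem isOpenMap_cls : IsOpenMap D.cls := by
  intro U hU
  have hq : Topology.IsQuotientMap D.cls := isQuotientMap_quot_mk
  rw [← hq.isOpen_preimage]
  have : D.cls ⁻¹' (D.cls '' U) = ⋃ t ∈ D.N, D.torusAct t ⁻¹' U := by
    ext z
    simp only [Set.mem_preimage, Set.mem_image, Set.mem_iUnion, exists_prop]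
    constructor
    · rintro ⟨w, hw, h⟩
      obtain ⟨t, ht, rfl⟩ := D.cls_eq_iff.1 h.symm
      exact ⟨t, ht, hw⟩
    · rintro ⟨t, ht, hw⟩
      exact ⟨_, hw, (D.cls_eq_iff.2 ⟨t, ht, rfl⟩).symm⟩
  rw [this]
  refine isOpen_biUnion fun t _ => hU.preimage (continuous_torusAct t)

theorem continuous_cls : Continuous D.cls := continuous_quot_mk

namespace VertexFrame

variable {m : ℕ} (F : D.VertexFrame m)

theorem height_congr {z w : Fin m → ℂ} (h : ∀ i, ‖z i‖ = ‖w i‖) (j : ι) :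
    F.height z j = F.height w j := by
  simp only [height, h]

theorem torus_smul_mem_dom (t : Fin m → Circle) {z : Fin m → ℂ} (hz : z ∈ F.dom) : t • z ∈ F.dom :=
  fun j hj => by
    rw [F.height_congr (norm_torus_smul t z)]
    exact hz j hj

/-- The transformation of the domain of the chart given by an element of the torus. -/
def torusPerm (t : Fin m → Circle) : Equiv.Perm F.dom where
  toFun z := ⟨t • z.1, F.torus_smul_mem_dom t z.2⟩
  invFun z := ⟨t⁻¹ • z.1, F.torus_smul_mem_dom t⁻¹ z.2⟩
  left_inv z := Subtype.ext (inv_smul_smul t z.1)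
  right_inv z := Subtype.ext (smul_inv_smul t z.1)

theorem torusPerm_mem_grp {t : ι → Circle} (ht : t ∈ D.N) (h1 : ∀ j, j ∉ Set.range F.e → t j = 1) :
    F.torusPerm (t ∘ F.e) ∈ F.grp :=
  ⟨t, ht, h1, fun _ _ => rfl⟩

theorem lift_torus_smul {t : ι → Circle} (h1 : ∀ j, j ∉ Set.range F.e → t j = 1) (z : Fin m → ℂ) :
    F.lift ((t ∘ F.e) • z) = t • F.lift z := by
  funext j
  change _ = (t j : ℂ) * F.lift z j
  by_cases hj : j ∈ Set.range F.e
  · obtain ⟨h, rfl⟩ := hj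
    rw [lift_apply, lift_apply]
    rfl
  · rw [F.lift_of_notMem _ hj, F.lift_of_notMem _ hj, h1 j hj, Circle.coe_one, one_mul,
      F.height_congr (norm_torus_smul _ z)]

/-- An element of the torus that relates two points of the slice is trivial at the facets away from the
vertex, since both points have positive coordinates there. -/
theorem eq_one_of_smul_lift {t : ι → Circle} {z w : Fin m → ℂ} (hz : z ∈ F.dom)
    (h : t • F.lift z = F.lift w) {j : ι} (hj : j ∉ Set.range F.e) : t j = 1 := by
  have h1 : (t j : ℂ) * F.lift z j = F.lift w j := congrFun h j
  have h2 : ‖F.lift w j‖ = ‖F.lift z j‖ := by rw [← h, norm_torus_smul]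
  rw [F.lift_eq_norm hj (z := w), h2, ← F.lift_eq_norm hj] at h1
  exact Circle.ext (mul_right_cancel₀ (F.lift_ne_zero hz hj) (by rw [h1, Circle.coe_one, one_mul]))

/-- The normal vectors at a vertex form a basis, so an angle vector is determined by its image under `π` and
its coordinates at the other facets. -/
theorem eq_of_proj_eq {Y Z : ι → ℝ} (h : ∀ j, j ∉ Set.range F.e → Y j = Z j)
    (hp : D.proj Y = D.proj Z) : Y = Z := by
  have h1 : ∑ i, (Y - Z) (F.e i) • F.basis i = 0 := by
    have h2 : D.proj (Y - Z) = 0 := by rw [map_sub, hp, sub_self]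
    rw [proj_apply] at h2
    rw [← h2]
    refine Fintype.sum_of_injective F.e F.e.injective _ _ (fun j hj => ?_) fun i => ?_
    · rw [Pi.sub_apply, h j hj, sub_self, zero_smul]
    · rw [F.basis_eq]
  have h2 := Fintype.linearIndependent_iff.1 F.basis.linearIndependent _ h1
  funext j
  by_cases hj : j ∈ Set.range F.e
  · obtain ⟨i, rfl⟩ := hj
    exact sub_eq_zero.1 (h2 i)
  · exact h j hj

theorem map_eq_iff (x y : F.dom) : F.chart.map x = F.chart.map y ↔ ∃ γ ∈ F.grp, γ x = y := by
  change D.cls _ = D.cls _ ↔ _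
  rw [D.cls_eq_iff]
  constructor
  · rintro ⟨t, ht, h⟩
    have h' : t • F.lift x.1 = F.lift y.1 := congrArg Subtype.val h
    have h1 : ∀ j, j ∉ Set.range F.e → t j = 1 := fun j => F.eq_one_of_smul_lift x.2 h'
    refine ⟨_, F.torusPerm_mem_grp ht h1, Subtype.ext (funext fun i => ?_)⟩
    have h2 := congrFun h' (F.e i)
    rw [lift_apply] at h2
    rw [← h2]
    change (t (F.e i) : ℂ) * x.1 i = (t (F.e i) : ℂ) * F.lift x.1 (F.e i)
    rw [lift_apply]
  · rintro ⟨γ, ⟨t, ht, h1, hγ⟩, rfl⟩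
    refine ⟨t, ht, Subtype.ext ?_⟩
    change t • F.lift x.1 = F.lift (γ x).1
    rw [← F.lift_torus_smul h1]
    exact congrArg F.lift (funext fun i => (hγ x i).symm)

theorem countable_grp (hQ : (D.Q : Set V).Countable) (hX : ∀ j, D.X j ∈ D.Q) : Countable F.grp := by
  have key : ∀ γ : F.grp, ∃ q : D.Q, ∃ Y : ι → ℝ, D.proj Y = q ∧ (∀ j, j ∉ Set.range F.e → Y j = 0) ∧
      ∀ z i, (γ.1 z).1 i = expT Y (F.e i) • z.1 i := by
    rintro ⟨γ, _, ⟨Y, hY, rfl⟩, h1, hγ⟩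
    obtain ⟨Y', h2, h3, h4⟩ := exists_supported hX hY h1
    exact ⟨⟨_, h3⟩, Y', rfl, h2, fun z i => by rw [h4]; exact hγ z i⟩
  choose q Y hY h0 hγ using key
  have : Countable D.Q := hQ.to_subtype
  refine Function.Injective.countable (f := q) fun γ γ' h => Subtype.ext (Equiv.ext fun z => ?_)
  have hYY : Y γ = Y γ' := F.eq_of_proj_eq (fun j hj => by rw [h0 _ j hj, h0 _ j hj])
    (by rw [hY, hY, h])
  exact Subtype.ext (funext fun i => by rw [hγ, hγ, hYY])

theorem continuous_map : Continuous F.chart.map :=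
  continuous_cls.comp (Continuous.subtype_mk (F.continuous_lift.comp continuous_subtype_val) _)

theorem isOpenMap_map : IsOpenMap F.chart.map := by
  intro U hU
  have hq : Topology.IsQuotientMap D.cls := isQuotientMap_quot_mk
  rw [← hq.isOpen_preimage, isOpen_iff_mem_nhds]
  rintro ζ₁ ⟨z₁, hz₁, h1⟩
  obtain ⟨Y₀, hY₀, h2⟩ := cls_eq_cls_iff.1 h1.symm
  obtain ⟨Z, δ, hZ, hZ0, -, -, hker, hgood⟩ := F.exists_local_section z₁.2 h2
  obtain ⟨U', hU', rfl⟩ := isOpen_induced_iff.1 hU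
  have h3 : ∀ᶠ ζ in 𝓝 ζ₁.1, Z ζ ∈ U' :=
    hZ.continuousAt.eventually (hU'.mem_nhds (by rw [hZ0]; exact hz₁))
  have h4 := (continuous_subtype_val.tendsto ζ₁).eventually (hgood.and h3)
  filter_upwards [h4] with ζ hζ
  obtain ⟨h5, h6⟩ := hζ.1 ζ.2
  refine ⟨⟨Z ζ, h5⟩, hζ.2, (cls_eq_cls_iff.2 ⟨Y₀ + δ ζ, ?_, h6.symm⟩).symm⟩
  rwa [map_add, hker, add_zero]

/-- A set `A` of coordinates supports free points: only the identity of the chart group fixes the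
coordinates in `A`. -/
def IsFreeSupport (A : Set (Fin m)) : Prop :=
  ∀ γ ∈ F.grp, ∀ t : ι → Circle, (∀ z i, (γ z).1 i = t (F.e i) • z.1 i) →
    (∀ i ∈ A, t (F.e i) = 1) → γ = 1

theorem IsFreeSupport.mono {F : D.VertexFrame m} {A B : Set (Fin m)} (h : F.IsFreeSupport A)
    (hAB : A ⊆ B) : F.IsFreeSupport B :=
  fun γ hγ t ht hB => h γ hγ t ht fun i hi => hB i (hAB hi)

theorem isFreeSupport_univ : F.IsFreeSupport Set.univ := fun γ _ t ht h1 =>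
  Equiv.ext fun z => Subtype.ext (funext fun i => by rw [ht, h1 i trivial, one_smul]; rfl)

theorem mem_freeSet_iff {z : Fin m → ℂ} :
    z ∈ F.chart.freeSet ↔ z ∈ F.dom ∧ F.IsFreeSupport {i | z i ≠ 0} := by
  constructor
  · rintro ⟨hz, h⟩
    refine ⟨hz, fun γ hγ t ht h1 => h γ hγ (Subtype.ext (funext fun i => ?_))⟩
    refine (ht ⟨z, hz⟩ i).trans ?_
    change t (F.e i) • z i = z i
    by_cases hi : z i = 0
    · rw [hi, smul_zero]
    · rw [h1 i hi, one_smul]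
  · rintro ⟨hz, h⟩
    refine ⟨hz, fun γ hγ hfix => ?_⟩
    obtain ⟨t, -, -, ht⟩ := id hγ
    refine h γ hγ t ht fun i hi => Circle.ext (mul_right_cancel₀ hi ?_)
    rw [Circle.coe_one, one_mul]
    exact (ht ⟨z, hz⟩ i).symm.trans (congrFun (congrArg Subtype.val hfix) i)

/-- The squared moduli of the points of the domain whose coordinates in `B` do not vanish and whose
nonvanishing coordinates satisfy the condition `P`. -/
def sqNormSet (B : Set (Fin m)) (P : Set (Fin m) → Prop) : Set (Fin m → ℝ) :=
  {c | (∀ i, 0 ≤ c i) ∧ (∀ j, j ∉ Set.range F.e →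
    0 < ∑ i, F.basis.repr (D.X j) i * (c i + D.lam (F.e i)) - D.lam j) ∧
    (∀ i ∈ B, 0 < c i) ∧ P {i | c i ≠ 0}}

theorem norm_sq_mem_sqNormSet {B : Set (Fin m)} {P : Set (Fin m) → Prop} {z : Fin m → ℂ} :
    (fun i => ‖z i‖ ^ 2) ∈ F.sqNormSet B P ↔
      z ∈ F.dom ∧ (∀ i ∈ B, z i ≠ 0) ∧ P {i | z i ≠ 0} := by
  have h1 : {i | ‖z i‖ ^ 2 ≠ 0} = {i | z i ≠ 0} := by ext i; simp
  have h2 : ∀ i, 0 < ‖z i‖ ^ 2 ↔ z i ≠ 0 := fun i => by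
    rw [← norm_ne_zero_iff, sq_pos_iff]
  simp only [sqNormSet, Set.mem_ofPred_eq, h1, h2, sq_nonneg, implies_true, true_and]
  rfl

theorem convex_sqNormSet (B : Set (Fin m)) {P : Set (Fin m) → Prop}
    (hP : ∀ A A', A ⊆ A' → P A → P A') : Convex ℝ (F.sqNormSet B P) := by
  rw [convex_iff_forall_pos]
  rintro c ⟨c0, c1, c2, c3⟩ d ⟨d0, d1, d2, d3⟩ a b ha hb hab
  refine ⟨fun i => ?_, fun j hj => ?_, fun i hi => ?_, hP _ _ (fun i hi => ?_) c3⟩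
  · have := c0 i
    have := d0 i
    simp only [Pi.add_apply, Pi.smul_apply, smul_eq_mul]
    positivity
  · have h1 := mul_pos ha (c1 j hj)
    have h2 := mul_pos hb (d1 j hj)
    have h3 : ∑ i, F.basis.repr (D.X j) i * ((a • c + b • d) i + D.lam (F.e i)) - D.lam j =
        a * (∑ i, F.basis.repr (D.X j) i * (c i + D.lam (F.e i)) - D.lam j) +
        b * (∑ i, F.basis.repr (D.X j) i * (d i + D.lam (F.e i)) - D.lam j) := by
      obtain rfl : b = 1 - a := by linarith
      rw [mul_sub, mul_sub, Finset.mul_sum, Finset.mul_sum]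
      have : ∀ x y z w : ℝ, x - y + (z - w) = (x + z) - (y + w) := fun _ _ _ _ => by ring
      rw [this, ← Finset.sum_add_distrib]
      congr 1
      · refine Finset.sum_congr rfl fun i _ => ?_
        simp only [Pi.add_apply, Pi.smul_apply, smul_eq_mul]
        ring
      · ring
    rw [h3]
    exact add_pos h1 h2
  · have := c2 i hi
    have := d2 i hi
    simp only [Pi.add_apply, Pi.smul_apply, smul_eq_mul]
    positivity
  · have h1 : 0 < c i := lt_of_le_of_ne (c0 i) (Ne.symm hi)
    have h2 := d0 i
    have : 0 < a * c i + b * d i := by positivity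
    exact this.ne'

theorem isConnected_dom_inter {B : Set (Fin m)} {P : Set (Fin m) → Prop}
    (hP : ∀ A A', A ⊆ A' → P A → P A')
    (hne : {z | z ∈ F.dom ∧ (∀ i ∈ B, z i ≠ 0) ∧ P {i | z i ≠ 0}}.Nonempty) :
    IsConnected {z | z ∈ F.dom ∧ (∀ i ∈ B, z i ≠ 0) ∧ P {i | z i ≠ 0}} := by
  have h : {z | z ∈ F.dom ∧ (∀ i ∈ B, z i ≠ 0) ∧ P {i | z i ≠ 0}} =
      {z : Fin m → ℂ | (fun h => ‖z h‖ ^ 2) ∈ F.sqNormSet B P} :=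
    Set.ext fun z => F.norm_sq_mem_sqNormSet.symm
  rw [h] at hne ⊢
  obtain ⟨z, hz⟩ := hne
  exact isConnected_setOf_norm_sq (F.convex_sqNormSet B hP) ⟨_, hz⟩ fun c hc => hc.1

theorem zero_mem_dom : (0 : Fin m → ℂ) ∈ F.dom := by
  intro j hj
  have h1 : D.lam j ≤ F.ν (D.X j) := F.isVertex.1 j
  have h2 : F.ν (D.X j) ≠ D.lam j := fun h => hj (F.range_e ▸ h)
  have h3 : F.ν (D.X j) = ∑ i, F.basis.repr (D.X j) i * D.lam (F.e i) := by
    conv_lhs => rw [← F.basis.sum_repr (D.X j), map_sum]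
    refine Finset.sum_congr rfl fun i _ => ?_
    have h4 : F.e i ∈ D.active F.ν := F.range_e ▸ Set.mem_range_self i
    have h5 : F.ν (D.X (F.e i)) = D.lam (F.e i) := h4
    rw [map_smul, F.basis_eq, h5, smul_eq_mul]
  have h4 : F.height 0 j = F.ν (D.X j) - D.lam j := by
    rw [h3, height]
    simp
  rw [h4, sub_pos]
  exact lt_of_le_of_ne h1 h2.symm

theorem dom_subset_closure_freeSet : F.dom ⊆ closure F.chart.freeSet := by
  refine ((dense_forall_ne_zero m).open_subset_closure_inter F.isOpen_dom).trans (closure_mono ?_)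
  rintro z ⟨hz, h0⟩
  refine F.mem_freeSet_iff.2 ⟨hz, F.isFreeSupport_univ.mono fun i _ => h0 i⟩

/-- Whether a point is free depends only on which of its coordinates vanish, and having fewer vanishing
coordinates helps; so the squared moduli of the free points form a convex set. -/
theorem isConnected_freeSet_inter {B : Set (Fin m)}
    (hne : {z | z ∈ F.dom ∧ ∀ i ∈ B, z i ≠ 0}.Nonempty) :
    IsConnected (F.chart.freeSet ∩ {z | z ∈ F.dom ∧ ∀ i ∈ B, z i ≠ 0}) := by
  have h1 : F.chart.freeSet ∩ {z | z ∈ F.dom ∧ ∀ i ∈ B, z i ≠ 0} =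
      {z | z ∈ F.dom ∧ (∀ i ∈ B, z i ≠ 0) ∧ F.IsFreeSupport {i | z i ≠ 0}} := by
    ext z
    rw [Set.mem_inter_iff, F.mem_freeSet_iff]
    exact ⟨fun h => ⟨h.1.1, h.2.2, h.1.2⟩, fun h => ⟨⟨h.1, h.2.2⟩, h.1, h.2.1⟩⟩
  rw [h1]
  refine F.isConnected_dom_inter (fun A A' hA h => h.mono hA) ?_
  have hopen : IsOpen {z | z ∈ F.dom ∧ ∀ i ∈ B, z i ≠ 0} := by
    refine F.isOpen_dom.inter ?_
    have : {z : Fin m → ℂ | ∀ i ∈ B, z i ≠ 0} = ⋂ i : Fin m, {z | i ∈ B → z i ≠ 0} := by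
      ext z; simp
    change IsOpen {z : Fin m → ℂ | ∀ i ∈ B, z i ≠ 0}
    rw [this]
    refine isOpen_iInter_of_finite fun i => ?_
    by_cases hi : i ∈ B
    · simp only [hi, true_imp_iff]
      exact isOpen_ne_fun (continuous_apply i) continuous_const
    · simp only [hi, false_imp_iff]
      exact isOpen_univ
  obtain ⟨z, hz, h0⟩ := (dense_forall_ne_zero m).inter_open_nonempty _ hopen hne
  exact ⟨z, hz.1, hz.2, F.isFreeSupport_univ.mono fun i _ => h0 i⟩

theorem isConnected_freeSet : IsConnected F.chart.freeSet := by
  have h := F.isConnected_freeSet_inter (B := ∅) ⟨0, F.zero_mem_dom, by simp⟩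
  have h1 : F.chart.freeSet ⊆ {z | z ∈ F.dom ∧ ∀ i ∈ (∅ : Set (Fin m)), z i ≠ 0} :=
    fun z hz => ⟨(F.mem_freeSet_iff.1 hz).1, by simp⟩
  rwa [Set.inter_eq_left.2 h1] at h

theorem smooth_grp {γ : Equiv.Perm F.dom} (hγ : γ ∈ F.grp) :
    ∃ h : (Fin m → ℂ) → (Fin m → ℂ), ContDiffOn ℝ ∞ h F.dom ∧ (∀ x : F.dom, h x = γ x) ∧
      ∀ x ∈ F.dom, pullbackForm h F.chart.form x = F.chart.form x := by
  obtain ⟨t, -, -, ht⟩ := hγ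
  let L : (Fin m → ℂ) →L[ℝ] (Fin m → ℂ) := ContinuousLinearMap.pi fun i =>
    (t (F.e i) : ℂ) • (ContinuousLinearMap.proj i : (Fin m → ℂ) →L[ℝ] ℂ)
  refine ⟨L, L.contDiff.contDiffOn, fun x => funext fun i => (ht x i).symm, fun x _ => ?_⟩
  ext v
  change pullbackForm L (fun _ => stdForm m) x v = stdForm m v
  rw [pullbackForm_stdForm, L.fderiv]
  exact coordForm_torus_smul (t ∘ F.e) (v 0) (v 1)

theorem isSymplectic_chart (hQ : (D.Q : Set V).Countable) (hX : ∀ j, D.X j ∈ D.Q) :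
    F.chart.IsSymplectic where
  isOpen_dom := F.isOpen_dom
  countable_grp := F.countable_grp hQ hX
  smooth_grp _ hγ := F.smooth_grp hγ
  connected_free := F.isConnected_freeSet
  dense_free := F.dom_subset_closure_freeSet
  continuous_map := F.continuous_map
  isOpenMap_map := F.isOpenMap_map
  map_eq_iff := F.map_eq_iff
  smooth_form := contDiffOn_const
  closed_form x _ := by
    change ContinuousAlternatingMap.alternatizeUncurryFin
      (fderiv ℝ (fun _ : Fin m → ℂ => stdForm m) x) = 0
    rw [fderiv_fun_const]
    exact map_zero (ContinuousAlternatingMap.alternatizeUncurryFinCLM ℝ (Fin m → ℂ) ℝ)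
  nondegenerate_form _ _ u hu := stdForm_nondegenerate u hu

end VertexFrame

end Charts

/-! ### The action of the quasitorus -/

section Action

variable {ι V : Type*} [Fintype ι] [AddCommGroup V] [Module ℝ V] {D : ToricData ι V}

theorem expT_neg_arg_smul (z : ι → ℂ) (j : ι) :
    (expT (fun j => -(Complex.arg (z j) / (2 * Real.pi))) • z) j = ‖z j‖ := by
  refine (expT_smul_apply _ _ _).trans ?_
  have h1 : 2 * Real.pi * -(Complex.arg (z j) / (2 * Real.pi)) = -Complex.arg (z j) := by
    field_simp
  have h2 := Complex.norm_mul_exp_arg_mul_I (z j)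
  rw [h1]
  calc _ = Complex.exp ((-Complex.arg (z j) : ℝ) * Complex.I) *
        (‖z j‖ * Complex.exp (Complex.arg (z j) * Complex.I)) := by rw [h2]
    _ = _ := by
      rw [mul_left_comm, ← Complex.exp_add]
      simp

/-- The coordinates of `z` outside `S` can be made nonnegative by an element of the torus that has a
representative in a prescribed fibre of `π`. -/
theorem IsSection.exists_normalizing {S : Set ι} {R : V →ₗ[ℝ] (ι → ℝ)} (hR : D.IsSection S R)
    (z : ι → ℂ) (v : V) : ∃ Y : ι → ℝ, D.proj Y = v ∧
      (∀ j ∉ S, (expT Y • z) j = ‖z j‖) ∧ ∀ j ∉ S, z j = ‖z j‖ → Y j = 0 := by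
  let Y₀ : ι → ℝ := fun j => -(Complex.arg (z j) / (2 * Real.pi))
  have h1 : ∀ j ∉ S, (D.toKer R Y₀ + R v) j = Y₀ j := fun j hj => by
    rw [Pi.add_apply, hR.toKer_apply_of_notMem _ hj, hR.apply_eq_zero _ _ hj, add_zero]
  refine ⟨D.toKer R Y₀ + R v, by rw [map_add, hR.proj_toKer, hR.proj_apply, zero_add],
    fun j hj => ?_, fun j hj hz => ?_⟩
  · rw [← expT_neg_arg_smul z j, expT_smul_apply, expT_smul_apply, h1 j hj]
  · rw [h1 j hj]
    have : Complex.arg (z j) = 0 := by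
      rw [hz]
      exact Complex.arg_ofReal_of_nonneg (norm_nonneg _)
    simp [Y₀, this]

theorem proj_surjective (h : Submodule.span ℝ (Set.range D.X) = ⊤) : Function.Surjective D.proj := by
  rw [← LinearMap.range_eq_top, proj, Fintype.range_linearCombination, h]

theorem act_zero (x : D.Space) : D.act 0 x = x := by
  induction x using Quotient.inductionOn with
  | h z =>
    have h := D.act_cls 0 z
    rw [map_zero] at h
    refine h.trans (congrArg D.cls (Subtype.ext ?_))
    change expT 0 • z.1 = z.1
    rw [expT_zero, one_smul]

theorem act_add (h : Submodule.span ℝ (Set.range D.X) = ⊤) (p q : V ⧸ D.Q) (x : D.Space) :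
    D.act (p + q) x = D.act p (D.act q x) := by
  induction p using QuotientAddGroup.induction_on with
  | H v =>
  induction q using QuotientAddGroup.induction_on with
  | H w =>
  obtain ⟨Y, rfl⟩ := proj_surjective h v
  obtain ⟨Z, rfl⟩ := proj_surjective h w
  induction x using Quotient.inductionOn with
  | h z =>
    have h1 := D.act_cls (Y + Z) z
    rw [map_add] at h1
    refine h1.trans ?_
    change _ = D.act _ (D.act _ (D.cls z))
    rw [D.act_cls, D.act_cls]
    exact congrArg D.cls (Subtype.ext (expT_smul_expT_smul Y Z z.1).symm)

theorem continuous_act (q : V ⧸ D.Q) : Continuous (D.act q) := by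
  have h : ∀ t : ι → Circle, Continuous (D.torusActSpace t) := fun t => by
    have h1 : Continuous (D.torusAct t) := continuous_torusAct t
    exact Continuous.quotient_map' h1 _
  exact h _

theorem isHomeomorph_act (h : Submodule.span ℝ (Set.range D.X) = ⊤) (q : V ⧸ D.Q) :
    IsHomeomorph (D.act q) := by
  let e : D.Space ≃ₜ D.Space :=
    { toFun := D.act q
      invFun := D.act (-q)
      left_inv := fun x => by rw [← act_add h, neg_add_cancel, act_zero]
      right_inv := fun x => by rw [← act_add h, add_neg_cancel, act_zero]
      continuous_toFun := continuous_act q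
      continuous_invFun := continuous_act (-q) }
  exact e.isHomeomorph

theorem act_mk_cls_eq_iff (h : Submodule.span ℝ (Set.range D.X) = ⊤) {v : V} {z w : D.levelSet} :
    D.act (QuotientAddGroup.mk v) (D.cls z) = D.cls w ↔
      ∃ Y : ι → ℝ, D.proj Y - v ∈ D.Q ∧ expT Y • z.1 = w.1 := by
  obtain ⟨Y₁, rfl⟩ := proj_surjective h v
  rw [D.act_cls, cls_eq_cls_iff]
  constructor
  · rintro ⟨Y, hY, h1⟩
    refine ⟨Y + Y₁, by rwa [map_add, add_sub_cancel_right], ?_⟩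
    rw [← h1, ← expT_smul_expT_smul]
    rfl
  · rintro ⟨Y, hY, h1⟩
    refine ⟨Y - Y₁, by rwa [map_sub], ?_⟩
    rw [← h1]
    exact (expT_smul_expT_smul _ _ _).trans (by rw [sub_add_cancel])

end Action

/-! ### Changes of charts -/

section Transition

variable {ι V : Type*} [Fintype ι] [AddCommGroup V] [Module ℝ V] {D : ToricData ι V}

namespace VertexFrame

variable {m : ℕ} (F F' : D.VertexFrame m) (v : V)

theorem span_range_X (F : D.VertexFrame m) : Submodule.span ℝ (Set.range D.X) = ⊤ :=
  top_le_iff.1 (F.span_range.symm.le.trans (Submodule.span_mono (Set.image_subset_range _ _)))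

theorem exists_rep_act_iff {z z' : Fin m → ℂ} :
    (∃ p, (F.chart.push (D.act (QuotientAddGroup.mk v))).Rep z p ∧ F'.chart.Rep z' p) ↔
      z ∈ F.dom ∧ z' ∈ F'.dom ∧ ∃ Y : ι → ℝ, D.proj Y - v ∈ D.Q ∧ expT Y • F.lift z = F'.lift z' := by
  constructor
  · rintro ⟨p, ⟨hz, h1⟩, hz', h2⟩
    exact ⟨hz, hz', (act_mk_cls_eq_iff F.span_range_X).1 (h1.trans h2.symm)⟩
  · rintro ⟨hz, hz', h⟩
    exact ⟨_, ⟨hz, (act_mk_cls_eq_iff F.span_range_X (z := ⟨F.lift z, F.lift_mem hz⟩)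
      (w := ⟨F'.lift z', F'.lift_mem hz'⟩)).2 h⟩, hz', rfl⟩

/-- The part of the domain of a vertex chart that lies over the image of another vertex chart. -/
def overlapSet : Set (Fin m → ℂ) :=
  {z | z ∈ F.dom ∧ ∀ i ∈ {i | F.e i ∉ Set.range F'.e}, z i ≠ 0}

/-- A covering of the overlap of two vertex charts: the points of the first overlap together with an angle
vector that carries them to the slice of the second chart. Translation by `v` in the quasitorus is taken
into account. -/
def transitionSet : Set ((Fin m → ℂ) × (ι → ℝ)) :=
  {p | p.1 ∈ F.overlapSet F' ∧ D.proj p.2 = v ∧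
    (∀ j, j ∉ Set.range F.e → j ∉ Set.range F'.e → p.2 j = 0) ∧
    ∀ j, j ∉ Set.range F'.e → (expT p.2 • F.lift p.1) j = ‖F.lift p.1 j‖}

/-- The lift of the change of charts to the covering. -/
def transition (p : (Fin m → ℂ) × (ι → ℝ)) : Fin m → ℂ := (expT p.2 • F.lift p.1) ∘ F'.e

variable {F F' v}

theorem lift_ne_zero_of_mem_overlapSet {z : Fin m → ℂ} (hz : z ∈ F.overlapSet F') {j : ι}
    (hj : j ∉ Set.range F'.e) : F.lift z j ≠ 0 := by
  by_cases h : j ∈ Set.range F.e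
  · obtain ⟨i, rfl⟩ := h
    rw [lift_apply]
    exact hz.2 i hj
  · exact F.lift_ne_zero hz.1 h

theorem transition_mem_dom {p : (Fin m → ℂ) × (ι → ℝ)} (hp : p ∈ F.transitionSet F' v) :
    F.transition F' p ∈ F'.dom :=
  F'.comp_mem_dom (D.smul_mem_levelSet _ (F.lift_mem hp.1.1)) fun j hj => by
    rw [← norm_ne_zero_iff, norm_torus_smul, norm_ne_zero_iff]
    exact lift_ne_zero_of_mem_overlapSet hp.1 hj

theorem lift_transition {p : (Fin m → ℂ) × (ι → ℝ)} (hp : p ∈ F.transitionSet F' v) :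
    F'.lift (F.transition F' p) = expT p.2 • F.lift p.1 :=
  F'.lift_comp (D.smul_mem_levelSet _ (F.lift_mem hp.1.1)) fun j hj => by
    rw [norm_torus_smul]
    exact hp.2.2.2 j hj

theorem transition_mem_overlapSet {p : (Fin m → ℂ) × (ι → ℝ)} (hp : p ∈ F.transitionSet F' v) :
    F.transition F' p ∈ F'.overlapSet F :=
  ⟨transition_mem_dom hp, fun i hi => by
    rw [← F'.lift_apply (F.transition F' p), lift_transition hp, ← norm_ne_zero_iff, norm_torus_smul,
      norm_ne_zero_iff]
    exact F.lift_ne_zero hp.1.1 hi⟩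

theorem expT_neg_smul_lift_transition {p : (Fin m → ℂ) × (ι → ℝ)} (hp : p ∈ F.transitionSet F' v) :
    expT (-p.2) • F'.lift (F.transition F' p) = F.lift p.1 := by
  rw [lift_transition hp, expT_smul_expT_smul, neg_add_cancel, expT_zero, one_smul]

theorem swap_mem_transitionSet {p : (Fin m → ℂ) × (ι → ℝ)} (hp : p ∈ F.transitionSet F' v) :
    (F.transition F' p, -p.2) ∈ F'.transitionSet F (-v) := by
  refine ⟨transition_mem_overlapSet hp, by rw [map_neg, hp.2.1], fun j h1 h2 => ?_, fun j hj => ?_⟩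
  · change -p.2 j = 0
    rw [hp.2.2.1 j h2 h1, neg_zero]
  · change (expT (-p.2) • F'.lift (F.transition F' p)) j = _
    rw [expT_neg_smul_lift_transition hp, F.lift_eq_norm hj, lift_transition hp, norm_torus_smul]

theorem transition_swap {p : (Fin m → ℂ) × (ι → ℝ)} (hp : p ∈ F.transitionSet F' v) :
    F'.transition F (F.transition F' p, -p.2) = p.1 := by
  change (expT (-p.2) • F'.lift (F.transition F' p)) ∘ F.e = p.1
  rw [expT_neg_smul_lift_transition hp]
  exact funext fun i => F.lift_apply _ i

theorem continuous_transition : Continuous (F.transition F') := by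
  have h : Continuous fun p : (Fin m → ℂ) × (ι → ℝ) => expT p.2 • F.lift p.1 :=
    continuous_expT_smul.comp (continuous_snd.prodMk (F.continuous_lift.comp continuous_fst))
  exact continuous_pi fun i => (continuous_apply (F'.e i)).comp h

theorem swap_mem_transitionSet' {p : (Fin m → ℂ) × (ι → ℝ)} (hp : p ∈ F'.transitionSet F (-v)) :
    (F'.transition F p, -p.2) ∈ F.transitionSet F' v := by
  have := swap_mem_transitionSet hp
  rwa [neg_neg] at this

/-- The covering of the overlap is symmetric in the two charts. -/
def transitionSwap : F.transitionSet F' v ≃ₜ F'.transitionSet F (-v) where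
  toFun p := ⟨(F.transition F' p.1, -p.1.2), swap_mem_transitionSet p.2⟩
  invFun p := ⟨(F'.transition F p.1, -p.1.2), swap_mem_transitionSet' p.2⟩
  left_inv p := Subtype.ext (Prod.ext (transition_swap p.2) (neg_neg _))
  right_inv p := Subtype.ext (Prod.ext (transition_swap p.2) (neg_neg _))
  continuous_toFun := Continuous.subtype_mk ((continuous_transition.comp continuous_subtype_val).prodMk
    (continuous_snd.comp continuous_subtype_val).neg) _
  continuous_invFun := Continuous.subtype_mk ((continuous_transition.comp continuous_subtype_val).prodMk
    (continuous_snd.comp continuous_subtype_val).neg) _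

theorem exists_mem_transitionSet (v : V) {z : Fin m → ℂ} (hz : z ∈ F.overlapSet F') :
    ∃ Y, (z, Y) ∈ F.transitionSet F' v := by
  obtain ⟨R, hR⟩ := F'.exists_isSection
  obtain ⟨Y, h1, h2, h3⟩ := hR.exists_normalizing (F.lift z) v
  exact ⟨Y, hz, h1, fun j hj hj' => h3 j hj' (F.lift_eq_norm hj), h2⟩

theorem overlap_left : (F.chart.push (D.act (QuotientAddGroup.mk v))).overlap F'.chart =
    F.overlapSet F' := by
  ext z
  constructor
  · rintro ⟨p, z', h⟩
    obtain ⟨hz, hz', Y, -, h1⟩ := (F.exists_rep_act_iff F' v).1 ⟨p, h⟩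
    refine ⟨hz, fun i hi => ?_⟩
    rw [← F.lift_apply z, ← norm_ne_zero_iff, ← norm_torus_smul (expT Y), h1, norm_ne_zero_iff]
    exact F'.lift_ne_zero hz' hi
  · intro hz
    obtain ⟨Y, hY⟩ := exists_mem_transitionSet v hz
    obtain ⟨p, hp⟩ := (F.exists_rep_act_iff F' v).2 ⟨hz.1, transition_mem_dom hY, Y,
      by rw [hY.2.1, sub_self]; exact D.Q.zero_mem, (lift_transition hY).symm⟩
    exact ⟨p, _, hp⟩

theorem overlap_right : F'.chart.overlap (F.chart.push (D.act (QuotientAddGroup.mk v))) =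
    F'.overlapSet F := by
  ext z'
  constructor
  · rintro ⟨p, z, h, h'⟩
    obtain ⟨hz, hz', Y, -, h1⟩ := (F.exists_rep_act_iff F' v).1 ⟨p, h', h⟩
    refine ⟨hz', fun i hi => ?_⟩
    rw [← F'.lift_apply z', ← h1, ← norm_ne_zero_iff, norm_torus_smul, norm_ne_zero_iff]
    exact F.lift_ne_zero hz hi
  · intro hz'
    obtain ⟨Y, hY⟩ := exists_mem_transitionSet (-v) hz'
    obtain ⟨p, hp, hp'⟩ := (F.exists_rep_act_iff F' v).2 ⟨transition_mem_dom hY, hz'.1, -Y,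
      by rw [map_neg, hY.2.1, neg_neg, sub_self]; exact D.Q.zero_mem, expT_neg_smul_lift_transition hY⟩
    exact ⟨p, _, hp', hp⟩

/-- The deck transformations of the covering `transitionSet` of the overlap. -/
def deck (F F' : D.VertexFrame m) : AddSubgroup (ι → ℝ) where
  carrier := {Y | D.proj Y = 0 ∧ (∀ j, j ∉ Set.range F.e → j ∉ Set.range F'.e → Y j = 0) ∧
    ∀ j, j ∉ Set.range F'.e → expT Y j = 1}
  zero_mem' := ⟨map_zero _, fun _ _ _ => rfl, fun j _ => by rw [expT_zero]; rfl⟩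
  add_mem' := by
    rintro Y Z ⟨h1, h2, h3⟩ ⟨h1', h2', h3'⟩
    exact ⟨by rw [map_add, h1, h1', add_zero],
      fun j hj hj' => by rw [Pi.add_apply, h2 j hj hj', h2' j hj hj', add_zero],
      fun j hj => by rw [expT_add, Pi.mul_apply, h3 j hj, h3' j hj, mul_one]⟩
  neg_mem' := by
    rintro Y ⟨h1, h2, h3⟩
    exact ⟨by rw [map_neg, h1, neg_zero],
      fun j hj hj' => by rw [Pi.neg_apply, h2 j hj hj', neg_zero],
      fun j hj => by rw [expT_neg, Pi.inv_apply, h3 j hj, inv_one]⟩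

theorem vadd_mem_transitionSet {Y : ι → ℝ} (hY : Y ∈ deck F F') {p : (Fin m → ℂ) × (ι → ℝ)}
    (hp : p ∈ F.transitionSet F' v) : (p.1, Y + p.2) ∈ F.transitionSet F' v := by
  refine ⟨hp.1, by rw [map_add, hY.1, hp.2.1, zero_add], fun j h1 h2 => ?_, fun j hj => ?_⟩
  · change Y j + p.2 j = 0
    rw [hY.2.1 j h1 h2, hp.2.2.1 j h1 h2, add_zero]
  · rw [← hp.2.2.2 j hj, ← expT_smul_expT_smul]
    change (expT Y j : ℂ) * (expT p.2 • F.lift p.1) j = _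
    rw [hY.2.2 j hj, Circle.coe_one, one_mul]

instance : AddAction (deck F F') (F.transitionSet F' v) where
  vadd Y p := ⟨(p.1.1, Y.1 + p.1.2), vadd_mem_transitionSet Y.2 p.2⟩
  zero_vadd _ := Subtype.ext (Prod.ext rfl (zero_add _))
  add_vadd _ _ _ := Subtype.ext (Prod.ext rfl (add_assoc _ _ _))

/-- The covering projection to the overlap. -/
def transitionFst (p : F.transitionSet F' v) : F.overlapSet F' := ⟨p.1.1, p.2.1⟩

/-- Through every point of the covering there is a local section, given by a smooth family of angle
vectors. -/
theorem exists_section_transitionSet {p : (Fin m → ℂ) × (ι → ℝ)} (hp : p ∈ F.transitionSet F' v) :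
    ∃ s : (Fin m → ℂ) → ι → ℝ, ContinuousAt s p.1 ∧ s p.1 = p.2 ∧
      ∀ᶠ z in 𝓝 p.1, z ∈ F.overlapSet F' → (z, s z) ∈ F.transitionSet F' v := by
  obtain ⟨Z, δ, -, -, hδ, hδ0, hker, hgood⟩ :=
    F'.exists_local_section (transition_mem_dom hp) (lift_transition hp).symm
  have hδc : ContinuousAt (fun z => δ (F.lift z)) p.1 :=
    ContinuousAt.comp (g := δ) hδ.continuousAt F.continuous_lift.continuousAt
  have hsmall : ∀ᶠ z in 𝓝 p.1, ∀ j, |δ (F.lift z) j| < 1 := by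
    rw [Filter.eventually_all]
    intro j
    have h1 : ContinuousAt (fun z => |δ (F.lift z) j|) p.1 :=
      ((continuous_apply j).continuousAt.comp hδc).abs
    exact h1.eventually (gt_mem_nhds (by simp [hδ0]))
  refine ⟨fun z => p.2 + δ (F.lift z), continuousAt_const.add hδc, by simp [hδ0], ?_⟩
  filter_upwards [F.continuous_lift.continuousAt.eventually hgood, hsmall] with z h1 h2 hz
  obtain ⟨-, h4⟩ := h1 (F.lift_mem hz.1)
  have h5 : ∀ j, j ∉ Set.range F'.e →
      (expT (p.2 + δ (F.lift z)) • F.lift z) j = ‖F.lift z j‖ := fun j hj => by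
    rw [← norm_torus_smul (expT (p.2 + δ (F.lift z))) (F.lift z), ← h4]
    exact F'.lift_eq_norm hj
  refine ⟨hz, by rw [map_add, hker, add_zero, hp.2.1], fun j hj hj' => ?_, h5⟩
  refine eq_of_expT_smul_eq (Z := 0) (z := F.lift z) (F.lift_ne_zero hz.1 hj) ?_ ?_
  · rw [h5 j hj', expT_zero, one_smul]
    exact (F.lift_eq_norm hj).symm
  · simpa [hp.2.2.1 j hj hj'] using h2 j

theorem isOpenMap_transitionFst : IsOpenMap (transitionFst : F.transitionSet F' v → _) := by
  rw [isOpenMap_iff_nhds_le]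
  intro p U hU
  rw [Filter.mem_map, mem_nhds_subtype] at hU
  obtain ⟨U', hU', hsub⟩ := hU
  obtain ⟨s, hs, hs0, hgood⟩ := exists_section_transitionSet p.2
  have h1 : ContinuousAt (fun z => (z, s z)) p.1.1 := continuousAt_id.prodMk hs
  have h2 : ∀ᶠ z in 𝓝 p.1.1, (z, s z) ∈ U' := h1.eventually (by
    change U' ∈ 𝓝 (p.1.1, s p.1.1)
    rwa [hs0])
  have h3 := (continuous_subtype_val.tendsto (transitionFst p)).eventually (hgood.and h2)
  filter_upwards [h3] with z hz
  exact hsub (a := ⟨(z.1, s z.1), hz.1 z.2⟩) hz.2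

theorem surjective_transitionFst :
    Function.Surjective (transitionFst : F.transitionSet F' v → _) := fun z => by
  obtain ⟨Y, hY⟩ := exists_mem_transitionSet v z.2
  exact ⟨⟨_, hY⟩, rfl⟩

theorem continuous_transitionFst : Continuous (transitionFst : F.transitionSet F' v → _) :=
  Continuous.subtype_mk (continuous_fst.comp continuous_subtype_val) _

theorem sub_mem_deck {z : Fin m → ℂ} {Y Z : ι → ℝ} (hY : (z, Y) ∈ F.transitionSet F' v)
    (hZ : (z, Z) ∈ F.transitionSet F' v) : Y - Z ∈ deck F F' := by
  refine ⟨by rw [map_sub, hY.2.1, hZ.2.1, sub_self], fun j h1 h2 => ?_, fun j hj => ?_⟩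
  · have hY0 : Y j = 0 := hY.2.2.1 j h1 h2
    have hZ0 : Z j = 0 := hZ.2.2.1 j h1 h2
    rw [Pi.sub_apply, hY0, hZ0, sub_zero]
  · have h1 : (expT Y j : ℂ) * F.lift z j = (expT Z j : ℂ) * F.lift z j :=
      (hY.2.2.2 j hj).trans (hZ.2.2.2 j hj).symm
    have h2 : expT Y j = expT Z j :=
      Circle.ext (mul_right_cancel₀ (lift_ne_zero_of_mem_overlapSet hY.1 hj) h1)
    rw [sub_eq_add_neg, expT_add, expT_neg, Pi.mul_apply, Pi.inv_apply, h2, mul_inv_cancel]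

/-- The group `deck` is discrete in the angle vectors, being determined by integers, and its orbits are the
fibres. -/
theorem isCoveringMap_transitionFst : IsCoveringMap (transitionFst : F.transitionSet F' v → _) := by
  have h : IsAddQuotientCoveringMap (transitionFst : F.transitionSet F' v → _) (deck F F') :=
    { toIsQuotientMap := isOpenMap_transitionFst.isQuotientMap continuous_transitionFst
        surjective_transitionFst
      toContinuousConstVAdd := ⟨fun Y => Continuous.subtype_mk
        ((continuous_fst.comp continuous_subtype_val).prodMk
          (continuous_const.add (continuous_snd.comp continuous_subtype_val))) _⟩
      apply_eq_iff_mem_orbit := by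
        rintro ⟨⟨z, Y⟩, hY⟩ ⟨⟨w, Z⟩, hZ⟩
        constructor
        · intro h
          obtain rfl : z = w := congrArg Subtype.val h
          exact ⟨⟨Y - Z, sub_mem_deck hY hZ⟩, Subtype.ext (Prod.ext rfl (sub_add_cancel Y Z))⟩
        · rintro ⟨T, hT⟩
          exact Subtype.ext (congrArg (fun p => p.1.1) hT).symm
      disjoint := by
        intro p
        refine ⟨{q | ∀ j, |q.1.2 j - p.1.2 j| < 1 / 2}, ?_, ?_⟩
        · have h1 : ∀ᶠ q : F.transitionSet F' v in 𝓝 p, ∀ j, |q.1.2 j - p.1.2 j| < 1 / 2 := by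
            rw [Filter.eventually_all]
            intro j
            have h2 : Continuous fun q : F.transitionSet F' v => |q.1.2 j - p.1.2 j| :=
              (((continuous_apply j).comp (continuous_snd.comp continuous_subtype_val)).sub
                continuous_const).abs
            exact h2.continuousAt.eventually (gt_mem_nhds (by norm_num))
          exact h1
        · rintro ⟨T, hT⟩ ⟨_, ⟨q, hq, rfl⟩, hq'⟩
          refine Subtype.ext (F'.eq_of_proj_eq (fun j hj => ?_) (hT.1.trans (map_zero _).symm))
          obtain ⟨k, hk⟩ := expT_apply_eq_one_iff.1 (hT.2.2 j hj)
          have h1 := hq j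
          have h2 : |T j + q.1.2 j - p.1.2 j| < 1 / 2 := hq' j
          rw [abs_lt] at h1 h2
          have h3 : |(k : ℝ)| < 1 := by
            rw [← hk, abs_lt]
            constructor <;> linarith [h1.1, h1.2, h2.1, h2.2]
          rw [← Int.cast_abs, ← Int.cast_one, Int.cast_lt, Int.abs_lt_one_iff] at h3
          change T j = 0
          rw [hk, h3, Int.cast_zero] }
  exact h.isCoveringMap

/-- In polar coordinates the covering is parametrized by a convex set of squared moduli and by arbitrary angles
`φ`; the angle vector is the one in the fibre of `π` over `v` that rotates back by `φ` at the facets of the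
first vertex that are not facets of the second. -/
theorem isConnected_transitionSet (hne : (F.overlapSet F').Nonempty) :
    IsConnected (F.transitionSet F' v) := by
  obtain ⟨R, hR⟩ := F'.exists_isSection
  let B : Set (Fin m) := {i | F.e i ∉ Set.range F'.e}
  let C := F.sqNormSet B fun _ => True
  let y : (Fin m → ℝ) → ι → ℝ := fun φ => Function.extend F.e (-φ) 0
  let Ψ : (Fin m → ℝ) × (Fin m → ℝ) → (Fin m → ℂ) × (ι → ℝ) := fun p =>
    (expT p.2 • fun i => ((Real.sqrt (p.1 i) : ℝ) : ℂ), D.toKer R (y p.2) + R v)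
  have hy1 : ∀ φ i, y φ (F.e i) = -φ i := fun φ i => F.e.injective.extend_apply _ _ _
  have hy0 : ∀ φ j, j ∉ Set.range F.e → y φ j = 0 := fun φ j hj =>
    Function.extend_apply' _ _ _ fun h => hj h
  have hYv : ∀ φ j, j ∉ Set.range F'.e → (D.toKer R (y φ) + R v) j = y φ j := fun φ j hj => by
    rw [Pi.add_apply, hR.toKer_apply_of_notMem _ hj, hR.apply_eq_zero _ _ hj, add_zero]
  have hYp : ∀ φ, D.proj (D.toKer R (y φ) + R v) = v := fun φ => by
    rw [map_add, hR.proj_toKer, hR.proj_apply, zero_add]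
  have hΨ : Continuous Ψ := by
    refine Continuous.prodMk (continuous_expT_smul.comp (continuous_snd.prodMk (continuous_pi fun h =>
      Complex.continuous_ofReal.comp (Real.continuous_sqrt.comp (by fun_prop))))) ?_
    refine ((D.toKer R).continuous.comp ?_).add continuous_const
    refine continuous_pi fun j => ?_
    by_cases hj : j ∈ Set.range F.e
    · obtain ⟨i, rfl⟩ := hj
      simp only [hy1]
      fun_prop
    · simp only [hy0 _ j hj]
      exact continuous_const
  have himage : F.transitionSet F' v = Ψ '' (C ×ˢ Set.univ) := by
    ext ⟨z, Y⟩
    constructor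
    · intro hp
      classical
      let φ : Fin m → ℝ := fun i =>
        if F.e i ∈ Set.range F'.e then Complex.arg (z i) / (2 * Real.pi) else -Y (F.e i)
      refine ⟨(fun i => ‖z i‖ ^ 2, φ), ⟨F.norm_sq_mem_sqNormSet.2 ⟨hp.1.1, hp.1.2, trivial⟩, trivial⟩,
        Prod.ext (funext fun i => ?_) ?_⟩
      · have h1 : (expT (-φ) • z) i = ‖z i‖ := by
          by_cases hi : F.e i ∈ Set.range F'.e
          · rw [← expT_neg_arg_smul z i, expT_smul_apply, expT_smul_apply, Pi.neg_apply]
            simp only [φ, if_pos hi]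
          · have h2 := hp.2.2.2 _ hi
            change (expT Y • F.lift z) (F.e i) = ‖F.lift z (F.e i)‖ at h2
            rw [expT_smul_apply, F.lift_apply] at h2
            rw [expT_smul_apply, ← h2, Pi.neg_apply]
            simp only [φ, if_neg hi, neg_neg]
        change (expT φ • fun i => ((Real.sqrt (‖z i‖ ^ 2) : ℝ) : ℂ)) i = z i
        have h3 : ((Real.sqrt (‖z i‖ ^ 2) : ℝ) : ℂ) = (expT (-φ) • z) i := by
          rw [h1, Real.sqrt_sq (norm_nonneg _)]
        calc _ = (expT φ • expT (-φ) • z) i := by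
              rw [expT_smul_apply, expT_smul_apply, h3]
          _ = z i := by rw [expT_smul_expT_smul, add_neg_cancel, expT_zero, one_smul]
      · refine F'.eq_of_proj_eq (fun j hj => ?_) ((hYp φ).trans hp.2.1.symm)
        refine (hYv φ j hj).trans ?_
        by_cases hj' : j ∈ Set.range F.e
        · obtain ⟨i, rfl⟩ := hj'
          rw [hy1]
          simp only [φ, if_neg hj, neg_neg]
        · rw [hy0 _ _ hj']
          exact (hp.2.2.1 j hj' hj).symm
    · rintro ⟨⟨c, φ⟩, ⟨hc, -⟩, h⟩
      rw [← h]
      have hnorm : ∀ i, ‖(expT φ • fun i => ((Real.sqrt (c i) : ℝ) : ℂ)) i‖ = Real.sqrt (c i) :=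
        fun i => by
          rw [norm_torus_smul, Complex.norm_real, Real.norm_of_nonneg (Real.sqrt_nonneg _)]
      have hsq : (fun i => ‖(expT φ • fun i => ((Real.sqrt (c i) : ℝ) : ℂ)) i‖ ^ 2) = c :=
        funext fun i => by rw [hnorm, Real.sq_sqrt (hc.1 i)]
      obtain ⟨h1, h2, -⟩ := F.norm_sq_mem_sqNormSet.1 (hsq.symm ▸ hc :
        (fun i => ‖(expT φ • fun i => ((Real.sqrt (c i) : ℝ) : ℂ)) i‖ ^ 2) ∈ C)
      refine ⟨⟨h1, h2⟩, hYp φ, fun j hj hj' => (hYv φ j hj').trans (hy0 φ j hj), fun j hj => ?_⟩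
      change (expT (D.toKer R (y φ) + R v) • F.lift (expT φ • fun i => ((Real.sqrt (c i) : ℝ) : ℂ))) j =
        ‖F.lift (expT φ • fun i => ((Real.sqrt (c i) : ℝ) : ℂ)) j‖
      by_cases hj' : j ∈ Set.range F.e
      · obtain ⟨i, rfl⟩ := hj'
        rw [expT_smul_apply, hYv φ _ hj, hy1, F.lift_apply, hnorm, expT_smul_apply, ← mul_assoc,
          ← Complex.exp_add]
        simp
      · rw [expT_smul_apply, hYv φ _ hj, hy0 φ _ hj', ← F.lift_eq_norm hj']
        simp
  obtain ⟨z, hz⟩ := hne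
  rw [himage]
  exact (((F.convex_sqNormSet B fun _ _ _ h => h).prod convex_univ).isConnected
    (Set.Nonempty.prod ⟨_, F.norm_sq_mem_sqNormSet.2 ⟨hz.1, hz.2, trivial⟩⟩
      Set.univ_nonempty)).image _ hΨ.continuousOn

/-- The change of charts is given locally by symplectic maps. -/
theorem exists_transition_germ (w : F.transitionSet F' v) :
    ∃ h : (Fin m → ℂ) → (Fin m → ℂ), ContDiffAt ℝ ∞ h w.1.1 ∧
      (∀ᶠ w' : F.transitionSet F' v in 𝓝 w, h w'.1.1 = F.transition F' w'.1) ∧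
      ∀ᶠ x in 𝓝 w.1.1, pullbackForm h F'.chart.form x = F.chart.form x := by
  have hdom : w.1.1 ∈ F.dom := w.2.1.1
  have hmem : ∀ᶠ u in 𝓝 w.1.1, u ∈ F.dom := F.isOpen_dom.mem_nhds hdom
  obtain ⟨h, δ, hh, hh0, hδ, hδ0, hgood⟩ := F'.exists_local_lift (F.contDiffAt_lift hdom)
    (hmem.mono fun u hu => F.lift_mem hu) (transition_mem_dom w.2) (lift_transition w.2).symm
  have hfst : Filter.Tendsto (fun w' : F.transitionSet F' v => w'.1.1) (𝓝 w) (𝓝 w.1.1) :=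
    (continuous_fst.comp continuous_subtype_val).tendsto w
  refine ⟨h, hh, ?_, ?_⟩
  · have hsmall : ∀ᶠ w' : F.transitionSet F' v in 𝓝 w, ∀ j,
        |w'.1.2 j - (w.1.2 + δ w'.1.1) j| < 1 := by
      rw [Filter.eventually_all]
      intro j
      have h1 : ContinuousAt (fun w' : F.transitionSet F' v => δ w'.1.1) w :=
        ContinuousAt.comp (g := δ) hδ.continuousAt hfst
      have h2 : ContinuousAt (fun w' : F.transitionSet F' v => δ w'.1.1 j) w :=
        ContinuousAt.comp (g := fun y : ι → ℝ => y j) (continuous_apply j).continuousAt h1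
      have h3 : ContinuousAt (fun w' : F.transitionSet F' v => w'.1.2 j) w :=
        ((continuous_apply j).comp (continuous_snd.comp continuous_subtype_val)).continuousAt
      have h4 : ContinuousAt (fun w' : F.transitionSet F' v =>
          |w'.1.2 j - (w.1.2 j + δ w'.1.1 j)|) w := (h3.sub (continuousAt_const.add h2)).abs
      exact h4.eventually (gt_mem_nhds (by simp [hδ0]))
    filter_upwards [hsmall, hfst.eventually hgood] with w' h1 h2
    obtain ⟨-, h3, h4, -⟩ := h2
    have h5 : w'.1.2 = w.1.2 + δ w'.1.1 := by
      refine F'.eq_of_proj_eq (fun j hj => ?_) (by rw [map_add, h3, add_zero, w'.2.2.1, w.2.2.1])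
      refine eq_of_expT_smul_eq (z := F.lift w'.1.1) (lift_ne_zero_of_mem_overlapSet w'.2.1 hj) ?_ (h1 j)
      rw [w'.2.2.2.2 j hj, ← h4, F'.lift_eq_norm hj, h4, norm_torus_smul]
    funext i
    rw [← F'.lift_apply (h w'.1.1), h4, ← h5]
    rfl
  · filter_upwards [hgood, hmem] with x h1 h2
    ext u
    change pullbackForm h (fun _ => stdForm m) x u = stdForm m u
    rw [pullbackForm_stdForm, h1.2.2.2, F.coordForm_fderiv_lift (f := fun u => u) differentiableAt_fun_id h2]
    simp only [fderiv_fun_id]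
    rfl

end VertexFrame

/-- Elements of the quasitorus carry vertex charts to compatible charts; for the neutral element this is the
compatibility of the vertex charts. The covering that carries the lift is
`transitionSet`; `ι` lies in `Type` because compatibility asks for a covering space in `Type`. -/
theorem VertexFrame.compatible_act {ι : Type} {V : Type*} [Fintype ι] [AddCommGroup V] [Module ℝ V]
    {D : ToricData ι V} {m : ℕ} (F F' : D.VertexFrame m) (q : V ⧸ D.Q) :
    (F.chart.push (D.act q)).Compatible F'.chart := by
  induction q using QuotientAddGroup.induction_on with
  | H v =>
  have key : ∀ S S' : Set (Fin m → ℂ), S = F.overlapSet F' → S' = F'.overlapSet F → S.Nonempty →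
      IsConnected (F.chart.freeSet ∩ S) ∧ IsConnected (F'.chart.freeSet ∩ S') ∧
      ∃ (W : Type) (_ : TopologicalSpace W) (α : W → S) (β : W → S'),
        ConnectedSpace W ∧ IsCoveringMap α ∧ Function.Surjective α ∧
        IsCoveringMap β ∧ Function.Surjective β ∧
        (∀ w, ∃ p, (F.chart.push (D.act (QuotientAddGroup.mk v))).Rep (α w) p ∧ F'.chart.Rep (β w) p) ∧
        ∀ w, ∃ (h : (Fin m → ℂ) → (Fin m → ℂ)) (h' : (Fin m → ℂ) → (Fin m → ℂ)),
          ContDiffAt ℝ ∞ h (α w) ∧ ContDiffAt ℝ ∞ h' (β w) ∧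
          (∀ᶠ w' in 𝓝 w, h (α w') = β w' ∧ h' (β w') = α w') ∧
          ∀ᶠ x in 𝓝 (α w : Fin m → ℂ), pullbackForm h F'.chart.form x = F.chart.form x := by
    rintro _ _ rfl rfl hne
    have hne' : (F'.overlapSet F).Nonempty := by
      obtain ⟨z, hz⟩ := hne
      obtain ⟨Y, hY⟩ := exists_mem_transitionSet v hz
      exact ⟨_, transition_mem_overlapSet hY⟩
    refine ⟨F.isConnected_freeSet_inter hne, F'.isConnected_freeSet_inter hne', F.transitionSet F' v,
      inferInstance, transitionFst, transitionFst ∘ transitionSwap,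
      isConnected_iff_connectedSpace.1 (isConnected_transitionSet hne), isCoveringMap_transitionFst,
      surjective_transitionFst, isCoveringMap_transitionFst.comp_homeomorph _,
      surjective_transitionFst.comp transitionSwap.surjective, fun w => ?_, fun w => ?_⟩
    · exact (F.exists_rep_act_iff F' v).2 ⟨w.2.1.1, transition_mem_dom w.2, w.1.2,
        by rw [w.2.2.1, sub_self]; exact D.Q.zero_mem, (lift_transition w.2).symm⟩
    · obtain ⟨h, h1, h2, h3⟩ := exists_transition_germ w
      obtain ⟨h', h1', h2', -⟩ := exists_transition_germ (transitionSwap w)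
      refine ⟨h, h', h1, h1', ?_, h3⟩
      filter_upwards [h2, transitionSwap.continuous.continuousAt.eventually h2'] with w' h4 h5
      exact ⟨h4, h5.trans (transition_swap w'.2)⟩
  exact key _ _ VertexFrame.overlap_left VertexFrame.overlap_right

/-- The toric quasifold of a regular triple. -/
theorem IsRegular.isSymplecticQuasifold {ι : Type} {V : Type*} [Fintype ι] [AddCommGroup V] [Module ℝ V]
    [FiniteDimensional ℝ V] {D : ToricData ι V} (hD : D.IsRegular) {m : ℕ}
    (hm : m = Module.finrank ℝ V) : IsSymplecticQuasifold (D.atlas m) where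
  chart := by
    rintro _ ⟨F, rfl⟩
    exact F.isSymplectic_chart hD.countable hD.mem_Q
  cover p := by
    induction p using Quotient.inductionOn with
    | h z =>
    obtain ⟨μ, hμ⟩ := D.exists_moment z
    obtain ⟨F, hF⟩ := hD.exists_frame hm (μ := μ) fun j => by
      rw [hμ]
      have := sq_nonneg ‖z.1 j‖
      linarith
    have h0 : ∀ j, j ∉ Set.range F.e → z.1 j ≠ 0 := fun j hj h => hj (hF (by
      change μ (D.X j) = D.lam j
      rw [hμ, h]
      simp))
    obtain ⟨R, hR⟩ := F.exists_isSection
    obtain ⟨Y, hY, hpos, -⟩ := hR.exists_normalizing z.1 0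
    have hmem := D.smul_mem_levelSet (expT Y) z.2
    have hdom : (expT Y • z.1) ∘ F.e ∈ F.dom := F.comp_mem_dom hmem fun j hj => by
      rw [← norm_ne_zero_iff, norm_torus_smul, norm_ne_zero_iff]
      exact h0 j hj
    have hlift : F.lift ((expT Y • z.1) ∘ F.e) = expT Y • z.1 := F.lift_comp hmem fun j hj => by
      rw [norm_torus_smul]
      exact hpos j hj
    exact ⟨F.chart, ⟨F, rfl⟩, _, hdom, (cls_eq_cls_iff.2
      ⟨Y, by rw [hY]; exact D.Q.zero_mem, hlift.symm⟩).symm⟩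
  compatible := by
    rintro _ ⟨F, rfl⟩ _ ⟨F', rfl⟩
    have h1 : F.chart.push (D.act 0) = F.chart := by
      have : (D.act 0 : D.Space → D.Space) = id := funext act_zero
      rw [this]
      rfl
    have h2 := F.compatible_act F' 0
    rwa [h1] at h2

/-- The action of the quasitorus is smooth, also as an action of a vector space that maps to it. -/
theorem isSmoothAction_act {m : ℕ} {W : Type*} [NormedAddCommGroup W] [NormedSpace ℝ W]
    [FiniteDimensional ℝ W] (L : W →ₗ[ℝ] V) :
    IsSmoothAction (D.atlas m) fun w x => D.act (QuotientAddGroup.mk (L w)) x := by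
  rintro _ ⟨F, rfl⟩ _ ⟨F', rfl⟩ w₀ x y p ⟨hx, rfl⟩ hy
  obtain ⟨-, hy', Y₀, hY₀, hxy⟩ := (F.exists_rep_act_iff F' (L w₀)).1 ⟨_, ⟨hx, rfl⟩, hy⟩
  obtain ⟨R, hR⟩ := F.exists_isSection
  let c : W → ι → ℝ := fun w => R (L (w - w₀))
  have hc : ContDiff ℝ ∞ c :=
    (LinearMap.toContinuousLinearMap (R ∘ₗ L)).contDiff.comp (contDiff_id.sub contDiff_const)
  have hc0 : c w₀ = 0 := by simp [c]
  let ζ : W × (Fin m → ℂ) → ι → ℂ := fun u => expT (c u.1) • F.lift u.2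
  have hc' : ContDiffAt ℝ ∞ (fun u : W × (Fin m → ℂ) => c u.1) (w₀, x) :=
    (hc.comp contDiff_fst).contDiffAt
  have hl : ContDiffAt ℝ ∞ (fun u : W × (Fin m → ℂ) => F.lift u.2) (w₀, x) :=
    ContDiffAt.comp (g := F.lift) (w₀, x) (F.contDiffAt_lift hx) contDiffAt_snd
  have hζ : ContDiffAt ℝ ∞ ζ (w₀, x) := contDiffAt_expT_smul hc' hl
  have hdom : ∀ᶠ u : W × (Fin m → ℂ) in 𝓝 (w₀, x), u.2 ∈ F.dom :=
    (continuous_snd.tendsto (w₀, x)).eventually (F.isOpen_dom.mem_nhds hx)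
  have hY₁ : expT Y₀ • ζ (w₀, x) = F'.lift y := by
    simp only [ζ, hc0, expT_zero, one_smul, hxy]
  obtain ⟨h, δ, hh, hh0, -, -, hgood⟩ := F'.exists_local_lift hζ
    (hdom.mono fun u hu => D.smul_mem_levelSet _ (F.lift_mem hu)) hy' hY₁
  refine ⟨h, hh, hh0, ?_⟩
  filter_upwards [hgood, hdom] with u hu hu'
  obtain ⟨h1, h2, h3, -⟩ := hu
  obtain ⟨p, ⟨hp, rfl⟩, hp'⟩ := (F.exists_rep_act_iff F' (L u.1)).2 ⟨hu', h1, Y₀ + δ u + c u.1, by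
    rw [map_add, map_add, h2, add_zero, hR.proj_apply, map_sub, add_sub, sub_sub, add_comm (L w₀),
      ← sub_sub, add_sub_cancel_right]
    exact hY₀, by rw [h3, expT_smul_expT_smul]⟩
  exact ⟨_, ⟨hp, rfl⟩, hp'⟩

end Transition

/-! ### The level set over the slice of the polyhedron -/

section Slice

variable {ι V : Type*} [Fintype ι] [AddCommGroup V] [Module ℝ V] {D : ToricData ι V}
  {𝔨 : Submodule ℝ V}

theorem mem_levelSet_of_moment {z : ι → ℂ} (μ : Module.Dual ℝ V)
    (h : ∀ j, ‖z j‖ ^ 2 + D.lam j = μ (D.X j)) : z ∈ D.levelSet := by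
  intro Y hY
  have h1 : μ (D.proj Y) = ∑ j, (‖z j‖ ^ 2 + D.lam j) * Y j := by
    rw [proj_apply, map_sum]
    refine Finset.sum_congr rfl fun j _ => ?_
    rw [map_smul, smul_eq_mul, h, mul_comm]
  rw [← h1, hY, map_zero]

theorem exists_mem_levelSet {μ : Module.Dual ℝ V} (hμ : μ ∈ D.polyhedron) :
    ∃ z : D.levelSet, ∀ j, ‖z.1 j‖ ^ 2 + D.lam j = μ (D.X j) := by
  have h : ∀ j, ‖((Real.sqrt (μ (D.X j) - D.lam j) : ℝ) : ℂ)‖ ^ 2 + D.lam j = μ (D.X j) := fun j => by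
    rw [Complex.norm_real, Real.norm_of_nonneg (Real.sqrt_nonneg _),
      Real.sq_sqrt (sub_nonneg.2 (hμ j)), sub_add_cancel]
  exact ⟨⟨_, mem_levelSet_of_moment μ h⟩, h⟩

theorem slice_proj (Y : ι → ℝ) : (D.slice 𝔨).proj Y = 𝔨.mkQ (D.proj Y) := by
  rw [proj_apply, proj_apply, map_sum]
  rfl

theorem moment_proj (z : D.levelSet) (Y : ι → ℝ) :
    D.moment (D.cls z) (D.proj Y) = ∑ j, (‖z.1 j‖ ^ 2 + D.lam j) * Y j := by
  rw [proj_apply, map_sum]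
  refine Finset.sum_congr rfl fun j _ => ?_
  rw [map_smul, smul_eq_mul, moment_cls, mul_comm]

theorem slice_levelSet_subset : (D.slice 𝔨).levelSet ⊆ D.levelSet := fun z hz Y hY =>
  hz Y (by rw [slice_proj, hY, map_zero])

/-- The part of the level set `Ψ⁻¹(0)` over `Φ_𝔨⁻¹(0)` is the level set of the sliced triple. -/
theorem cls_mem_zeroLevel_iff (hspan : Submodule.span ℝ (Set.range D.X) = ⊤) {z : D.levelSet} :
    D.cls z ∈ D.zeroLevel 𝔨 ↔ z.1 ∈ (D.slice 𝔨).levelSet := by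
  constructor
  · intro h Y hY
    rw [slice_proj, Submodule.mkQ_apply, Submodule.Quotient.mk_eq_zero] at hY
    refine (moment_proj z Y).symm.trans ?_
    exact LinearMap.congr_fun (show D.momentK 𝔨 (D.cls z) = 0 from h) ⟨_, hY⟩
  · intro h
    refine LinearMap.ext fun v => ?_
    obtain ⟨Y, hY⟩ := proj_surjective hspan v.1
    change D.moment (D.cls z) v.1 = 0
    rw [← hY, moment_proj]
    refine h Y ?_
    rw [slice_proj, hY, Submodule.mkQ_apply, Submodule.Quotient.mk_eq_zero]
    exact v.2

theorem exists_supported_of_mem_span {A : Set ι} {y : V} (hy : y ∈ Submodule.span ℝ (D.X '' A)) :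
    ∃ Y : ι → ℝ, (∀ j ∉ A, Y j = 0) ∧ D.proj Y = y := by
  classical
  induction hy using Submodule.span_induction with
  | mem x hx =>
    obtain ⟨j, hj, rfl⟩ := hx
    refine ⟨Pi.single j 1, fun i hi => ?_, proj_single _ j⟩
    have : i ≠ j := fun h => hi (h ▸ hj)
    simp [this]
  | zero => exact ⟨0, fun _ _ => rfl, map_zero _⟩
  | add x y _ _ hx hy =>
    obtain ⟨Y, h1, rfl⟩ := hx
    obtain ⟨Z, h2, rfl⟩ := hy
    exact ⟨Y + Z, fun j hj => by rw [Pi.add_apply, h1 j hj, h2 j hj, add_zero], map_add _ _ _⟩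
  | smul a x _ hx =>
    obtain ⟨Y, h1, rfl⟩ := hx
    exact ⟨a • Y, fun j hj => by rw [Pi.smul_apply, h1 j hj, smul_zero], map_smul _ _ _⟩

/-- The isotropy Lie algebra at a point over `μ` contains the span of the active normal vectors, so that
0-dimensional isotropy makes `𝔨` transverse to the face of `μ`. -/
theorem disjoint_span_active (hspan : Submodule.span ℝ (Set.range D.X) = ⊤)
    (hiso : D.ZeroDimIsotropy 𝔨) {ν : Module.Dual ℝ (V ⧸ 𝔨)} (hν : ν ∈ (D.slice 𝔨).polyhedron) :
    Disjoint (Submodule.span ℝ (D.X '' (D.slice 𝔨).active ν)) 𝔨 := by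
  rw [Submodule.disjoint_def]
  intro y hy hyk
  obtain ⟨Y, h0, rfl⟩ := exists_supported_of_mem_span hy
  obtain ⟨z, hz⟩ := exists_mem_levelSet hν
  refine hiso (D.cls ⟨z.1, slice_levelSet_subset z.2⟩) ((cls_mem_zeroLevel_iff hspan).2 z.2) _ hyk
    fun t => ?_
  rw [← map_smul, D.act_cls]
  refine congrArg D.cls (Subtype.ext (funext fun j => ?_))
  change (expT (t • Y) • z.1) j = z.1 j
  rw [expT_smul_apply]
  by_cases hj : j ∈ (D.slice 𝔨).active ν
  · have h1 : ν ((D.slice 𝔨).X j) = (D.slice 𝔨).lam j := hj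
    have h2 := hz j
    rw [h1, add_eq_right, sq_eq_zero_iff, norm_eq_zero] at h2
    rw [h2, mul_zero]
  · rw [Pi.smul_apply, h0 j hj]
    simp

/-- A point with trivial isotropy algebra in `𝔨` keeps its active normal vectors linearly independent modulo `𝔨`. -/
theorem IsRegular.slice (hD : D.IsRegular) (hiso : D.ZeroDimIsotropy 𝔨) : (D.slice 𝔨).IsRegular where
  countable := hD.countable.image _
  mem_Q j := ⟨D.X j, hD.mem_Q j, rfl⟩
  span := by
    have h : Set.range (D.slice 𝔨).X = 𝔨.mkQ '' Set.range D.X := by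
      rw [← Set.range_comp]
      rfl
    rw [h, ← Submodule.map_span, hD.span, Submodule.map_top, Submodule.range_mkQ]
  linearIndependent ν hν := by
    have h1 : 𝔨.mkQ.dualMap ν ∈ D.polyhedron := hν
    have h2 : LinearIndependent ℝ fun j : (D.slice 𝔨).active ν => D.X j :=
      hD.linearIndependent _ h1
    refine h2.map (f := 𝔨.mkQ) ?_
    rw [Submodule.ker_mkQ, ← Set.image_eq_range]
    exact disjoint_span_active hD.span hiso hν

theorem nonempty_slice_polyhedron (hspan : Submodule.span ℝ (Set.range D.X) = ⊤)
    (hne : (D.zeroLevel 𝔨).Nonempty) : (D.slice 𝔨).polyhedron.Nonempty := by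
  obtain ⟨x, hx⟩ := hne
  induction x using Quotient.inductionOn with
  | h z =>
    obtain ⟨ν, hν⟩ := (D.slice 𝔨).exists_moment ⟨z.1, (cls_mem_zeroLevel_iff hspan).1 hx⟩
    refine ⟨ν, fun j => ?_⟩
    rw [hν]
    have := sq_nonneg ‖z.1 j‖
    linarith

/-- In a regular slice a half-space cuts out a facet as soon as its face is nonempty. -/
theorem IsRegular.mem_sliceFacets_iff [FiniteDimensional ℝ V] (hS : (D.slice 𝔨).IsRegular) (j : ι) :
    j ∈ D.sliceFacets 𝔨 ↔ ((D.slice 𝔨).face j).Nonempty := by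
  classical
  rw [sliceFacets, Finset.mem_filter]
  exact ⟨fun h => h.2.1, fun h => ⟨Finset.mem_univ j, hS.isFacet h⟩⟩

theorem IsQuasilattice.map {W : Type*} [AddCommGroup W] [Module ℝ W] {Q : AddSubgroup V}
    (h : IsQuasilattice Q) {f : V →ₗ[ℝ] W} (hf : Function.Surjective f) :
    IsQuasilattice (Q.map f.toAddMonoidHom) := by
  classical
  obtain ⟨S, rfl, hS⟩ := h
  refine ⟨S.image f, ?_, ?_⟩
  · rw [AddMonoidHom.map_closure, Finset.coe_image]
    rfl
  · rw [Finset.coe_image, ← Submodule.map_span, hS, Submodule.map_top, LinearMap.range_eq_top.2 hf]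

/-! ### The orbit space of the zero level as a quotient of the level set over the slice -/

theorem toReduced_eq_iff {x y : D.zeroLevel 𝔨} (hspan : Submodule.span ℝ (Set.range D.X) = ⊤) :
    D.toReduced 𝔨 x = D.toReduced 𝔨 y ↔ ∃ κ ∈ D.subgroupK 𝔨, D.actZero 𝔨 κ x = y := by
  refine Equivalence.quot_mk_eq_iff ⟨fun x => ⟨0, zero_mem _, Subtype.ext (act_zero x.1)⟩, ?_, ?_⟩ x y
  · rintro x _ ⟨κ, hκ, rfl⟩
    refine ⟨-κ, neg_mem hκ, Subtype.ext ?_⟩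
    change D.act (-κ) (D.act κ x.1) = x.1
    rw [← act_add hspan, neg_add_cancel, act_zero]
  · rintro x _ _ ⟨κ, hκ, rfl⟩ ⟨κ', hκ', rfl⟩
    exact ⟨κ' + κ, add_mem hκ' hκ, Subtype.ext (act_add hspan κ' κ x.1)⟩

/-- The point of `Φ_𝔨⁻¹(0)` represented by a point of the level set over the slice. -/
def sliceToZero (hspan : Submodule.span ℝ (Set.range D.X) = ⊤) (z : (D.slice 𝔨).levelSet) :
    D.zeroLevel 𝔨 :=
  ⟨D.cls ⟨z.1, slice_levelSet_subset z.2⟩, (cls_mem_zeroLevel_iff hspan).2 z.2⟩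

theorem isQuotientMap_sliceToZero (hspan : Submodule.span ℝ (Set.range D.X) = ⊤) :
    Topology.IsQuotientMap (sliceToZero (𝔨 := 𝔨) hspan) := by
  have h1 : IsOpenQuotientMap D.cls :=
    ⟨Quotient.mk_surjective, continuous_cls, isOpenMap_cls⟩
  have h2 := (h1.restrictPreimage (D.zeroLevel 𝔨)).isQuotientMap
  let e : (D.slice 𝔨).levelSet ≃ₜ D.cls ⁻¹' D.zeroLevel 𝔨 :=
    { toFun := fun z => ⟨⟨z.1, slice_levelSet_subset z.2⟩, (cls_mem_zeroLevel_iff hspan).2 z.2⟩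
      invFun := fun z => ⟨z.1.1, (cls_mem_zeroLevel_iff hspan).1 z.2⟩
      left_inv := fun _ => rfl
      right_inv := fun _ => rfl
      continuous_toFun := (continuous_subtype_val.subtype_mk _).subtype_mk _
      continuous_invFun := (continuous_subtype_val.comp continuous_subtype_val).subtype_mk _ }
  exact h2.comp e.isQuotientMap

/-- Reducing in stages: an orbit of `K` on the orbit space of `N` is an orbit of the group of the sliced triple,
because `p(π(Y)) ∈ p(Q)` if and only if `π(Y) ∈ Q + 𝔨`. -/
theorem toReduced_sliceToZero_eq_iff (hspan : Submodule.span ℝ (Set.range D.X) = ⊤)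
    {z w : (D.slice 𝔨).levelSet} :
    D.toReduced 𝔨 (sliceToZero hspan z) = D.toReduced 𝔨 (sliceToZero hspan w) ↔
      (D.slice 𝔨).cls z = (D.slice 𝔨).cls w := by
  rw [toReduced_eq_iff hspan, cls_eq_cls_iff]
  constructor
  · rintro ⟨_, ⟨k, hk, rfl⟩, h⟩
    obtain ⟨Y, hY, h1⟩ := (act_mk_cls_eq_iff hspan (w := ⟨w.1, slice_levelSet_subset w.2⟩)).1
      (congrArg Subtype.val h)
    refine ⟨Y, ⟨_, hY, ?_⟩, h1⟩
    change 𝔨.mkQ (D.proj Y - k) = _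
    have hk0 : 𝔨.mkQ k = 0 := (Submodule.Quotient.mk_eq_zero 𝔨).2 hk
    rw [slice_proj, map_sub, hk0, sub_zero]
  · rintro ⟨Y, ⟨q, hq, hqY⟩, h1⟩
    have hk : D.proj Y - q ∈ 𝔨 := by
      rw [← Submodule.Quotient.mk_eq_zero, Submodule.Quotient.mk_sub, sub_eq_zero]
      exact ((slice_proj Y).symm.trans hqY.symm)
    refine ⟨QuotientAddGroup.mk (D.proj Y - q), ⟨_, hk, rfl⟩, Subtype.ext ?_⟩
    exact (act_mk_cls_eq_iff hspan (z := ⟨z.1, slice_levelSet_subset z.2⟩)).2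
      ⟨Y, by rwa [sub_sub_cancel], h1⟩

/-- The reduced space is the orbit space of the level set over the slice by the group
`exp {Y | p(π(Y)) ∈ p(Q)}`. -/
def sliceHomeo (hspan : Submodule.span ℝ (Set.range D.X) = ⊤) : (D.slice 𝔨).Space ≃ₜ D.Reduced 𝔨 := by
  let f : (D.slice 𝔨).Space → D.Reduced 𝔨 :=
    Quotient.lift (fun z => D.toReduced 𝔨 (sliceToZero hspan z)) fun z w h =>
      (toReduced_sliceToZero_eq_iff hspan).2 (Quotient.sound h)
  have hq : Topology.IsQuotientMap fun z : (D.slice 𝔨).levelSet => D.toReduced 𝔨 (sliceToZero hspan z) :=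
    (isQuotientMap_quot_mk : Topology.IsQuotientMap (D.toReduced 𝔨)).comp (isQuotientMap_sliceToZero hspan)
  have hinj : Function.Injective f := by
    intro x y
    induction x using Quotient.inductionOn with
    | h z =>
    induction y using Quotient.inductionOn with
    | h w => exact (toReduced_sliceToZero_eq_iff hspan).1
  have hf : IsHomeomorph f := by
    refine ⟨continuous_quot_lift _ hq.continuous, fun U hU => ?_, hinj, fun y => ?_⟩
    · rw [← hq.isOpen_preimage]
      have : (fun z : (D.slice 𝔨).levelSet => D.toReduced 𝔨 (sliceToZero hspan z)) ⁻¹' (f '' U) =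
          (D.slice 𝔨).cls ⁻¹' U := by
        ext z
        exact hinj.mem_set_image (a := (D.slice 𝔨).cls z)
      rw [this]
      exact hU.preimage continuous_cls
    · obtain ⟨z, hz⟩ := hq.surjective y
      exact ⟨(D.slice 𝔨).cls z, hz⟩
  exact hf.homeomorph

theorem sliceHomeo_act (hspan : Submodule.span ℝ (Set.range D.X) = ⊤) (v : V) (x : (D.slice 𝔨).Space) :
    sliceHomeo hspan ((D.slice 𝔨).act (QuotientAddGroup.mk (𝔨.mkQ v)) x) =
      D.reducedAct 𝔨 (QuotientAddGroup.mk v) (sliceHomeo hspan x) := by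
  obtain ⟨Y, rfl⟩ := proj_surjective hspan v
  induction x using Quotient.inductionOn with
  | h z =>
    have h1 := (D.slice 𝔨).act_cls Y z
    rw [slice_proj] at h1
    refine (congrArg (sliceHomeo hspan) h1).trans ?_
    change D.toReduced 𝔨 _ = D.toReduced 𝔨 (D.actZero 𝔨 _ _)
    exact congrArg (D.toReduced 𝔨) (Subtype.ext (D.act_cls Y ⟨z.1, slice_levelSet_subset z.2⟩).symm)

end Slice

/-! ### Discarding redundant half-spaces in the construction -/

section Restrict

variable {ι V : Type*} [Fintype ι] [AddCommGroup V] [Module ℝ V] {T : ToricData ι V} {S : Finset ι}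

/-- The half-spaces with index outside `S` are redundant, and their boundaries do not meet the
polyhedron. -/
structure IsSufficient (T : ToricData ι V) (S : Finset ι) : Prop where
  polyhedron_eq : (T.restrict S).polyhedron = T.polyhedron
  mem_of_nonempty : ∀ j, (T.face j).Nonempty → j ∈ S
  span : Submodule.span ℝ (Set.range (T.restrict S).X) = ⊤
  mem_Q : ∀ j, T.X j ∈ T.Q

theorem restrict_proj_comp {Y : ι → ℝ} (hY : ∀ j ∉ S, Y j = 0) :
    (T.restrict S).proj (Y ∘ Subtype.val) = T.proj Y := by
  rw [proj_apply, proj_apply]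
  refine Fintype.sum_of_injective Subtype.val Subtype.val_injective _ _ (fun j hj => ?_) fun _ => rfl
  rw [hY j fun h => hj ⟨⟨j, h⟩, rfl⟩, zero_smul]

theorem exists_extension (Y : {j // j ∈ S} → ℝ) :
    ∃ Z : ι → ℝ, Z ∘ Subtype.val = Y ∧ (∀ j ∉ S, Z j = 0) ∧ T.proj Z = (T.restrict S).proj Y := by
  have h1 : Function.extend Subtype.val Y 0 ∘ Subtype.val = Y :=
    Function.extend_comp Subtype.val_injective _ _
  have h2 : ∀ j ∉ S, Function.extend Subtype.val Y (0 : ι → ℝ) j = 0 := fun j hj =>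
    Function.extend_apply' _ _ _ fun ⟨i, hi⟩ => hj (hi ▸ i.2)
  refine ⟨_, h1, h2, ?_⟩
  rw [← restrict_proj_comp h2, h1]

namespace IsSufficient

theorem exists_isSection (h : T.IsSufficient S) : ∃ R, (T.restrict S).IsSection Set.univ R :=
  (T.restrict S).exists_isSection (by rw [Set.image_univ, h.span])

/-- A section of the projection for the half-spaces that are kept. -/
def sec (h : T.IsSufficient S) : V →ₗ[ℝ] ({j // j ∈ S} → ℝ) := h.exists_isSection.choose

theorem proj_sec (h : T.IsSufficient S) (v : V) : (T.restrict S).proj (h.sec v) = v :=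
  h.exists_isSection.choose_spec.proj_apply v

open Classical in
/-- The point with the given coordinates in `S` and with positive coordinates at the redundant half-spaces,
determined by the moment condition. -/
def complete (h : T.IsSufficient S) (η : {j // j ∈ S} → ℂ) : ι → ℂ := fun j =>
  if hj : j ∈ S then η ⟨j, hj⟩
  else ((Real.sqrt (∑ i, (‖η i‖ ^ 2 + T.lam i) * h.sec (T.X j) i - T.lam j) : ℝ) : ℂ)

variable (h : T.IsSufficient S)

theorem complete_val (η : {j // j ∈ S} → ℂ) (i : {j // j ∈ S}) : h.complete η i = η i :=
  dif_pos i.2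

theorem complete_comp_val (η : {j // j ∈ S} → ℂ) : h.complete η ∘ Subtype.val = η :=
  funext (h.complete_val η)

theorem complete_of_notMem (η : {j // j ∈ S} → ℂ) {j : ι} (hj : j ∉ S) : h.complete η j =
    ((Real.sqrt (∑ i, (‖η i‖ ^ 2 + T.lam i) * h.sec (T.X j) i - T.lam j) : ℝ) : ℂ) :=
  dif_neg hj

theorem complete_eq_norm (η : {j // j ∈ S} → ℂ) {j : ι} (hj : j ∉ S) :
    h.complete η j = ‖h.complete η j‖ := by
  rw [h.complete_of_notMem η hj, Complex.norm_real, Real.norm_of_nonneg (Real.sqrt_nonneg _)]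

theorem continuous_complete : Continuous h.complete := by
  refine continuous_pi fun j => ?_
  by_cases hj : j ∈ S
  · have : (fun η => h.complete η j) = fun η => η ⟨j, hj⟩ := funext fun η => h.complete_val η ⟨j, hj⟩
    rw [this]
    exact continuous_apply _
  · simp only [h.complete_of_notMem _ hj]
    refine Complex.continuous_ofReal.comp (Real.continuous_sqrt.comp ?_)
    fun_prop

theorem moment_sec {η : {j // j ∈ S} → ℂ} {μ : Module.Dual ℝ V}
    (hμ : ∀ i : {j // j ∈ S}, μ (T.X i) = ‖η i‖ ^ 2 + T.lam i) (v : V) :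
    ∑ i, (‖η i‖ ^ 2 + T.lam i) * h.sec v i = μ v := by
  conv_rhs => rw [← h.proj_sec v, proj_apply, map_sum]
  refine Finset.sum_congr rfl fun i _ => ?_
  rw [map_smul, smul_eq_mul, mul_comm]
  exact congrArg _ (hμ i).symm

theorem norm_complete {η : {j // j ∈ S} → ℂ} {μ : Module.Dual ℝ V}
    (hμ : ∀ i : {j // j ∈ S}, μ (T.X i) = ‖η i‖ ^ 2 + T.lam i) :
    (∀ j, ‖h.complete η j‖ ^ 2 + T.lam j = μ (T.X j)) ∧ ∀ j ∉ S, h.complete η j ≠ 0 := by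
  have hP : μ ∈ T.polyhedron := by
    rw [← h.polyhedron_eq]
    intro i
    change T.lam i ≤ μ (T.X i)
    rw [hμ]
    have := sq_nonneg ‖η i‖
    linarith
  have hlt : ∀ j ∉ S, 0 < μ (T.X j) - T.lam j := fun j hj =>
    sub_pos.2 (lt_of_le_of_ne (hP j) fun he => hj (h.mem_of_nonempty j ⟨μ, hP, he.symm⟩))
  refine ⟨fun j => ?_, fun j hj => ?_⟩
  · by_cases hj : j ∈ S
    · exact (congrArg (fun z : ℂ => ‖z‖ ^ 2 + T.lam j) (h.complete_val η ⟨j, hj⟩)).trans (hμ ⟨j, hj⟩).symm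
    · rw [h.complete_of_notMem _ hj, h.moment_sec hμ, Complex.norm_real,
        Real.norm_of_nonneg (Real.sqrt_nonneg _), Real.sq_sqrt (hlt j hj).le, sub_add_cancel]
  · rw [h.complete_of_notMem _ hj, h.moment_sec hμ, Ne, Complex.ofReal_eq_zero]
    exact (Real.sqrt_pos.2 (hlt j hj)).ne'

theorem complete_mem {η : {j // j ∈ S} → ℂ} (hη : η ∈ (T.restrict S).levelSet) :
    h.complete η ∈ T.levelSet := by
  obtain ⟨μ, hμ⟩ := (T.restrict S).exists_moment ⟨η, hη⟩
  exact mem_levelSet_of_moment μ (h.norm_complete hμ).1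

theorem complete_ne_zero {η : {j // j ∈ S} → ℂ} (hη : η ∈ (T.restrict S).levelSet) {j : ι} (hj : j ∉ S) :
    h.complete η j ≠ 0 := by
  obtain ⟨μ, hμ⟩ := (T.restrict S).exists_moment ⟨η, hη⟩
  exact (h.norm_complete hμ).2 j hj

theorem ne_zero_of_mem_levelSet (h : T.IsSufficient S) {ζ : ι → ℂ} (hζ : ζ ∈ T.levelSet) {j : ι}
    (hj : j ∉ S) : ζ j ≠ 0 := by
  obtain ⟨μ, hμ⟩ := T.exists_moment ⟨ζ, hζ⟩
  intro h0
  have h1 : μ (T.X j) = T.lam j := by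
    rw [hμ j]
    simp [h0]
  refine hj (h.mem_of_nonempty j ⟨μ, fun i => ?_, h1⟩)
  rw [hμ i]
  have := sq_nonneg ‖ζ i‖
  dsimp only
  linarith

theorem _root_.ToricData.comp_val_mem_levelSet {ζ : ι → ℂ} (hζ : ζ ∈ T.levelSet) :
    ζ ∘ Subtype.val ∈ (T.restrict S).levelSet := by
  obtain ⟨μ, hμ⟩ := T.exists_moment ⟨ζ, hζ⟩
  exact mem_levelSet_of_moment μ fun i => (hμ i).symm

theorem complete_comp {ζ : ι → ℂ} (hζ : ζ ∈ T.levelSet) (hpos : ∀ j ∉ S, ζ j = ‖ζ j‖) :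
    h.complete (ζ ∘ Subtype.val) = ζ := by
  obtain ⟨μ, hμ⟩ := T.exists_moment ⟨ζ, hζ⟩
  funext j
  by_cases hj : j ∈ S
  · exact h.complete_val _ ⟨j, hj⟩
  · have h1 := (h.norm_complete (η := ζ ∘ Subtype.val) (μ := μ) fun i => hμ i).1 j
    rw [hμ j, add_left_inj, sq_eq_sq₀ (norm_nonneg _) (norm_nonneg _)] at h1
    rw [h.complete_eq_norm _ hj, h1]
    exact (hpos j hj).symm

theorem complete_torus_smul {t : ι → Circle} (ht : ∀ j ∉ S, t j = 1) (η : {j // j ∈ S} → ℂ) :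
    h.complete ((t ∘ (Subtype.val : {j // j ∈ S} → ι)) • η) = t • h.complete η := by
  funext j
  change _ = (t j : ℂ) * h.complete η j
  by_cases hj : j ∈ S
  · rw [h.complete_val _ ⟨j, hj⟩, h.complete_val _ ⟨j, hj⟩]
    rfl
  · rw [h.complete_of_notMem _ hj, h.complete_of_notMem _ hj, ht j hj, Circle.coe_one, one_mul]
    simp only [norm_torus_smul]

/-- The completion of coordinates, as a map of level sets. -/
def completeLevel (η : (T.restrict S).levelSet) : T.levelSet := ⟨h.complete η.1, h.complete_mem η.2⟩

theorem continuous_completeLevel : Continuous h.completeLevel :=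
  (h.continuous_complete.comp continuous_subtype_val).subtype_mk _

theorem expT_extension {Z : ι → ℝ} (hZ : ∀ j ∉ S, Z j = 0) : ∀ j ∉ S, expT Z j = 1 := fun j hj =>
  expT_apply_eq_one_iff.2 ⟨0, by rw [hZ j hj, Int.cast_zero]⟩

/-- Completed points are in the same orbit exactly if the given ones are: an element of the torus that relates
two completed points is trivial at the redundant half-spaces. -/
theorem cls_completeLevel_eq_iff {η η' : (T.restrict S).levelSet} :
    T.cls (h.completeLevel η) = T.cls (h.completeLevel η') ↔
      (T.restrict S).cls η = (T.restrict S).cls η' := by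
  rw [cls_eq_cls_iff, cls_eq_cls_iff]
  constructor
  · rintro ⟨Y, hY, h1⟩
    -- the coordinates of both points at the redundant half-spaces are positive
    have h2 : ∀ j ∉ (S : Set ι), expT Y j = 1 := fun j hj => by
      have h3 : (expT Y j : ℂ) * h.complete η.1 j = h.complete η'.1 j := congrFun h1 j
      have h4 : ‖h.complete η'.1 j‖ = ‖h.complete η.1 j‖ := by
        rw [← h3, norm_mul, Circle.norm_coe, one_mul]
      rw [h.complete_eq_norm η'.1 hj, h4, ← h.complete_eq_norm η.1 hj] at h3
      exact Circle.ext (mul_right_cancel₀ (h.complete_ne_zero η.2 hj)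
        (by rw [h3, Circle.coe_one, one_mul]))
    obtain ⟨Y', h5, h6, h7⟩ := exists_supported h.mem_Q hY h2
    refine ⟨Y' ∘ Subtype.val, by rw [restrict_proj_comp h5]; exact h6, ?_⟩
    rw [← h.complete_comp_val η'.1, ← h.complete_comp_val η.1]
    funext i
    have h8 := congrFun h1 i
    rw [← h7] at h8
    exact h8
  · rintro ⟨Y, hY, h1⟩
    obtain ⟨Z, rfl, h0, hZ⟩ := exists_extension (T := T) Y
    refine ⟨Z, by rw [hZ]; exact hY, ?_⟩
    change expT Z • h.complete η.1 = h.complete η'.1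
    rw [← h1, ← h.complete_torus_smul (expT_extension h0)]
    rfl

theorem span_image (h : T.IsSufficient S) : Submodule.span ℝ (T.X '' (S : Set ι)) = ⊤ := by
  rw [← h.span, Set.image_eq_range]
  rfl

/-- The map of orbit spaces induced by the completion of coordinates. -/
def completeSpace : (T.restrict S).Space → T.Space :=
  Quotient.lift (fun η => T.cls (h.completeLevel η)) fun _ _ hη =>
    h.cls_completeLevel_eq_iff.2 (Quotient.sound hη)

theorem continuous_completeSpace : Continuous h.completeSpace :=
  continuous_quot_lift _ (continuous_cls.comp h.continuous_completeLevel)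

theorem bijective_completeSpace : Function.Bijective h.completeSpace := by
  refine ⟨fun x y => ?_, fun y => ?_⟩
  · induction x using Quotient.inductionOn with
    | h η =>
    induction y using Quotient.inductionOn with
    | h η' => exact h.cls_completeLevel_eq_iff.1
  · induction y using Quotient.inductionOn with
    | h ζ =>
    obtain ⟨R, hR⟩ := T.exists_isSection h.span_image
    obtain ⟨Y, hY, hpos, -⟩ := hR.exists_normalizing ζ.1 0
    have hmem := T.smul_mem_levelSet (expT Y) ζ.2
    refine ⟨(T.restrict S).cls ⟨(expT Y • ζ.1) ∘ Subtype.val, comp_val_mem_levelSet hmem⟩,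
      (cls_eq_cls_iff.2 ⟨Y, by rw [hY]; exact T.Q.zero_mem, ?_⟩).symm⟩
    refine (h.complete_comp hmem fun j hj => ?_).symm
    rw [norm_torus_smul]
    exact hpos j hj

/-- Near a completed point, a rotation in `exp(ker π)` makes the coordinates at the redundant half-spaces
positive; forgetting them gives a local inverse of the completion, up to the group. -/
theorem exists_local_inverse {ζ₁ : T.levelSet} {η : (T.restrict S).levelSet}
    (hζ : T.cls ζ₁ = T.cls (h.completeLevel η)) :
    ∃ Z : T.levelSet → (T.restrict S).levelSet, ContinuousAt Z ζ₁ ∧ Z ζ₁ = η ∧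
      ∀ᶠ ζ in 𝓝 ζ₁, T.cls ζ = T.cls (h.completeLevel (Z ζ)) := by
  obtain ⟨Y, hY, h1⟩ := cls_eq_cls_iff.1 hζ
  have h1' : expT Y • ζ₁.1 = h.complete η.1 := h1
  obtain ⟨R, hR⟩ := T.exists_isSection h.span_image
  have hζ0 : ∀ j ∉ (S : Set ι), ζ₁.1 j ≠ 0 := fun j hj => h.ne_zero_of_mem_levelSet ζ₁.2 hj
  obtain ⟨δ, hδ, hδ0, hker, hgood⟩ := hR.exists_local_straightening hζ0 (Y := Y) fun j hj => by
    rw [← norm_torus_smul (expT Y) ζ₁.1, h1']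
    exact h.complete_eq_norm _ hj
  have hδc : ContinuousAt (fun ζ : T.levelSet => δ ζ.1) ζ₁ :=
    ContinuousAt.comp (g := δ) hδ.continuousAt continuous_subtype_val.continuousAt
  have hη : ContinuousAt (fun ζ : T.levelSet => expT (Y + δ ζ.1) • ζ.1) ζ₁ :=
    continuousAt_expT_smul (continuousAt_const.add hδc) continuous_subtype_val.continuousAt
  have hη' : ContinuousAt (fun ζ : T.levelSet =>
      (expT (Y + δ ζ.1) • ζ.1) ∘ (Subtype.val : {j // j ∈ S} → ι)) ζ₁ :=
    continuousAt_pi.2 fun i =>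
      ContinuousAt.comp (g := fun y : ι → ℂ => y i) (continuous_apply i.1).continuousAt hη
  refine ⟨fun ζ => ⟨(expT (Y + δ ζ.1) • ζ.1) ∘ Subtype.val,
    comp_val_mem_levelSet (T.smul_mem_levelSet _ ζ.2)⟩, ?_, Subtype.ext ?_, ?_⟩
  · exact Topology.IsInducing.subtypeVal.continuousAt_iff.2 hη'
  · change (expT (Y + δ ζ₁.1) • ζ₁.1) ∘ Subtype.val = η.1
    rw [hδ0, add_zero, h1']
    exact h.complete_comp_val _
  · filter_upwards [(continuous_subtype_val.tendsto ζ₁).eventually hgood] with ζ h4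
    refine cls_eq_cls_iff.2 ⟨Y + δ ζ.1, by rwa [map_add, hker, add_zero], ?_⟩
    refine (h.complete_comp (T.smul_mem_levelSet _ ζ.2) fun j hj => ?_).symm
    rw [norm_torus_smul]
    exact (h4 j hj).2

theorem isOpenMap_completeSpace : IsOpenMap h.completeSpace := by
  intro U hU
  have hq : Topology.IsQuotientMap T.cls := isQuotientMap_quot_mk
  rw [← hq.isOpen_preimage, isOpen_iff_mem_nhds]
  rintro ζ₁ ⟨x, hx, hxζ⟩
  induction x using Quotient.inductionOn with
  | h η =>
  obtain ⟨Z, hZ, hZ0, hgood⟩ := h.exists_local_inverse hxζ.symm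
  have hU' : (T.restrict S).cls ⁻¹' U ∈ 𝓝 (Z ζ₁) :=
    (hU.preimage continuous_cls).mem_nhds (by rw [hZ0]; exact hx)
  filter_upwards [hZ.eventually hU', hgood] with ζ h3 h4
  exact ⟨_, h3, h4.symm⟩

/-- The toric quasifold does not change when redundant half-spaces are discarded. -/
def homeo : (T.restrict S).Space ≃ₜ T.Space :=
  IsHomeomorph.homeomorph h.completeSpace
    ⟨h.continuous_completeSpace, h.isOpenMap_completeSpace, h.bijective_completeSpace⟩

theorem homeo_act (h : T.IsSufficient S) (v : V) (x : (T.restrict S).Space) :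
    h.homeo ((T.restrict S).act (QuotientAddGroup.mk v) x) =
      T.act (QuotientAddGroup.mk v) (h.homeo x) := by
  obtain ⟨Y, rfl⟩ := proj_surjective h.span v
  induction x using Quotient.inductionOn with
  | h η =>
    refine (congrArg h.homeo ((T.restrict S).act_cls Y η)).trans ?_
    obtain ⟨Z, rfl, h0, hZ⟩ := exists_extension (T := T) Y
    rw [← hZ]
    refine Eq.trans ?_ (T.act_cls Z (h.completeLevel η)).symm
    exact congrArg T.cls (Subtype.ext (h.complete_torus_smul (expT_extension h0) η.1))

/-- A vertex with its basis of normal vectors, regarded as a vertex of the polyhedron with all its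
half-spaces. -/
def frame {m : ℕ} (F : (T.restrict S).VertexFrame m) : T.VertexFrame m where
  ν := F.ν
  isVertex := by
    have := F.isVertex
    rwa [vertices, h.polyhedron_eq] at this
  e := F.e.trans (Function.Embedding.subtype _)
  range_e := by
    have hν : F.ν ∈ T.polyhedron := h.polyhedron_eq ▸ F.isVertex.1
    have h1 : T.active F.ν = Subtype.val '' (T.restrict S).active F.ν := by
      ext j
      refine ⟨fun hj => ⟨⟨j, h.mem_of_nonempty j ⟨F.ν, hν, hj⟩⟩, hj, rfl⟩, ?_⟩
      rintro ⟨i, hi, rfl⟩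
      exact hi
    rw [h1, ← F.range_e, ← Set.range_comp]
    rfl
  basis := F.basis
  basis_eq := F.basis_eq

theorem notMem_range_frame {m : ℕ} (F : (T.restrict S).VertexFrame m) {i : {j // j ∈ S}} :
    i.1 ∉ Set.range (h.frame F).e ↔ i ∉ Set.range F.e := by
  refine not_congr ⟨?_, ?_⟩
  · rintro ⟨k, hk⟩
    exact ⟨k, Subtype.ext hk⟩
  · rintro ⟨k, rfl⟩
    exact ⟨k, rfl⟩

theorem mem_dom_of_frame {m : ℕ} (F : (T.restrict S).VertexFrame m) {z : Fin m → ℂ}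
    (hz : z ∈ (h.frame F).dom) : z ∈ F.dom := fun i hi =>
  hz i ((h.notMem_range_frame F).2 hi)

/-- The chart at a vertex is compatible with the completion of coordinates. -/
theorem frame_dom_lift {m : ℕ} (F : (T.restrict S).VertexFrame m) {z : Fin m → ℂ} (hz : z ∈ F.dom) :
    z ∈ (h.frame F).dom ∧ (h.frame F).lift z = h.complete (F.lift z) := by
  have hmem := h.complete_mem (F.lift_mem hz)
  have h1 : h.complete (F.lift z) ∘ (h.frame F).e = z := funext fun i =>
    (h.complete_val _ (F.e i)).trans (F.lift_apply z i)
  have h2 : ∀ j, j ∉ Set.range (h.frame F).e →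
      h.complete (F.lift z) j ≠ 0 ∧ h.complete (F.lift z) j = ‖h.complete (F.lift z) j‖ := by
    intro j hj
    by_cases hjS : j ∈ S
    · have hj' : (⟨j, hjS⟩ : {j // j ∈ S}) ∉ Set.range F.e := (h.notMem_range_frame F).1 hj
      have h3 : h.complete (F.lift z) j = F.lift z ⟨j, hjS⟩ := h.complete_val _ ⟨j, hjS⟩
      rw [h3]
      exact ⟨F.lift_ne_zero hz hj', F.lift_eq_norm hj'⟩
    · exact ⟨h.complete_ne_zero (F.lift_mem hz) hjS, h.complete_eq_norm _ hjS⟩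
  constructor
  · have := (h.frame F).comp_mem_dom hmem fun j hj => (h2 j hj).1
    rwa [h1] at this
  · have := (h.frame F).lift_comp hmem fun j hj => (h2 j hj).2
    rwa [h1] at this

end IsSufficient

end Restrict

end ToricData

/-! ### Transport of structures along homeomorphisms -/

section Transport

variable {E E' : Type*} [NormedAddCommGroup E] [NormedSpace ℝ E]
  [NormedAddCommGroup E'] [NormedSpace ℝ E'] {M M' : Type*}

theorem QChart.rep_push_iff {a : QChart E M} {x : E} (e : M ≃ M') {m : M'} :
    (a.push e).Rep x m ↔ a.Rep x (e.symm m) :=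
  exists_congr fun _ => (Equiv.eq_symm_apply e).symm

theorem QChart.Compatible.push {a : QChart E M} {b : QChart E' M} (h : a.Compatible b) (e : M ≃ M') :
    (a.push e).Compatible (b.push e) := by
  have h1 : ∀ x y, (∃ m, (a.push e).Rep x m ∧ (b.push e).Rep y m) ↔ ∃ m, a.Rep x m ∧ b.Rep y m := by
    intro x y
    simp only [QChart.rep_push_iff]
    exact ⟨fun ⟨m, hm⟩ => ⟨_, hm⟩, fun ⟨m, hm⟩ => ⟨e m, by rwa [e.symm_apply_apply]⟩⟩
  have h2 : (a.push e).overlap (b.push e) = a.overlap b := by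
    ext x
    constructor
    · rintro ⟨m, y, hm⟩
      obtain ⟨m', hm'⟩ := (h1 x y).1 ⟨m, hm⟩
      exact ⟨m', y, hm'⟩
    · rintro ⟨m, y, hm⟩
      obtain ⟨m', hm'⟩ := (h1 x y).2 ⟨m, hm⟩
      exact ⟨m', y, hm'⟩
  have h3 : (b.push e).overlap (a.push e) = b.overlap a := by
    ext y
    constructor
    · rintro ⟨m, x, hm, hm'⟩
      obtain ⟨m', h4, h5⟩ := (h1 x y).1 ⟨m, hm', hm⟩
      exact ⟨m', x, h5, h4⟩
    · rintro ⟨m, x, hm, hm'⟩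
      obtain ⟨m', h4, h5⟩ := (h1 x y).2 ⟨m, hm', hm⟩
      exact ⟨m', x, h5, h4⟩
  unfold QChart.Compatible
  rw [h2, h3]
  intro hne
  obtain ⟨h4, h5, W, _, α, β, h6, h7, h8, h9, h10, h11, h12⟩ := h hne
  exact ⟨h4, h5, W, _, α, β, h6, h7, h8, h9, h10, fun w => (h1 _ _).2 (h11 w), h12⟩

theorem QChart.IsSymplectic.push [TopologicalSpace M] [TopologicalSpace M'] {a : QChart E M}
    (h : a.IsSymplectic) (e : M ≃ₜ M') : (a.push e).IsSymplectic where
  isOpen_dom := h.isOpen_dom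
  countable_grp := h.countable_grp
  smooth_grp := h.smooth_grp
  connected_free := h.connected_free
  dense_free := h.dense_free
  continuous_map := e.continuous.comp h.continuous_map
  isOpenMap_map := e.isOpenMap.comp h.isOpenMap_map
  map_eq_iff x y := e.injective.eq_iff.trans (h.map_eq_iff x y)
  smooth_form := h.smooth_form
  closed_form := h.closed_form
  nondegenerate_form := h.nondegenerate_form

/-- The image of an atlas under a map of the underlying spaces. -/
def pushAtlas (g : M → M') (𝒜 : Set (QChart E M)) : Set (QChart E M') := (fun a => a.push g) '' 𝒜

theorem IsSymplecticQuasifold.push [TopologicalSpace M] [TopologicalSpace M'] {𝒜 : Set (QChart E M)}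
    (h : IsSymplecticQuasifold 𝒜) (e : M ≃ₜ M') : IsSymplecticQuasifold (pushAtlas e 𝒜) where
  chart := by
    rintro _ ⟨a, ha, rfl⟩
    exact (h.chart a ha).push e
  cover m := by
    obtain ⟨a, ha, x, hx⟩ := h.cover (e.symm m)
    exact ⟨_, ⟨a, ha, rfl⟩, x, (QChart.rep_push_iff e.toEquiv).2 hx⟩
  compatible := by
    rintro _ ⟨a, ha, rfl⟩ _ ⟨b, hb, rfl⟩
    exact (h.compatible a ha b hb).push e.toEquiv

theorem IsSymplecticQuasifold.isSymplectomorphism_symm [TopologicalSpace M] [TopologicalSpace M']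
    {𝒜 : Set (QChart E M)} (h : IsSymplecticQuasifold 𝒜) (e : M ≃ₜ M') :
    IsSymplectomorphism (pushAtlas e 𝒜) 𝒜 e.symm where
  homeo := e.symm.isHomeomorph
  compatible := by
    rintro _ ⟨a, ha, rfl⟩ b hb
    have h1 : (a.push e).push e.symm = a := by
      have : e.symm ∘ e ∘ a.map = a.map := funext fun x => e.symm_apply_apply _
      unfold QChart.push
      rw [this]
    change ((a.push e).push e.symm).Compatible b
    rw [h1]
    exact h.compatible a ha b hb

theorem IsSymplectomorphism.conj [TopologicalSpace M] [TopologicalSpace M'] {𝒜 : Set (QChart E M)}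
    {g : M → M} (h : IsSymplectomorphism 𝒜 𝒜 g) (e : M ≃ₜ M') :
    IsSymplectomorphism (pushAtlas e 𝒜) (pushAtlas e 𝒜) fun x => e (g (e.symm x)) where
  homeo := e.isHomeomorph.comp (h.homeo.comp e.symm.isHomeomorph)
  compatible := by
    rintro _ ⟨a, ha, rfl⟩ _ ⟨b, hb, rfl⟩
    have h1 : (a.push e).push (fun x => e (g (e.symm x))) = (a.push g).push e := by
      have : (fun x => e (g (e.symm x))) ∘ e ∘ a.map = e ∘ g ∘ a.map :=
        funext fun x => by simp only [Function.comp_apply, e.symm_apply_apply]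
      unfold QChart.push
      dsimp only
      rw [this]
    change ((a.push e).push fun x => e (g (e.symm x))).Compatible (b.push e)
    rw [h1]
    exact (h.compatible a ha b hb).push e.toEquiv

theorem IsSmoothAction.conj {V : Type*} [NormedAddCommGroup V] [NormedSpace ℝ V]
    {𝒜 : Set (QChart E M)} {act : V → M → M} (h : IsSmoothAction 𝒜 act) (e : M ≃ M') :
    IsSmoothAction (pushAtlas e 𝒜) fun v x => e (act v (e.symm x)) := by
  rintro _ ⟨a, ha, rfl⟩ _ ⟨b, hb, rfl⟩ v x y m hx hy
  rw [QChart.rep_push_iff] at hx hy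
  rw [e.symm_apply_apply] at hy
  obtain ⟨f, hf, hf0, hev⟩ := h a ha b hb v x y (e.symm m) hx hy
  refine ⟨f, hf, hf0, hev.mono fun p hp => ?_⟩
  obtain ⟨m', h1, h2⟩ := hp
  refine ⟨e m', QChart.rep_push_iff e |>.2 ?_, QChart.rep_push_iff e |>.2 ?_⟩
  · rwa [e.symm_apply_apply]
  · rwa [e.symm_apply_apply, e.symm_apply_apply]

end Transport

namespace ToricData

/-! ### The reduced space and the toric quasifold of the reduced polyhedron -/

section Reduction

variable {ι V : Type*} [Fintype ι] [AddCommGroup V] [Module ℝ V] {D : ToricData ι V}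
  {𝔨 : Submodule ℝ V}

theorem IsRegular.isSufficient_sliceFacets [FiniteDimensional ℝ V] (hS : (D.slice 𝔨).IsRegular)
    (hadm : ((D.slice 𝔨).restrict (D.sliceFacets 𝔨)).IsAdmissible)
    (hne : (D.slice 𝔨).polyhedron.Nonempty) : (D.slice 𝔨).IsSufficient (D.sliceFacets 𝔨) where
  polyhedron_eq := polyhedron_restrict hne fun j => (hS.mem_sliceFacets_iff j).2
  mem_of_nonempty j := (hS.mem_sliceFacets_iff j).2
  span := hadm.isRegular.span
  mem_Q := hS.mem_Q

/-- The reduced space is homeomorphic to the toric quasifold of the reduced polyhedron. -/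
def reducedHomeo (hspan : Submodule.span ℝ (Set.range D.X) = ⊤)
    (h : (D.slice 𝔨).IsSufficient (D.sliceFacets 𝔨)) : (D.reducedData 𝔨).Space ≃ₜ D.Reduced 𝔨 :=
  h.homeo.trans (sliceHomeo hspan)

variable (hspan : Submodule.span ℝ (Set.range D.X) = ⊤)
  (h : (D.slice 𝔨).IsSufficient (D.sliceFacets 𝔨))

theorem reducedHomeo_act (v : V) (x : (D.reducedData 𝔨).Space) :
    reducedHomeo hspan h ((D.reducedData 𝔨).act (QuotientAddGroup.mk (𝔨.mkQ v)) x) =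
      D.reducedAct 𝔨 (QuotientAddGroup.mk v) (reducedHomeo hspan h x) :=
  (congrArg (sliceHomeo hspan) (h.homeo_act (𝔨.mkQ v) x)).trans (sliceHomeo_act hspan v (h.homeo x))

/-- The form of the toric quasifold of the reduced polyhedron is the reduced form: a smooth map into a chart
of `M` over the zero level is a smooth map into the level set over the slice, which a smooth family of
elements of the group moves into the slice of a chart of the reduced space. -/
theorem isReducedStructure (n m : ℕ) : IsReducedStructure (D.atlas n) (D.toReduced 𝔨)
    (pushAtlas (reducedHomeo hspan h) ((D.reducedData 𝔨).atlas m)) := by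
  rintro _ ⟨F, rfl⟩ _ ⟨_, ⟨F', rfl⟩, rfl⟩ p f u₀ x hf hZ ⟨z, ⟨hdom₀, hz⟩, hx, hxz⟩
  have hmem : ∀ᶠ u in 𝓝 u₀, f u ∈ F.dom ∧ F.lift (f u) ∈ (D.slice 𝔨).levelSet := by
    filter_upwards [hZ] with u hu
    obtain ⟨z, hdom, hz⟩ := hu
    have hz' : D.cls ⟨F.lift (f u), F.lift_mem hdom⟩ = z := hz
    exact ⟨hdom, (cls_mem_zeroLevel_iff hspan (z := ⟨F.lift (f u), F.lift_mem hdom⟩)).1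
      (by rw [hz']; exact z.2)⟩
  have hζ₀ := hmem.self_of_nhds.2
  have hz₀ : z = sliceToZero hspan ⟨F.lift (f u₀), hζ₀⟩ := Subtype.ext hz.symm
  have hx' : D.toReduced 𝔨 (sliceToZero hspan (h.completeLevel ⟨F'.lift x, F'.lift_mem hx⟩)) =
      D.toReduced 𝔨 (sliceToZero hspan ⟨F.lift (f u₀), hζ₀⟩) := hz₀ ▸ hxz
  obtain ⟨Y₀, hY₀, hY⟩ := cls_eq_cls_iff.1 ((toReduced_sliceToZero_eq_iff hspan).1 hx').symm
  have hY' : expT Y₀ • F.lift (f u₀) = (h.frame F').lift x := hY.trans (h.frame_dom_lift F' hx).2.symm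
  have hζ : ContDiffAt ℝ ∞ (fun u => F.lift (f u)) u₀ :=
    ContDiffAt.comp (g := F.lift) u₀ (F.contDiffAt_lift hdom₀) hf
  obtain ⟨f', δ, hf', hf'0, -, -, hgood⟩ := (h.frame F').exists_local_lift hζ
    (hmem.mono fun u hu => hu.2) (h.frame_dom_lift F' hx).1 hY'
  refine ⟨f', hf', hf'0, ?_⟩
  filter_upwards [hgood, hmem, hf.eventually_differentiableAt] with u h1 h2 h3
  obtain ⟨h4, h5, h6, h7⟩ := h1
  have hdom' := h.mem_dom_of_frame F' h4
  refine ⟨⟨sliceToZero hspan ⟨_, h2.2⟩, ⟨h2.1, rfl⟩, hdom', ?_⟩, ?_⟩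
  · refine (toReduced_sliceToZero_eq_iff hspan
      (z := h.completeLevel ⟨F'.lift (f' u), F'.lift_mem hdom'⟩)).2 (cls_eq_cls_iff.2
        ⟨Y₀ + δ u, by rwa [map_add, h5, add_zero], ?_⟩).symm
    exact h6.symm.trans (h.frame_dom_lift F' hdom').2
  · ext v
    change pullbackForm f' (fun _ => stdForm m) u v = pullbackForm f (fun _ => stdForm n) u v
    rw [pullbackForm_stdForm, pullbackForm_stdForm, h7, F.coordForm_fderiv_lift h3 h2.1]

/-- The action of `(V / Q) / K` on the reduced space, transported from the action of `(V / 𝔨) / p(Q)` on the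
toric quasifold of the reduced polyhedron. -/
@[reducible]
def reducedAddAction (hspan' : Submodule.span ℝ (Set.range (D.reducedData 𝔨).X) = ⊤) :
    AddAction ((V ⧸ D.Q) ⧸ D.subgroupK 𝔨) (D.Reduced 𝔨) where
  vadd τ x := reducedHomeo hspan h ((D.reducedData 𝔨).act (D.residualHom 𝔨 τ)
    ((reducedHomeo hspan h).symm x))
  zero_vadd x := by
    change reducedHomeo hspan h ((D.reducedData 𝔨).act (D.residualHom 𝔨 0)
      ((reducedHomeo hspan h).symm x)) = x
    rw [map_zero, act_zero, Homeomorph.apply_symm_apply]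
  add_vadd τ τ' x := by
    change reducedHomeo hspan h ((D.reducedData 𝔨).act (D.residualHom 𝔨 (τ + τ')) _) =
      reducedHomeo hspan h ((D.reducedData 𝔨).act (D.residualHom 𝔨 τ) ((reducedHomeo hspan h).symm
        (reducedHomeo hspan h ((D.reducedData 𝔨).act (D.residualHom 𝔨 τ') _))))
    rw [map_add, act_add hspan', Homeomorph.symm_apply_apply]

end Reduction

end ToricData

end

open ToricData

theorem corollary3p1 {n d : ℕ} (X : Fin d → Fin n → ℝ) (lam : Fin d → ℝ)
    (hΔ : IsSmoothPolyhedron X lam) (𝔨 : Submodule ℝ (Fin n → ℝ))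
    (hne : ((latticeData X lam).zeroLevel 𝔨).Nonempty)
    (hiso : (latticeData X lam).ZeroDimIsotropy 𝔨) :
    -- the triple of the reduced polyhedron is admissible, and its toric quasifold is one
    ((latticeData X lam).reducedData 𝔨).IsAdmissible ∧
    ((latticeData X lam).reducedData 𝔨).polyhedron = ((latticeData X lam).slice 𝔨).polyhedron ∧
    IsSymplecticQuasifold
      (((latticeData X lam).reducedData 𝔨).atlas (n - Module.finrank ℝ 𝔨)) ∧
    -- the reduced space is a symplectic quasifold, with the reduced symplectic form
    ∃ 𝒜 : Set (QChart (Fin (n - Module.finrank ℝ 𝔨) → ℂ) ((latticeData X lam).Reduced 𝔨)),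
      IsSymplecticQuasifold 𝒜 ∧
      IsReducedStructure ((latticeData X lam).atlas n) ((latticeData X lam).toReduced 𝔨) 𝒜 ∧
      -- the induced action of the quasitorus
      ∃ _ : AddAction
          (((Fin n → ℝ) ⧸ (latticeData X lam).Q) ⧸ (latticeData X lam).subgroupK 𝔨)
          ((latticeData X lam).Reduced 𝔨),
        (∀ (q : (Fin n → ℝ) ⧸ (latticeData X lam).Q) (x : (latticeData X lam).Reduced 𝔨),
          (QuotientAddGroup.mk q :
            ((Fin n → ℝ) ⧸ (latticeData X lam).Q) ⧸ (latticeData X lam).subgroupK 𝔨) +ᵥ x =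
            (latticeData X lam).reducedAct 𝔨 q x) ∧
        IsSmoothAction 𝒜 (fun (v : Fin n → ℝ) (x : (latticeData X lam).Reduced 𝔨) =>
          (QuotientAddGroup.mk (QuotientAddGroup.mk v) :
            ((Fin n → ℝ) ⧸ (latticeData X lam).Q) ⧸ (latticeData X lam).subgroupK 𝔨) +ᵥ x) ∧
        (∀ τ : ((Fin n → ℝ) ⧸ (latticeData X lam).Q) ⧸ (latticeData X lam).subgroupK 𝔨,
          IsSymplectomorphism 𝒜 𝒜 (fun x : (latticeData X lam).Reduced 𝔨 => τ +ᵥ x)) ∧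
        -- the equivariant symplectomorphism
        ∃ g : (latticeData X lam).Reduced 𝔨 → ((latticeData X lam).reducedData 𝔨).Space,
          IsSymplectomorphism 𝒜
            (((latticeData X lam).reducedData 𝔨).atlas (n - Module.finrank ℝ 𝔨)) g ∧
          ∀ (τ : ((Fin n → ℝ) ⧸ (latticeData X lam).Q) ⧸ (latticeData X lam).subgroupK 𝔨)
            (x : (latticeData X lam).Reduced 𝔨),
            g (τ +ᵥ x) =
              ((latticeData X lam).reducedData 𝔨).act ((latticeData X lam).residualHom 𝔨 τ) (g x) := by
  have hD : (latticeData X lam).IsRegular := hΔ.admissible.isRegular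
  have hslice : ((latticeData X lam).slice 𝔨).IsRegular := hD.slice hiso
  have hP : ((latticeData X lam).slice 𝔨).polyhedron.Nonempty :=
    nonempty_slice_polyhedron hD.span hne
  have hadm : ((latticeData X lam).reducedData 𝔨).IsAdmissible :=
    hslice.isAdmissible_restrict (IsQuasilattice.map hΔ.admissible.quasilattice 𝔨.mkQ_surjective) hP
      hslice.mem_sliceFacets_iff
  have hsuff : ((latticeData X lam).slice 𝔨).IsSufficient ((latticeData X lam).sliceFacets 𝔨) :=
    hslice.isSufficient_sliceFacets hadm hP
  have hm : n - Module.finrank ℝ 𝔨 = Module.finrank ℝ ((Fin n → ℝ) ⧸ 𝔨) := by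
    rw [Submodule.finrank_quotient, Module.finrank_fin_fun]
  have hqf := hadm.isRegular.isSymplecticQuasifold hm
  have hact := isSmoothAction_act (D := (latticeData X lam).reducedData 𝔨)
    (m := n - Module.finrank ℝ 𝔨) 𝔨.mkQ
  let e := reducedHomeo hD.span hsuff
  refine ⟨hadm, hsuff.polyhedron_eq, hqf, pushAtlas e _, hqf.push e,
    isReducedStructure hD.span hsuff n _, reducedAddAction hD.span hsuff hadm.isRegular.span,
    fun q x => ?_, hact.conj e.toEquiv, fun τ => ?_, e.symm, hqf.isSymplectomorphism_symm e,
    fun τ x => e.symm_apply_apply _⟩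
  · induction q using QuotientAddGroup.induction_on with
    | H v =>
      refine (reducedHomeo_act hD.span hsuff v (e.symm x)).trans ?_
      exact congrArg _ (e.apply_symm_apply x)
  · refine IsSymplectomorphism.conj ⟨isHomeomorph_act hadm.isRegular.span _, ?_⟩ e
    rintro _ ⟨F, rfl⟩ _ ⟨F', rfl⟩
    exact F.compatible_act F' _
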